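/- **Setting.** All vector spaces are over $\mathbb F=\mathbb Z/2$ and all tensor products are over $\mathbb F$. Let $\mathcal F_0$ be the free associative algebra on $Sq^n$, $n\ge1$ (with $Sq^0=1$, $|Sq^n|=n$), $\mathcal A$ the mod 2 Steenrod algebra, i.e. the quotient of $\mathcal F_0$ by the ideal $R_{\mathcal F}$ generated by the Adem relations $$[n,m]=Sq^nSq^m+\sum_{k}\binom{m-k-1}{n-2k}Sq^{n+m-k}Sq^k,\qquad 0<n<2m,\ 0\le k\le n/2,$$ and $q_{\mathcal F}:\mathcal F_0\to\mathcal A$ the projection. Both $\mathcal F_0$ and $\mathcal A$ carry the multiplicative diagonal $\delta(Sq^n)=\sum_{i+j=n}Sq^i\otimes Sq^j$. Put $\bar R=R_{\mathcal F}/R_{\mathcal F}^2$. It is an $\mathcal A$-$\mathcal A$-bimodule by multiplication in $\mathcal F_0$, and an $\mathcal A$-$\mathcal A$-bicomodule: for $r\in R_{\mathcal F}$ the element $\delta(r)$ lies in $\mathcal F_0\otimes R_{\mathcal F}+R_{\mathcal F}\otimes\mathcal F_0$, and the coactions $\Delta_\ell:\bar R\to\mathcal A\otimes\bar R$ and $\Delta_r:\bar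 R\to\bar R\otimes\mathcal A$ send the class of $r$ to the images of $\delta(r)$ under the map that kills $R_{\mathcal F}\otimes\mathcal F_0$, resp. $\mathcal F_0\otimes R_{\mathcal F}$. $\Sigma^{-1}\bar R$ is $\bar R$ with degrees lowered by one. $T$ is the interchange of tensor factors. $\mathcal A_*$ and $\Sigma^{-1}\bar R_*$ are the graded duals of $\mathcal A$ and $\Sigma^{-1}\bar R$; $m_*,\delta_*$ are dual to the product and diagonal of $\mathcal A$. **Symmetry operator.** Let $\kappa$ be the derivation of $\mathcal A$ with $\kappa(Sq^n)=Sq^{n-1}$ for $n\ge1$. Let $S_n=\sum Sq^a\otimes Sq^b$ over odd $a,b$ with $a+b=n-1$, let $S_{\mathcal F}(Sq^nSq^m)=S_n\delta(Sq^m)+\delta(Sq^n)S_m+\delta(Sq^{n-1})S_{m+1}$ and $L_{\mathcal F}(Sq^nSq^m)=\sum Sq^aSq^c\otimes Sq^bSq^d$ over $a+b=n$, $c+d=m$ with $b,c$ odd, and let $S_R[n,m]$, $L_R[n,m]\in\mathcal A\otimes\mathcal A$ be obtained by applying $S_{\mathcal F}$, $L_{\mathcal F}$ to the terms of $[n,m]$.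 A symmetry operator is a degree-preserving linear map $S:\Sigma^{-1}\bar R\to\mathcal A\otimes\mathcal A$ with $S(ra)=S(r)\delta(a)$ for $a\in\mathcal A$ and $$S(\alpha[n,m])=\delta(\alpha)S_R[n,m]+(1+T)\bigl(\delta(\kappa(\alpha))L_R[n,m]\bigr)$$ whenever $0<n<2m$ and $\alpha$ is a monomial such that $\alpha Sq^n$ is admissible. **Singular extensions.** For a graded algebra and coalgebra $A$ and a graded vector space $R$, a singular extension of $A$ by $R$ is a direct sum diagram of graded vector spaces $$R\underset{q}{\overset{i}{\rightleftarrows}}\hat A\underset{s}{\overset{p}{\rightleftarrows}}A,\qquad ps=1,\ qi=1,\ sp+iq=1,$$ where $\hat A$ is a graded algebra and a graded coalgebra with diagonal $\hat\delta$ (no compatibility of product and diagonal is required), $p$ is an algebra homomorphism, $s$ is a coalgebra homomorphism, $i(R)\cdot i(R)=0$ and $(q\otimes q)\hat\delta=0$. **Theorem.** There is exactly one symmetry operator $S$, and the following hold. (1) There is a singular extension $\Sigma^{-1}\bar R\rightleftarrows\hat{\mathcal A}\rightleftarrows\mathcal A$ such that, as an algebra, $\hat{\mathcal A}=\mathcal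 A\oplus\Sigma^{-1}\bar R$ is the semidirect product $(a,r)(a',r')=(aa',ar'+ra')$, the induced $\mathcal A$-$\mathcal A$-bimodule and $\mathcal A$-$\mathcal A$-bicomodule structures on $\Sigma^{-1}\bar R$ are the ones above (for the bicomodule structure: $(1\otimes q)\hat\delta=(s\otimes1)\Delta_\ell q$ and $(q\otimes1)\hat\delta=(1\otimes s)\Delta_rq$), and $$(1+T)\hat\delta=(s\otimes s)\,S\,q.$$ It is unique in the following sense: for any two such extensions the canonical isomorphism of direct sum diagrams is an isomorphism of algebras, and there is an isomorphism of graded coalgebras between them that is compatible with $s$ and $q$. (2) There is a singular extension $\Sigma^{-1}\bar R_*\rightleftarrows\hat{\mathcal A}_*\rightleftarrows\mathcal A_*$, whose structure maps we again call $i,q,p,s$, such that, as a coalgebra, $\hat{\mathcal A}_*=\mathcal A_*\oplus\Sigma^{-1}\bar R_*$ has the diagonal with components $m_*$ on $\mathcal A_*$ and the duals of the left and right actions of $\mathcal A$ on $\bar R$ on $\Sigma^{-1}\bar R_*$, the induced $\mathcal A_*$-$\mathcal A_*$-bimodule structure on $\Sigma^{-1}\bar R_*$ is dual to $\Delta_\ell,\Delta_r$,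 and for all $x,y\in\mathcal A_*$ $$s(y)s(x)=s(x)s(y)+i\,S_*(x\otimes y),\qquad S_*(x\otimes y)=(x\otimes y)\circ S.$$ It is unique in the following sense: for any two such extensions the canonical isomorphism of direct sum diagrams is an isomorphism of coalgebras, and there is an isomorphism of graded algebras between them that is compatible with $i$ and $p$. -/

import Mathlib

open scoped TensorProduct

namespace AdemAux

theorem adem_binomial_core (n m : ℕ) (h : n < 2 * m) :
    ((Nat.choose (n + m) n : ℕ) : ZMod 2) =
      ∑ l ∈ Finset.range (n / 2 + 1),
        ((Nat.choose (m - l - 1) (n - 2 * l) * Nat.choose (n + m) l : ℕ) : ZMod 2) := by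
  classical
  obtain ⟨v, hv⟩ : ∃ v : PowerSeries (ZMod 2), v = PowerSeries.mk 1 := ⟨_, rfl⟩
  obtain ⟨c, hc⟩ : ∃ c : PowerSeries (ZMod 2), c = 1 + PowerSeries.X := ⟨_, rfl⟩
  have hvc : v * c = 1 := by
    have := PowerSeries.mk_one_mul_one_sub_eq_one (ZMod 2)
    have h2 : (1 : PowerSeries (ZMod 2)) - PowerSeries.X = 1 + PowerSeries.X := by
      ext i; simp [CharTwo.sub_eq_add]
    rw [hv, hc, ← h2, this]
  have hcv (i : ℕ) : c ^ i * v ^ i = 1 := by rw [← mul_pow, mul_comm, hvc, one_pow]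
  have key : (PowerSeries.X ^ 2 + c) ^ (n + m) * v ^ (n + 1)
      = (PowerSeries.X * c + 1) ^ (n + m) * v ^ (n + 1) := by
    congr 2; rw [hc]; ring
  have e1 : PowerSeries.coeff n ((PowerSeries.X * c + 1) ^ (n + m) * v ^ (n + 1))
      = ((Nat.choose (n + m) n : ℕ) : ZMod 2) := by
    rw [add_pow, Finset.sum_mul, map_sum, Finset.sum_eq_single n]
    · have : (PowerSeries.X * c) ^ n * 1 ^ (n + m - n) * ((Nat.choose (n + m) n : ℕ) : PowerSeries (ZMod 2))
          * v ^ (n + 1) = ((Nat.choose (n + m) n : ℕ) : PowerSeries (ZMod 2)) *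
            (PowerSeries.X ^ n * ((c ^ n * v ^ n) * v)) := by ring
      rw [this, hcv, one_mul, ← map_natCast (PowerSeries.C (R := ZMod 2)), PowerSeries.coeff_C_mul]
      have := PowerSeries.coeff_X_pow_mul v n 0
      rw [zero_add] at this
      rw [this]; simp [hv]
    · intro a _ ha
      have : (PowerSeries.X * c) ^ a * 1 ^ (n + m - a) * ((Nat.choose (n + m) a : ℕ) : PowerSeries (ZMod 2))
          * v ^ (n + 1) = ((Nat.choose (n + m) a : ℕ) : PowerSeries (ZMod 2)) *
            (PowerSeries.X ^ a * (c ^ a * v ^ (n + 1))) := by ring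
      rw [this, ← map_natCast (PowerSeries.C (R := ZMod 2)), PowerSeries.coeff_C_mul,
        PowerSeries.coeff_X_pow_mul']
      split_ifs with hle
      · obtain ⟨d, rfl⟩ := Nat.exists_eq_add_of_le hle
        have hd : d ≠ 0 := by rintro rfl; simp at ha
        have : c ^ a * v ^ (a + d + 1) = v ^ (d + 1) := by
          rw [add_assoc, pow_add, ← mul_assoc, hcv, one_mul]
        rw [this, hv, PowerSeries.mk_one_pow_eq_mk_choose_add, PowerSeries.coeff_mk,
          Nat.add_sub_cancel_left]
        have h2 : 2 ∣ (d + d).choose d := by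
          have := Nat.two_dvd_centralBinom_of_one_le (Nat.one_le_iff_ne_zero.2 hd)
          rwa [Nat.centralBinom, two_mul] at this
        have h3 : (((d + d).choose d : ℕ) : ZMod 2) = 0 := (ZMod.natCast_eq_zero_iff _ _).2 h2
        rw [h3, mul_zero]
      · simp
    · intro hn; exfalso; apply hn; simp
  have e2 : PowerSeries.coeff n ((PowerSeries.X ^ 2 + c) ^ (n + m) * v ^ (n + 1))
      = ∑ l ∈ Finset.range (n / 2 + 1),
        ((Nat.choose (m - l - 1) (n - 2 * l) * Nat.choose (n + m) l : ℕ) : ZMod 2) := by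
    rw [add_pow, Finset.sum_mul, map_sum]
    have hsub : Finset.range (n / 2 + 1) ⊆ Finset.range (n + m + 1) := by
      intro l hl; simp only [Finset.mem_range] at *; omega
    have hterm (l : ℕ) : (PowerSeries.X ^ 2 : PowerSeries (ZMod 2)) ^ l * c ^ (n + m - l)
          * ((Nat.choose (n + m) l : ℕ) : PowerSeries (ZMod 2)) * v ^ (n + 1)
          = ((Nat.choose (n + m) l : ℕ) : PowerSeries (ZMod 2)) *
            (PowerSeries.X ^ (2 * l) * (c ^ (n + m - l) * v ^ (n + 1))) := by ring
    rw [← Finset.sum_subset hsub]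
    · apply Finset.sum_congr rfl
      intro l hl
      simp only [Finset.mem_range] at hl
      rw [hterm, ← map_natCast (PowerSeries.C (R := ZMod 2)), PowerSeries.coeff_C_mul,
        PowerSeries.coeff_X_pow_mul', if_pos (by omega)]
      have : c ^ (n + m - l) * v ^ (n + 1) = c ^ (m - l - 1) := by
        have e : n + m - l = (m - l - 1) + (n + 1) := by omega
        rw [e, pow_add, mul_assoc, hcv, mul_one]
      rw [this]
      have e3 : PowerSeries.coeff (n - 2 * l) (c ^ (m - l - 1))
          = (((m - l - 1).choose (n - 2 * l) : ℕ) : ZMod 2) := by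
        have : c ^ (m - l - 1) = (((1 + Polynomial.X) ^ (m - l - 1) : Polynomial (ZMod 2)) :
            PowerSeries (ZMod 2)) := by simp [hc]
        rw [this, Polynomial.coeff_coe, Polynomial.coeff_one_add_X_pow]
      rw [e3]; push_cast; ring
    · intro l _ hl
      simp only [Finset.mem_range] at hl
      rw [hterm, ← map_natCast (PowerSeries.C (R := ZMod 2)), PowerSeries.coeff_C_mul,
        PowerSeries.coeff_X_pow_mul', if_neg (by omega), mul_zero]
  rw [← e1, ← e2, key]

end AdemAux

/-- For a function `f` of two indices, the combination
`f n m + ∑ k, (m - k - 1 choose n - 2 k) f (n + m - k) k` over `0 ≤ k ≤ n / 2` that occurs in the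
Adem relations. -/
def ademSum {M : Type*} [AddCommGroup M] [Module (ZMod 2) M] (f : ℕ → ℕ → M) (n m : ℕ) : M :=
  f n m + ∑ k ∈ Finset.range (n / 2 + 1),
    ((Nat.choose (m - k - 1) (n - 2 * k) : ℕ) : ZMod 2) • f (n + m - k) k

namespace AdemAux

/-- The coefficients in the expansion of products of squares in the algebra of families that satisfy
the Adem relations. -/
def coef (i j a : ℕ) : ZMod 2 := if 2 * j ≤ a then ((Nat.choose i (a - 2 * j) : ℕ) : ZMod 2) else 0

theorem coef_eq_zero (i j a : ℕ) (h : i + 2 * j < a) : coef i j a = 0 := by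
  unfold coef
  split_ifs with h1
  · rw [Nat.choose_eq_zero_of_lt (by omega), Nat.cast_zero]
  · rfl

theorem coef_adem (n m i j : ℕ) (h : n < 2 * m) (hij : i + 3 * j = n + m) :
    coef i j n = ∑ k ∈ Finset.range (n / 2 + 1),
      ((Nat.choose (m - k - 1) (n - 2 * k) : ℕ) : ZMod 2) * coef i j (n + m - k) := by
  by_cases hj : 2 * j ≤ n
  · obtain ⟨n', rfl⟩ := Nat.exists_eq_add_of_le hj
    obtain ⟨m', rfl⟩ : ∃ m', m = j + m' := Nat.exists_eq_add_of_le (by omega)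
    obtain rfl : i = n' + m' := by omega
    have e : (2 * j + n') / 2 + 1 = j + (n' / 2 + 1) := by omega
    rw [e, Finset.sum_range_add, Finset.sum_eq_zero, zero_add]
    · rw [coef, if_pos hj, Nat.add_sub_cancel_left, adem_binomial_core n' m' (by omega)]
      apply Finset.sum_congr rfl
      intro l hl
      simp only [Finset.mem_range] at hl
      rw [coef, if_pos (by omega), Nat.cast_mul]
      congr 2
      · congr 1 <;> omega
      · have : 2 * j + n' + (j + m') - (j + l) - 2 * j = n' + m' - l := by omega
        rw [this, Nat.choose_symm (by omega)]
    · intro k hk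
      simp only [Finset.mem_range] at hk
      rw [coef_eq_zero _ _ _ (by omega), mul_zero]
  · rw [coef, if_neg hj, Finset.sum_eq_zero]
    intro k hk
    simp only [Finset.mem_range] at hk
    rw [coef_eq_zero _ _ _ (by omega), mul_zero]

theorem coef_vandermonde (i j i' j' a : ℕ) :
    ∑ p ∈ Finset.HasAntidiagonal.antidiagonal a, coef i j p.1 * coef i' j' p.2 = coef (i + i') (j + j') a := by
  have key (i j : ℕ) : ∀ a, coef i j a =
      ((Polynomial.X ^ (2 * j) * (1 + Polynomial.X) ^ i : Polynomial (ZMod 2))).coeff a := by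
    intro a
    rw [Polynomial.coeff_X_pow_mul', Polynomial.coeff_one_add_X_pow]; rfl
  simp_rw [key]
  rw [← Polynomial.coeff_mul]
  congr 1; ring

variable {B : Type*} [Ring B] [Algebra (ZMod 2) B]

theorem ademSum_eq_zero {N : ℕ} {ι : Type*} (T : Finset ι) (j : ι → ℕ) (V : ι → B)
    (hj : ∀ t ∈ T, 3 * j t ≤ N) (f : ℕ → ℕ → B)
    (hf : ∀ a b, a + b = N → f a b = ∑ t ∈ T, coef (N - 3 * j t) (j t) a • V t)
    (n m : ℕ) (h : n < 2 * m) (hN : n + m = N) : ademSum f n m = 0 := by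
  unfold ademSum
  have e : ∑ k ∈ Finset.range (n / 2 + 1),
      ((Nat.choose (m - k - 1) (n - 2 * k) : ℕ) : ZMod 2) • f (n + m - k) k = f n m := by
    rw [hf n m hN]
    rw [Finset.sum_congr rfl (fun k hk => by
      rw [hf (n + m - k) k (by simp only [Finset.mem_range] at hk; omega), Finset.smul_sum])]
    rw [Finset.sum_comm]
    apply Finset.sum_congr rfl
    intro t ht
    have := hj t ht
    rw [coef_adem n m (N - 3 * j t) (j t) h (by omega), Finset.sum_smul]
    simp_rw [mul_smul]
  rw [e, ← two_smul (ZMod 2), show (2 : ZMod 2) = 0 from rfl, zero_smul]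

/-- The family `X` satisfies the Adem relations. -/
def IsAdemFamily (X : ℕ → B) : Prop :=
  X 0 = 1 ∧ ∀ n m, 0 < n → n < 2 * m → ademSum (fun a b => X a * X b) n m = 0

/-- The elements in terms of which the products `X a * X b` with `a + b = N` are expanded. -/
def milnor (X : ℕ → B) (N : ℕ) : ℕ → B
  | j => X (N - j) * X j - ∑ i : Fin j, coef (N - 3 * i) i (N - j) • milnor X N i
termination_by j => j
decreasing_by exact i.2

theorem IsAdemFamily.expand {X : ℕ → B} (hX : IsAdemFamily X) (N : ℕ) : ∀ b a : ℕ, a + b = N →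
    X a * X b = ∑ j ∈ Finset.range (N / 3 + 1), coef (N - 3 * j) j a • milnor X N j := by
  intro b
  induction b using Nat.strong_induction_on with
  | _ b ih =>
    intro a hab
    by_cases hadm : 2 * b ≤ a
    · have e : N / 3 + 1 = (b + 1) + (N / 3 - b) := by omega
      rw [e, Finset.sum_range_add, Finset.sum_range_succ]
      rw [Finset.sum_eq_zero (s := Finset.range (N / 3 - b)), add_zero]
      · rw [milnor.eq_1 X N b, Finset.sum_range (fun j => coef (N - 3 * j) j a • milnor X N j)]
        have e1 : coef (N - 3 * b) b a = 1 := by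
          rw [coef, if_pos hadm, show N - 3 * b = a - 2 * b by omega]; simp
        have e2 : N - b = a := by omega
        rw [e1, one_smul, e2]; abel
      · intro k hk
        simp only [Finset.mem_range] at hk
        rw [coef_eq_zero _ _ _ (by omega), zero_smul]
    · have e0 : X a * X b = ∑ k ∈ Finset.range (a / 2 + 1),
          ((Nat.choose (b - k - 1) (a - 2 * k) : ℕ) : ZMod 2) • (X (a + b - k) * X k) := by
        rcases Nat.eq_zero_or_pos a with rfl | ha
        · simp [hX.1]
        · have := hX.2 a b ha (by omega)
          unfold ademSum at this
          have h2 : ∀ x y : B, x + y = 0 → x = y := by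
            intro x y hxy
            have h3 : y + y = 0 := by
              rw [← two_smul (ZMod 2), show (2 : ZMod 2) = 0 from rfl, zero_smul]
            exact add_right_cancel (hxy.trans h3.symm)
          exact h2 _ _ this
      rw [e0]
      rw [Finset.sum_congr rfl (fun k hk => by
        simp only [Finset.mem_range] at hk
        rw [ih k (by omega) (a + b - k) (by omega), Finset.smul_sum])]
      rw [Finset.sum_comm]
      apply Finset.sum_congr rfl
      intro j hj
      simp only [Finset.mem_range] at hj
      rw [coef_adem a b (N - 3 * j) j (by omega) (by omega), Finset.sum_smul]
      simp_rw [mul_smul]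

theorem IsAdemFamily.conv {X Y : ℕ → B} (hX : IsAdemFamily X) (hY : IsAdemFamily Y)
    (hXY : ∀ i j, Commute (X i) (Y j)) :
    IsAdemFamily (fun n => ∑ p ∈ Finset.HasAntidiagonal.antidiagonal n, X p.1 * Y p.2) := by
  refine ⟨by simp [hX.1, hY.1], ?_⟩
  intro n m _ hnm
  let T : Finset (Σ _ : ℕ × ℕ, ℕ × ℕ) := (Finset.HasAntidiagonal.antidiagonal (n + m)).sigma
    (fun p => Finset.range (p.1 / 3 + 1) ×ˢ Finset.range (p.2 / 3 + 1))
  refine ademSum_eq_zero (N := n + m) T (fun t => t.2.1 + t.2.2)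
    (fun t => milnor X t.1.1 t.2.1 * milnor Y t.1.2 t.2.2) ?_ _ ?_ n m hnm rfl
  · rintro ⟨⟨N1, N2⟩, j1, j2⟩ ht
    simp only [T, Finset.mem_sigma, Finset.HasAntidiagonal.mem_antidiagonal, Finset.mem_product,
      Finset.mem_range] at ht
    simp only; omega
  · intro a b hab
    simp only
    have hG (N1 N2 a1 b1 a2 b2 : ℕ) (h1 : a1 + b1 = N1) (h2 : a2 + b2 = N2) :
        X a1 * Y a2 * (X b1 * Y b2) = ∑ j ∈ Finset.range (N1 / 3 + 1) ×ˢ Finset.range (N2 / 3 + 1),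
          (coef (N1 - 3 * j.1) j.1 a1 * coef (N2 - 3 * j.2) j.2 a2) •
            (milnor X N1 j.1 * milnor Y N2 j.2) := by
      have : X a1 * Y a2 * (X b1 * Y b2) = (X a1 * X b1) * (Y a2 * Y b2) := by
        rw [mul_assoc, ← mul_assoc (Y a2), ← (hXY b1 a2).eq]; noncomm_ring
      rw [this, hX.expand N1 b1 a1 h1, hY.expand N2 b2 a2 h2, Finset.sum_mul_sum,
        Finset.sum_product]
      simp_rw [smul_mul_smul_comm]
    rw [Finset.sum_sigma]
    have hV (p : ℕ × ℕ) (hp : p ∈ Finset.HasAntidiagonal.antidiagonal (n + m)) :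
        ∑ j ∈ Finset.range (p.1 / 3 + 1) ×ˢ Finset.range (p.2 / 3 + 1),
          coef (n + m - 3 * (j.1 + j.2)) (j.1 + j.2) a •
            (milnor X p.1 j.1 * milnor Y p.2 j.2)
        = ∑ q ∈ (Finset.HasAntidiagonal.antidiagonal a).filter (fun q => q.1 ≤ p.1 ∧ q.2 ≤ p.2),
            X q.1 * Y q.2 * (X (p.1 - q.1) * Y (p.2 - q.2)) := by
      simp only [Finset.HasAntidiagonal.mem_antidiagonal] at hp
      have h1 : ∀ q ∈ (Finset.HasAntidiagonal.antidiagonal a).filter (fun q => q.1 ≤ p.1 ∧ q.2 ≤ p.2),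
          X q.1 * Y q.2 * (X (p.1 - q.1) * Y (p.2 - q.2)) =
          ∑ j ∈ Finset.range (p.1 / 3 + 1) ×ˢ Finset.range (p.2 / 3 + 1),
          (coef (p.1 - 3 * j.1) j.1 q.1 * coef (p.2 - 3 * j.2) j.2 q.2) •
            (milnor X p.1 j.1 * milnor Y p.2 j.2) := by
        intro q hq
        simp only [Finset.mem_filter, Finset.HasAntidiagonal.mem_antidiagonal] at hq
        exact hG _ _ _ _ _ _ (by omega) (by omega)
      rw [Finset.sum_congr rfl h1, Finset.sum_comm]
      apply Finset.sum_congr rfl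
      rintro ⟨j1, j2⟩ hj
      simp only [Finset.mem_product, Finset.mem_range] at hj
      simp only
      rw [← Finset.sum_smul]
      congr 1
      have e : n + m - 3 * (j1 + j2) = (p.1 - 3 * j1) + (p.2 - 3 * j2) := by omega
      rw [e, ← coef_vandermonde, Finset.sum_filter_of_ne]
      intro q hq hne
      by_contra hcon
      apply hne
      rw [not_and_or] at hcon
      rcases hcon with h | h
      · rw [coef_eq_zero _ _ q.1 (by omega), zero_mul]
      · rw [coef_eq_zero _ _ q.2 (by omega), mul_zero]
    rw [Finset.sum_congr rfl hV, Finset.sum_mul_sum]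
    rw [← Finset.sum_product', Finset.sum_sigma']
    refine Finset.sum_bij' (fun t _ => ⟨(t.1.1 + t.2.1, t.1.2 + t.2.2), t.1⟩)
      (fun s _ => (s.2, (s.1.1 - s.2.1, s.1.2 - s.2.2))) ?_ ?_ ?_ ?_ ?_
    · rintro ⟨⟨a1, a2⟩, b1, b2⟩ ht
      simp only [Finset.mem_product, Finset.HasAntidiagonal.mem_antidiagonal, Finset.mem_sigma,
        Finset.mem_filter] at *
      omega
    · rintro ⟨⟨N1, N2⟩, a1, a2⟩ ht
      simp only [Finset.mem_product, Finset.HasAntidiagonal.mem_antidiagonal, Finset.mem_sigma,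
        Finset.mem_filter] at *
      omega
    · rintro ⟨⟨a1, a2⟩, b1, b2⟩ ht
      simp
    · rintro ⟨⟨N1, N2⟩, a1, a2⟩ ht
      simp only [Finset.HasAntidiagonal.mem_antidiagonal, Finset.mem_sigma,
        Finset.mem_filter] at ht
      have h1 : a1 + (N1 - a1) = N1 := by omega
      have h2 : a2 + (N2 - a2) = N2 := by omega
      simp [h1, h2]
    · rintro ⟨⟨a1, a2⟩, b1, b2⟩ ht
      simp

end AdemAux

namespace GradedAux
noncomputable section
variable {k U V W : Type} [Field k] [AddCommGroup U] [Module k U] [AddCommGroup V] [Module k V]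
  [AddCommGroup W] [Module k W]

/-- The degree `n` part of the tensor product of two graded vector spaces. -/
def tensorGr (𝒰 : ℕ → Submodule k U) (𝒱 : ℕ → Submodule k V) (n : ℕ) : Submodule k (U ⊗[k] V) :=
  Submodule.span k {t | ∃ i j, i + j = n ∧ ∃ u ∈ 𝒰 i, ∃ v ∈ 𝒱 j, t = u ⊗ₜ[k] v}

/-- The graded dual of a graded vector space: the linear forms that vanish in all but finitely many
degrees. -/
def gradedDual (𝒱 : ℕ → Submodule k V) : Submodule k (Module.Dual k V) where
  carrier := {f | ∃ N, ∀ n, N ≤ n → ∀ v ∈ 𝒱 n, f v = 0}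
  zero_mem' := ⟨0, fun _ _ _ _ => rfl⟩
  add_mem' := by
    rintro f g ⟨N, hf⟩ ⟨M, hg⟩
    refine ⟨max N M, fun n hn v hv => ?_⟩
    rw [LinearMap.add_apply, hf n (le_of_max_le_left hn) v hv,
      hg n (le_of_max_le_right hn) v hv, add_zero]
  smul_mem' := by
    rintro c f ⟨N, hf⟩
    exact ⟨N, fun n hn v hv => by rw [LinearMap.smul_apply, hf n hn v hv, smul_zero]⟩

/-- The linear form on `U ⊗ V` given by a tensor of linear forms on `U` and on `V`. -/
def pairing {M N : Type} [AddCommMonoid M] [Module k M] [AddCommMonoid N] [Module k N]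
    (j : M →ₗ[k] Module.Dual k U) (j' : N →ₗ[k] Module.Dual k V) :
    M ⊗[k] N →ₗ[k] Module.Dual k (U ⊗[k] V) :=
  TensorProduct.dualDistrib k U V ∘ₗ TensorProduct.map j j'

section
variable {M N : Type} [AddCommMonoid M] [Module k M] [AddCommMonoid N] [Module k N]
    (j : M →ₗ[k] Module.Dual k U) (j' : N →ₗ[k] Module.Dual k V)

@[simp] theorem pairing_tmul (x : M) (y : N) (u : U) (v : V) :
    pairing j j' (x ⊗ₜ y) (u ⊗ₜ v) = j x u * j' y v := by
  simp [pairing]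

theorem pairing_injective (hj : Function.Injective j) (hj' : Function.Injective j') :
    Function.Injective (pairing j j') := by
  classical
  let _ : AddCommGroup M := Module.addCommMonoidToAddCommGroup k
  let _ : AddCommGroup N := Module.addCommMonoidToAddCommGroup k
  rw [injective_iff_map_eq_zero]
  intro t ht
  let b := Module.Basis.ofVectorSpace k M
  obtain ⟨c, rfl⟩ := (TensorProduct.equivFinsuppOfBasisLeft (N := N) b).symm.surjective t
  suffices c = 0 by rw [this, map_zero]
  ext i
  apply hj'
  ext v
  have h : ∑ i ∈ c.support, j' (c i) v • b i = 0 := by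
    apply hj
    ext u
    have := LinearMap.congr_fun ht (u ⊗ₜ v)
    rw [TensorProduct.equivFinsuppOfBasisLeft_symm_apply, Finsupp.sum, map_sum] at this
    simpa [mul_comm] using this
  have h2 := (linearIndependent_iff'.1 b.linearIndependent) _ _ h i
  by_cases hi : i ∈ c.support
  · simpa using h2 hi
  · rw [Finsupp.notMem_support_iff.1 hi]; simp

end

/-- `𝒱` spans `V`, and the projections of `V` onto its parts of degree less than `N` exist
and have finite rank. -/
def HasTruncations (𝒱 : ℕ → Submodule k V) : Prop :=
  (⨆ n, 𝒱 n) = ⊤ ∧ ∀ N, ∃ τ : V →ₗ[k] V, FiniteDimensional k (LinearMap.range τ) ∧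
    (∀ n, N ≤ n → ∀ v ∈ 𝒱 n, τ v = 0) ∧ ∀ n, n < N → ∀ v ∈ 𝒱 n, τ v = v

theorem exists_pairing {𝒰 : ℕ → Submodule k U} {𝒱 : ℕ → Submodule k V} (h𝒰 : HasTruncations 𝒰)
    (f : Module.Dual k (U ⊗[k] V)) (N : ℕ)
    (hN : ∀ i j, N ≤ i + j → ∀ u ∈ 𝒰 i, ∀ v ∈ 𝒱 j, f (u ⊗ₜ v) = 0) (htop : (⨆ n, 𝒱 n) = ⊤) :
    ∃ t, pairing (gradedDual 𝒰).subtype (gradedDual 𝒱).subtype t = f := by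
  obtain ⟨τ, hfin, h0, h1⟩ := h𝒰.2 N
  let b := Module.finBasis k (LinearMap.range τ)
  let e (i) : Module.Dual k U := (b.coord i) ∘ₗ τ.rangeRestrict
  have he (i) : e i ∈ gradedDual 𝒰 := ⟨N, fun n hn u hu => by
    have : τ.rangeRestrict u = 0 := Subtype.ext (h0 n hn u hu)
    simp [e, this]⟩
  let g (i) : Module.Dual k V := f ∘ₗ TensorProduct.mk k U V (b i)
  have hg (i) : g i ∈ gradedDual 𝒱 := by
    refine ⟨N, fun n hn v hv => ?_⟩
    have : ∀ u : U, f (u ⊗ₜ v) = 0 := by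
      intro u
      have hu : u ∈ ⨆ n, 𝒰 n := by rw [h𝒰.1]; trivial
      induction hu using Submodule.iSup_induction' with
      | mem i u hu => exact hN i n (by omega) u hu v hv
      | zero => simp
      | add x y _ _ hx hy => rw [TensorProduct.add_tmul, map_add, hx, hy, add_zero]
    exact this _
  refine ⟨∑ i, (⟨e i, he i⟩ : gradedDual 𝒰) ⊗ₜ (⟨g i, hg i⟩ : gradedDual 𝒱), ?_⟩
  apply TensorProduct.ext'
  intro u v
  have key : f (u ⊗ₜ v) = f (τ u ⊗ₜ v) := by
    have hu : u ∈ ⨆ n, 𝒰 n := by rw [h𝒰.1]; trivial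
    induction hu using Submodule.iSup_induction' with
    | mem i u hu =>
      by_cases hi : i < N
      · rw [h1 i hi u hu]
      · rw [h0 i (by omega) u hu, TensorProduct.zero_tmul, map_zero]
        have hv : v ∈ ⨆ n, 𝒱 n := by rw [htop]; trivial
        induction hv using Submodule.iSup_induction' with
        | mem j v hv => exact hN i j (by omega) u hu v hv
        | zero => simp
        | add x y _ _ hx hy => rw [TensorProduct.tmul_add, map_add, hx, hy, add_zero]
    | zero => simp
    | add x y _ _ hx hy =>
      rw [TensorProduct.add_tmul, map_add, hx, hy, map_add, TensorProduct.add_tmul, map_add]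
  rw [key]
  have h3 : τ u = ∑ i, e i u • (b i : U) := by
    have h4 := congrArg (LinearMap.range τ).subtype (b.sum_repr (τ.rangeRestrict u))
    rw [map_sum] at h4
    exact h4.symm
  rw [h3, TensorProduct.sum_tmul, map_sum, map_sum, LinearMap.sum_apply]
  apply Finset.sum_congr rfl
  intro i _
  rw [pairing_tmul, ← TensorProduct.smul_tmul', map_smul]
  rfl

variable {A : Type} [Ring A] [Bialgebra k A]

/-- `𝒜` is a grading of the bialgebra `A` for which the multiplication and the diagonal preserve
degrees, with finite dimensional truncations. -/
class GradedBialgebra (𝒜 : ℕ → Submodule k A) : Prop where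
  trunc : HasTruncations 𝒜
  one_mem : (1 : A) ∈ 𝒜 0
  mul_mem : ∀ {i j a b}, a ∈ 𝒜 i → b ∈ 𝒜 j → a * b ∈ 𝒜 (i + j)
  comul_mem : ∀ {n a}, a ∈ 𝒜 n → Coalgebra.comul (R := k) a ∈ tensorGr 𝒜 𝒜 n
  counit_eq_zero : ∀ {n a}, n ≠ 0 → a ∈ 𝒜 n → Coalgebra.counit (R := k) a = 0

/-- The graded dual of a graded bialgebra, as a subalgebra of the convolution algebra: the product
is dual to the diagonal, the unit is the counit. -/
def dualSubalgebra (𝒜 : ℕ → Submodule k A) [GradedBialgebra 𝒜] :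
    Subalgebra k (WithConv (A →ₗ[k] k)) where
  carrier := {f | f.ofConv ∈ gradedDual 𝒜}
  add_mem' := fun hf hg => (gradedDual 𝒜).add_mem hf hg
  mul_mem' := by
    rintro f g ⟨N, hf⟩ ⟨M, hg⟩
    refine ⟨N + M, fun n hn v hv => ?_⟩
    have h := GradedBialgebra.comul_mem hv
    change LinearMap.mul' k k (TensorProduct.map f.ofConv g.ofConv (Coalgebra.comul (R := k) v)) = 0
    generalize Coalgebra.comul (R := k) v = z at h
    induction h using Submodule.span_induction with
    | mem t ht =>
      obtain ⟨i, j, rfl, u, hu, w, hw, rfl⟩ := ht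
      by_cases hi : N ≤ i
      · simp [hf i hi u hu]
      · simp [hg j (by omega) w hw]
    | zero => simp
    | add x y _ _ hx hy => rw [map_add, map_add, hx, hy, add_zero]
    | smul c x _ hx => rw [map_smul, map_smul, hx, smul_zero]
  algebraMap_mem' := by
    intro r
    refine ⟨1, fun n hn v hv => ?_⟩
    change r • algebraMap k k (Coalgebra.counit (R := k) v) = 0
    rw [GradedBialgebra.counit_eq_zero (by omega) hv, map_zero, smul_zero]

/-- The graded dual `A_*` of a graded bialgebra `A`. -/
def DualAlg (𝒜 : ℕ → Submodule k A) [GradedBialgebra 𝒜] : Type := dualSubalgebra 𝒜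

variable (𝒜 : ℕ → Submodule k A) [GradedBialgebra 𝒜]

instance : Ring (DualAlg 𝒜) := inferInstanceAs (Ring (dualSubalgebra 𝒜))
instance : Algebra k (DualAlg 𝒜) := inferInstanceAs (Algebra k (dualSubalgebra 𝒜))

/-- An element of `A_*`, as a linear form on `A`. -/
def DualAlg.toDual : DualAlg 𝒜 →ₗ[k] Module.Dual k A where
  toFun f := f.1.ofConv
  map_add' _ _ := rfl
  map_smul' _ _ := rfl

theorem DualAlg.toDual_injective : Function.Injective (DualAlg.toDual 𝒜) := by
  intro f g h
  exact Subtype.ext (congrArg WithConv.toConv h)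

theorem DualAlg.exists_comul (f : DualAlg 𝒜) : ∃ t : DualAlg 𝒜 ⊗[k] DualAlg 𝒜,
    pairing (DualAlg.toDual 𝒜) (DualAlg.toDual 𝒜) t = DualAlg.toDual 𝒜 f ∘ₗ LinearMap.mul' k A := by
  obtain ⟨N, hN⟩ := f.2
  obtain ⟨t, ht⟩ := exists_pairing (𝒰 := 𝒜) (𝒱 := 𝒜) GradedBialgebra.trunc
    (DualAlg.toDual 𝒜 f ∘ₗ LinearMap.mul' k A) N (fun i j hij u hu v hv => by
      exact hN (i + j) hij _ (GradedBialgebra.mul_mem hu hv)) GradedBialgebra.trunc.1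
  let e : gradedDual 𝒜 →ₗ[k] DualAlg 𝒜 :=
    { toFun := fun f => ⟨WithConv.toConv f.1, f.2⟩
      map_add' := fun _ _ => rfl
      map_smul' := fun _ _ => rfl }
  refine ⟨TensorProduct.map e e t, ?_⟩
  rw [← ht, pairing, pairing, LinearMap.comp_apply, LinearMap.comp_apply]
  congr 1
  rw [← LinearMap.comp_apply, ← TensorProduct.map_comp]
  rfl

/-- The diagonal of `A_*`, dual to the multiplication of `A`. -/
def DualAlg.comulAux : DualAlg 𝒜 →ₗ[k] DualAlg 𝒜 ⊗[k] DualAlg 𝒜 :=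
  (LinearEquiv.ofInjective _ (pairing_injective _ _ (DualAlg.toDual_injective 𝒜)
    (DualAlg.toDual_injective 𝒜))).symm.toLinearMap ∘ₗ
    LinearMap.codRestrict _ ((LinearMap.lcomp k k (LinearMap.mul' k A)) ∘ₗ DualAlg.toDual 𝒜)
      (DualAlg.exists_comul 𝒜)

theorem DualAlg.pairing_comulAux (f : DualAlg 𝒜) :
    pairing (DualAlg.toDual 𝒜) (DualAlg.toDual 𝒜) (DualAlg.comulAux 𝒜 f) =
      DualAlg.toDual 𝒜 f ∘ₗ LinearMap.mul' k A := by
  rw [comulAux, LinearMap.comp_apply]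
  exact LinearEquiv.ofInjective_symm_apply
    (f := pairing (DualAlg.toDual 𝒜) (DualAlg.toDual 𝒜)) _

theorem DualAlg.pairing_lTensor_comulAux (t : DualAlg 𝒜 ⊗[k] DualAlg 𝒜) (a b c : A) :
    pairing (DualAlg.toDual 𝒜) (pairing (DualAlg.toDual 𝒜) (DualAlg.toDual 𝒜))
      ((DualAlg.comulAux 𝒜).lTensor _ t) (a ⊗ₜ (b ⊗ₜ c)) =
    pairing (DualAlg.toDual 𝒜) (DualAlg.toDual 𝒜) t (a ⊗ₜ (b * c)) := by
  induction t with
  | zero => simp only [map_zero, LinearMap.zero_apply]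
  | add x y hx hy => simp only [map_add, LinearMap.add_apply, hx, hy]
  | tmul x y =>
    rw [LinearMap.lTensor_tmul, pairing_tmul, pairing_tmul, DualAlg.pairing_comulAux]
    rfl

theorem DualAlg.pairing_assoc (t : (DualAlg 𝒜 ⊗[k] DualAlg 𝒜) ⊗[k] DualAlg 𝒜) (a b c : A) :
    pairing (DualAlg.toDual 𝒜) (pairing (DualAlg.toDual 𝒜) (DualAlg.toDual 𝒜))
      (TensorProduct.assoc k _ _ _ t) (a ⊗ₜ (b ⊗ₜ c)) =
    pairing (pairing (DualAlg.toDual 𝒜) (DualAlg.toDual 𝒜)) (DualAlg.toDual 𝒜) t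
      ((a ⊗ₜ b) ⊗ₜ c) := by
  induction t with
  | zero => simp only [map_zero, LinearMap.zero_apply]
  | add x y hx hy => simp only [map_add, LinearMap.add_apply, hx, hy]
  | tmul x y =>
    induction x with
    | zero => simp
    | add x x' hx hy => simp only [map_add, LinearMap.add_apply, hx, hy, TensorProduct.add_tmul]
    | tmul x x' => simp [mul_assoc]

theorem DualAlg.pairing_rTensor_comulAux (t : DualAlg 𝒜 ⊗[k] DualAlg 𝒜) (a b c : A) :
    pairing (pairing (DualAlg.toDual 𝒜) (DualAlg.toDual 𝒜)) (DualAlg.toDual 𝒜)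
      ((DualAlg.comulAux 𝒜).rTensor _ t) ((a ⊗ₜ b) ⊗ₜ c) =
    pairing (DualAlg.toDual 𝒜) (DualAlg.toDual 𝒜) t ((a * b) ⊗ₜ c) := by
  induction t with
  | zero => simp only [map_zero, LinearMap.zero_apply]
  | add x y hx hy => simp only [map_add, LinearMap.add_apply, hx, hy]
  | tmul x y =>
    rw [LinearMap.rTensor_tmul, pairing_tmul, pairing_tmul, DualAlg.pairing_comulAux]
    rfl

/-- The counit of `A_*`: evaluation at the unit of `A`. -/
def DualAlg.counitAux : DualAlg 𝒜 →ₗ[k] k where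
  toFun f := DualAlg.toDual 𝒜 f 1
  map_add' _ _ := rfl
  map_smul' _ _ := rfl

instance DualAlg.coalgebra : Coalgebra k (DualAlg 𝒜) where
  comul := DualAlg.comulAux 𝒜
  counit := DualAlg.counitAux 𝒜
  coassoc := by
    apply LinearMap.ext
    intro f
    apply pairing_injective _ _ (DualAlg.toDual_injective 𝒜)
      (pairing_injective _ _ (DualAlg.toDual_injective 𝒜) (DualAlg.toDual_injective 𝒜))
    apply TensorProduct.ext
    apply LinearMap.ext
    intro a
    apply TensorProduct.ext'
    intro b c
    change pairing _ _ (TensorProduct.assoc k _ _ _ ((DualAlg.comulAux 𝒜).rTensor _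
      (DualAlg.comulAux 𝒜 f))) (a ⊗ₜ (b ⊗ₜ c)) = pairing _ _ ((DualAlg.comulAux 𝒜).lTensor _
      (DualAlg.comulAux 𝒜 f)) (a ⊗ₜ (b ⊗ₜ c))
    rw [DualAlg.pairing_lTensor_comulAux, DualAlg.pairing_assoc, DualAlg.pairing_rTensor_comulAux,
      DualAlg.pairing_comulAux]
    simp [mul_assoc]
  rTensor_counit_comp_comul := by
    apply LinearMap.ext
    intro f
    apply (TensorProduct.lid k _).injective
    apply DualAlg.toDual_injective
    apply LinearMap.ext
    intro a
    have hc (x : DualAlg 𝒜) : DualAlg.counitAux 𝒜 x = DualAlg.toDual 𝒜 x 1 := rfl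
    have h : ∀ t : DualAlg 𝒜 ⊗[k] DualAlg 𝒜, DualAlg.toDual 𝒜 (TensorProduct.lid k _
        ((DualAlg.counitAux 𝒜).rTensor _ t)) a =
        pairing (DualAlg.toDual 𝒜) (DualAlg.toDual 𝒜) t (1 ⊗ₜ a) := by
      intro t
      induction t with
      | zero => simp
      | add x y hx hy => simp only [map_add, LinearMap.add_apply, hx, hy]
      | tmul x y => simp [hc]
    refine (h _).trans ?_
    rw [DualAlg.pairing_comulAux]
    simp
  lTensor_counit_comp_comul := by
    apply LinearMap.ext
    intro f
    apply (TensorProduct.rid k _).injective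
    apply DualAlg.toDual_injective
    apply LinearMap.ext
    intro a
    have hc (x : DualAlg 𝒜) : DualAlg.counitAux 𝒜 x = DualAlg.toDual 𝒜 x 1 := rfl
    have h : ∀ t : DualAlg 𝒜 ⊗[k] DualAlg 𝒜, DualAlg.toDual 𝒜 (TensorProduct.rid k _
        ((DualAlg.counitAux 𝒜).lTensor _ t)) a =
        pairing (DualAlg.toDual 𝒜) (DualAlg.toDual 𝒜) t (a ⊗ₜ 1) := by
      intro t
      induction t with
      | zero => simp
      | add x y hx hy => simp only [map_add, LinearMap.add_apply, hx, hy]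
      | tmul x y => simp [hc, mul_comm]
    refine (h _).trans ?_
    rw [DualAlg.pairing_comulAux]
    simp

end
end GradedAux

namespace SteenrodExt
open AdemAux

/-- The free associative algebra over `ZMod 2` on generators `Sq^n`, `n > 0`. -/
abbrev FreeSteenrod : Type := FreeAlgebra (ZMod 2) ℕ+

/-- The element `Sq^n` of the free algebra, with `Sq^0 = 1`. -/
def freeSq : ℕ → FreeSteenrod
  | 0 => 1
  | n + 1 => FreeAlgebra.ι (ZMod 2) n.succPNat

/-- The monomial in the elements `Sq^n` given by a list of exponents. -/
def freeWord (w : List ℕ) : FreeSteenrod := (w.map freeSq).prod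

/-- The Adem relation `[n, m]`. -/
def ademRelation (n m : ℕ) : FreeSteenrod := ademSum (fun a b => freeSq a * freeSq b) n m

/-- The Adem relations `[n, m] = 0` for `0 < n < 2 m`. -/
inductive AdemRel : FreeSteenrod → FreeSteenrod → Prop
  | adem (n m : ℕ) (hn : 0 < n) (hm : n < 2 * m) : AdemRel (ademRelation n m) 0

/-- The mod 2 Steenrod algebra. -/
def Steenrod : Type := RingQuot AdemRel

noncomputable section

instance : Ring Steenrod := inferInstanceAs (Ring (RingQuot AdemRel))
instance : Algebra (ZMod 2) Steenrod := inferInstanceAs (Algebra (ZMod 2) (RingQuot AdemRel))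

/-- The projection of the free algebra onto the Steenrod algebra. -/
def proj : FreeSteenrod →ₐ[ZMod 2] Steenrod := RingQuot.mkAlgHom (ZMod 2) AdemRel

theorem proj_surjective : Function.Surjective proj := RingQuot.mkAlgHom_surjective _ _

/-- The Steenrod square `Sq^n`. -/
def sq (n : ℕ) : Steenrod := proj (freeSq n)

theorem map_ademSum {M N : Type*} [AddCommGroup M] [Module (ZMod 2) M] [AddCommGroup N]
    [Module (ZMod 2) N] (g : M →ₗ[ZMod 2] N) (f : ℕ → ℕ → M) (n m : ℕ) :
    g (ademSum f n m) = ademSum (fun a b => g (f a b)) n m := by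
  simp [ademSum]

theorem isAdemFamily_sq : IsAdemFamily sq := by
  refine ⟨map_one proj, fun n m hn hm => ?_⟩
  have h : proj (ademRelation n m) = proj 0 := RingQuot.mkAlgHom_rel _ (AdemRel.adem n m hn hm)
  rw [map_zero] at h
  rw [← h, ademRelation]
  exact ((map_ademSum proj.toLinearMap _ n m).trans (by simp [sq])).symm

section lift
variable {B : Type*} [Ring B] [Algebra (ZMod 2) B]

theorem freeLift_freeSq (X : ℕ → B) (h0 : X 0 = 1) (n : ℕ) :
    FreeAlgebra.lift (ZMod 2) (fun n : ℕ+ => X n) (freeSq n) = X n := by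
  cases n with
  | zero => simp [freeSq, h0]
  | succ n => simp [freeSq]

/-- A family of elements of an algebra that satisfies the Adem relations gives a homomorphism from the
Steenrod algebra. -/
def liftAdem (X : ℕ → B) (hX : IsAdemFamily X) : Steenrod →ₐ[ZMod 2] B :=
  RingQuot.liftAlgHom (ZMod 2) ⟨FreeAlgebra.lift (ZMod 2) (fun n : ℕ+ => X n), by
    rintro _ _ ⟨n, m, hn, hm⟩
    rw [map_zero, ← hX.2 n m hn hm, ademRelation]
    refine (map_ademSum (FreeAlgebra.lift (ZMod 2) (fun n : ℕ+ => X n)).toLinearMap _ n m).trans ?_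
    simp [freeLift_freeSq X hX.1]⟩

theorem liftAdem_proj (X : ℕ → B) (hX : IsAdemFamily X) (f : FreeSteenrod) :
    liftAdem X hX (proj f) = FreeAlgebra.lift (ZMod 2) (fun n : ℕ+ => X n) f :=
  RingQuot.liftAlgHom_mkAlgHom_apply _ _ _ _

@[simp] theorem liftAdem_sq (X : ℕ → B) (hX : IsAdemFamily X) (n : ℕ) :
    liftAdem X hX (sq n) = X n := by
  rw [sq, liftAdem_proj, freeLift_freeSq X hX.1]

theorem steenrod_hom_ext {f g : Steenrod →ₐ[ZMod 2] B} (h : ∀ n, f (sq n) = g (sq n)) : f = g := by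
  apply RingQuot.ringQuot_ext'
  apply FreeAlgebra.hom_ext
  funext n
  obtain ⟨m, rfl⟩ : ∃ m : ℕ, n = m.succPNat := ⟨n.natPred, by simp⟩
  exact h (m + 1)

end lift

/-- The diagonal of the free algebra, `Sq^n ↦ ∑ Sq^a ⊗ Sq^b` over `a + b = n`. -/
def freeDiag : FreeSteenrod →ₐ[ZMod 2] FreeSteenrod ⊗[ZMod 2] FreeSteenrod :=
  FreeAlgebra.lift (ZMod 2) fun n : ℕ+ =>
    ∑ p ∈ Finset.HasAntidiagonal.antidiagonal (n : ℕ), freeSq p.1 ⊗ₜ[ZMod 2] freeSq p.2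

theorem freeDiag_freeSq (n : ℕ) : freeDiag (freeSq n) =
    ∑ p ∈ Finset.HasAntidiagonal.antidiagonal n, freeSq p.1 ⊗ₜ[ZMod 2] freeSq p.2 :=
  freeLift_freeSq (fun n => ∑ p ∈ Finset.HasAntidiagonal.antidiagonal n,
    freeSq p.1 ⊗ₜ[ZMod 2] freeSq p.2) (by simp [freeSq]; rfl) n

theorem isAdemFamily_diag : IsAdemFamily fun n : ℕ =>
    ∑ p ∈ Finset.HasAntidiagonal.antidiagonal n, sq p.1 ⊗ₜ[ZMod 2] sq p.2 := by
  have hl : IsAdemFamily fun n => (sq n ⊗ₜ[ZMod 2] (1 : Steenrod)) := by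
    refine ⟨by simp only [isAdemFamily_sq.1]; rfl, fun n m hn hm => ?_⟩
    have := map_ademSum (Algebra.TensorProduct.includeLeft :
      Steenrod →ₐ[ZMod 2] Steenrod ⊗[ZMod 2] Steenrod).toLinearMap
      (fun a b => sq a * sq b) n m
    rw [isAdemFamily_sq.2 n m hn hm, map_zero] at this
    simpa using this.symm
  have hr : IsAdemFamily fun n => ((1 : Steenrod) ⊗ₜ[ZMod 2] sq n) := by
    refine ⟨by simp only [isAdemFamily_sq.1]; rfl, fun n m hn hm => ?_⟩
    have := map_ademSum (Algebra.TensorProduct.includeRight :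
      Steenrod →ₐ[ZMod 2] Steenrod ⊗[ZMod 2] Steenrod).toLinearMap
      (fun a b => sq a * sq b) n m
    rw [isAdemFamily_sq.2 n m hn hm, map_zero] at this
    simpa using this.symm
  have := hl.conv hr (fun i j => by simp [Commute, SemiconjBy])
  simpa using this

/-- The diagonal of the Steenrod algebra, `Sq^n ↦ ∑ Sq^a ⊗ Sq^b` over `a + b = n`. -/
def diag : Steenrod →ₐ[ZMod 2] Steenrod ⊗[ZMod 2] Steenrod := liftAdem _ isAdemFamily_diag

theorem diag_sq (n : ℕ) : diag (sq n) =
    ∑ p ∈ Finset.HasAntidiagonal.antidiagonal n, sq p.1 ⊗ₜ[ZMod 2] sq p.2 := liftAdem_sq _ _ n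

theorem diag_proj (f : FreeSteenrod) :
    diag (proj f) = Algebra.TensorProduct.map proj proj (freeDiag f) := by
  have : diag.comp proj = (Algebra.TensorProduct.map proj proj).comp freeDiag := by
    apply FreeAlgebra.hom_ext
    funext n
    obtain ⟨m, rfl⟩ : ∃ m : ℕ, n = m.succPNat := ⟨n.natPred, by simp⟩
    change diag (sq (m + 1)) = Algebra.TensorProduct.map proj proj (freeDiag (freeSq (m + 1)))
    rw [diag_sq, freeDiag_freeSq, map_sum]
    rfl
  exact DFunLike.congr_fun this f

theorem isAdemFamily_counit :
    IsAdemFamily (fun n : ℕ => if n = 0 then (1 : ZMod 2) else 0) := by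
  refine ⟨by simp, fun n m hn hm => ?_⟩
  have hm' : m ≠ 0 := by omega
  unfold ademSum
  simp only []
  rw [Finset.sum_eq_zero, if_neg hm', mul_zero, add_zero]
  intro k hk
  simp only [Finset.mem_range] at hk
  rw [if_neg (show n + m - k ≠ 0 by omega), zero_mul, smul_zero]

/-- The counit of the Steenrod algebra. -/
def aug : Steenrod →ₐ[ZMod 2] ZMod 2 := liftAdem _ isAdemFamily_counit

theorem aug_sq (n : ℕ) : aug (sq n) = if n = 0 then (1 : ZMod 2) else 0 := liftAdem_sq _ _ n

/-- The Steenrod algebra with its diagonal and counit. -/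
instance : Bialgebra (ZMod 2) Steenrod :=
  Bialgebra.ofAlgHom diag aug
    (by
      apply steenrod_hom_ext
      intro n
      simp only [AlgHom.comp_apply, diag_sq, map_sum, Algebra.TensorProduct.map_tmul,
        AlgHom.id_apply, TensorProduct.sum_tmul, TensorProduct.tmul_sum]
      rw [Finset.sum_sigma', Finset.sum_sigma']
      refine Finset.sum_bij' (fun t _ => ⟨(t.2.1, t.2.2 + t.1.2), (t.2.2, t.1.2)⟩)
        (fun t _ => ⟨(t.1.1 + t.2.1, t.2.2), (t.1.1, t.2.1)⟩) ?_ ?_ ?_ ?_ ?_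
      · rintro ⟨⟨a, b⟩, c, d⟩ h
        simp only [Finset.mem_sigma, Finset.HasAntidiagonal.mem_antidiagonal] at h
        refine Finset.mem_sigma.2 ⟨Finset.HasAntidiagonal.mem_antidiagonal.2 ?_,
          Finset.HasAntidiagonal.mem_antidiagonal.2 ?_⟩ <;> simp only [] <;> omega
      · rintro ⟨⟨a, b⟩, c, d⟩ h
        simp only [Finset.mem_sigma, Finset.HasAntidiagonal.mem_antidiagonal] at h
        refine Finset.mem_sigma.2 ⟨Finset.HasAntidiagonal.mem_antidiagonal.2 ?_,
          Finset.HasAntidiagonal.mem_antidiagonal.2 ?_⟩ <;> simp only [] <;> omega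
      · rintro ⟨⟨a, b⟩, c, d⟩ h
        simp only [Finset.mem_sigma, Finset.HasAntidiagonal.mem_antidiagonal] at *
        obtain ⟨h1, rfl⟩ := h
        rfl
      · rintro ⟨⟨a, b⟩, c, d⟩ h
        simp only [Finset.mem_sigma, Finset.HasAntidiagonal.mem_antidiagonal] at *
        obtain ⟨h1, rfl⟩ := h
        rfl
      · rintro ⟨⟨a, b⟩, c, d⟩ h
        rfl)
    (by
      apply steenrod_hom_ext
      intro n
      simp only [AlgHom.comp_apply, diag_sq, map_sum, Algebra.TensorProduct.map_tmul, aug_sq,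
        AlgHom.id_apply]
      rw [Finset.sum_eq_single (0, n)]
      · simp
      · rintro ⟨a, b⟩ h hne
        have : a ≠ 0 := by
          rintro rfl; apply hne; simpa using h
        simp [this]
      · simp)
    (by
      apply steenrod_hom_ext
      intro n
      simp only [AlgHom.comp_apply, diag_sq, map_sum, Algebra.TensorProduct.map_tmul, aug_sq,
        AlgHom.id_apply]
      rw [Finset.sum_eq_single (n, 0)]
      · simp
      · rintro ⟨a, b⟩ h hne
        have : b ≠ 0 := by
          rintro rfl; apply hne; simpa using h
        simp [this]
      · simp)

theorem comul_eq (a : Steenrod) : Coalgebra.comul (R := ZMod 2) a = diag a := rfl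

theorem isAdemFamily_kappa : IsAdemFamily (fun n : ℕ =>
    (TrivSqZeroExt.inl (sq n) + TrivSqZeroExt.inr (if n = 0 then 0 else sq (n - 1)) : TrivSqZeroExt Steenrod Steenrod)) := by
  have hl : IsAdemFamily (fun n : ℕ => (TrivSqZeroExt.inl (sq n) : TrivSqZeroExt Steenrod Steenrod)) := by
    refine ⟨by simp only [isAdemFamily_sq.1]; rfl, fun n m hn hm => ?_⟩
    have := map_ademSum (TrivSqZeroExt.inlAlgHom (ZMod 2) Steenrod Steenrod).toLinearMap
      (fun a b => sq a * sq b) n m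
    rw [isAdemFamily_sq.2 n m hn hm, map_zero] at this
    simpa using this.symm
  let Y : ℕ → TrivSqZeroExt Steenrod Steenrod :=
    fun n => if n = 0 then 1 else if n = 1 then TrivSqZeroExt.inr 1 else 0
  have hY2 (n : ℕ) (h : 2 ≤ n) : Y n = 0 := by
    simp only [Y]; rw [if_neg (by omega), if_neg (by omega)]
  have hr : IsAdemFamily Y := by
    refine ⟨by simp [Y], fun n m hn hm => ?_⟩
    unfold ademSum
    simp only []
    have h1 : Y n * Y m = 0 := by
      by_cases h : 2 ≤ n
      · rw [hY2 n h, zero_mul]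
      · by_cases h' : 2 ≤ m
        · rw [hY2 m h', mul_zero]
        · obtain rfl : n = 1 := by omega
          obtain rfl : m = 1 := by omega
          simp [Y]
    rw [h1, zero_add, Finset.sum_eq_zero]
    intro k hk
    simp only [Finset.mem_range] at hk
    rw [hY2 _ (by omega), zero_mul, smul_zero]
  have := hl.conv hr (fun i j => by
    simp only [Y]; split_ifs
    · exact Commute.one_right _
    · ext <;> simp
    · exact Commute.zero_right _)
  convert this using 2 with n
  cases n with
  | zero => simp [Y, isAdemFamily_sq.1]
  | succ n =>
    rw [Finset.Nat.sum_antidiagonal_eq_sum_range_succ_mk, Finset.sum_range_succ,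
      Finset.sum_range_succ, Finset.sum_eq_zero]
    · simp only [Y, Nat.sub_self, if_pos, Nat.add_one_sub_one, Nat.add_sub_cancel_left,
        one_ne_zero, if_false, mul_one, zero_add, Nat.add_eq_zero_iff, and_false]
      apply TrivSqZeroExt.ext <;> simp
    · intro k hk
      simp only [Finset.mem_range] at hk
      simp only
      rw [hY2 _ (by omega), mul_zero]

/-- The homomorphism `a ↦ (a, κ a)` to the trivial square zero extension. -/
def kappaHom : Steenrod →ₐ[ZMod 2] TrivSqZeroExt Steenrod Steenrod := liftAdem _ isAdemFamily_kappa

/-- The derivation `κ` of the Steenrod algebra with `κ (Sq^n) = Sq^(n-1)` for `n > 0`. -/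
def kappa : Steenrod →ₗ[ZMod 2] Steenrod where
  toFun a := (kappaHom a).snd
  map_add' a b := by simp
  map_smul' c a := by simp

theorem kappa_sq (n : ℕ) : kappa (sq n) = if n = 0 then 0 else sq (n - 1) := by
  cases n <;> simp [kappa, kappaHom]

theorem kappaHom_fst (a : Steenrod) : (kappaHom a).fst = a := by
  have : (TrivSqZeroExt.fstHom (ZMod 2) Steenrod Steenrod).comp kappaHom = AlgHom.id _ _ := by
    apply steenrod_hom_ext; intro n; cases n <;> simp [kappaHom]
  exact DFunLike.congr_fun this a

theorem kappa_mul (a b : Steenrod) : kappa (a * b) = a * kappa b + kappa a * b := by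
  simp [kappa, kappaHom_fst]

end
end SteenrodExt

namespace SteenrodExt
open AdemAux GradedAux
noncomputable section

/-- The degree `n` part of the free algebra. -/
def freeGr (n : ℕ) : Submodule (ZMod 2) FreeSteenrod :=
  Submodule.span (ZMod 2) {f | ∃ w : List ℕ, w.sum = n ∧ f = freeWord w}

/-- The degree `n` part of the Steenrod algebra. -/
def steenrodGr (n : ℕ) : Submodule (ZMod 2) Steenrod := (freeGr n).map proj.toLinearMap

theorem freeWord_append (w w' : List ℕ) : freeWord (w ++ w') = freeWord w * freeWord w' := by
  simp [freeWord]

theorem freeWord_mem (w : List ℕ) : freeWord w ∈ freeGr w.sum :=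
  Submodule.subset_span ⟨w, rfl, rfl⟩

theorem freeSq_mem (n : ℕ) : freeSq n ∈ freeGr n := by
  simpa [freeWord] using freeWord_mem [n]

theorem freeGr_one_mem : (1 : FreeSteenrod) ∈ freeGr 0 := by
  simpa [freeWord] using freeWord_mem []

theorem freeGr_mul_mem {i j : ℕ} {a b : FreeSteenrod} (ha : a ∈ freeGr i) (hb : b ∈ freeGr j) :
    a * b ∈ freeGr (i + j) := by
  have : freeGr i * freeGr j ≤ freeGr (i + j) := by
    rw [freeGr, freeGr, Submodule.span_mul_span]
    apply Submodule.span_le.2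
    rintro _ ⟨_, ⟨w, rfl, rfl⟩, _, ⟨w', rfl, rfl⟩, rfl⟩
    simpa [freeWord_append] using freeWord_mem (w ++ w')
  exact this (Submodule.mul_mem_mul ha hb)

theorem iSup_freeGr : (⨆ n, freeGr n) = ⊤ := by
  rw [eq_top_iff]
  rintro f -
  have hw (w : List ℕ) : freeWord w ∈ ⨆ n, freeGr n :=
    Submodule.mem_iSup_of_mem w.sum (freeWord_mem w)
  have hs : Submodule.span (ZMod 2) (Set.range freeWord) ≤ ⨆ n, freeGr n :=
    Submodule.span_le.2 (by rintro _ ⟨w, rfl⟩; exact hw w)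
  apply hs
  induction f using FreeAlgebra.induction with
  | grade0 r =>
    rw [Algebra.algebraMap_eq_smul_one]
    exact Submodule.smul_mem _ _ (Submodule.subset_span ⟨[], by simp [freeWord]⟩)
  | grade1 n =>
    obtain ⟨m, rfl⟩ : ∃ m : ℕ, n = m.succPNat := ⟨n.natPred, by simp⟩
    exact Submodule.subset_span ⟨[m + 1], by simp [freeWord, freeSq]⟩
  | mul a b ha hb =>
    have := Submodule.mul_mem_mul ha hb
    rw [Submodule.span_mul_span] at this
    refine Submodule.span_mono ?_ this
    rintro _ ⟨_, ⟨w, rfl⟩, _, ⟨w', rfl⟩, rfl⟩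
    exact ⟨w ++ w', freeWord_append w w'⟩
  | add a b ha hb => exact Submodule.add_mem _ ha hb

theorem freeWord_filter (w : List ℕ) : freeWord (w.filter (fun n => 0 < n)) = freeWord w := by
  induction w with
  | nil => rfl
  | cons a w ih =>
    rcases Nat.eq_zero_or_pos a with rfl | ha
    · simpa [freeWord, freeSq] using ih
    · simpa [freeWord, ha] using congrArg (freeSq a * ·) ih

theorem finiteDimensional_freeGr (n : ℕ) : FiniteDimensional (ZMod 2) (freeGr n) := by
  apply FiniteDimensional.span_of_finite
  apply (Set.finite_range fun c : Composition n => freeWord c.blocks).subset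
  rintro _ ⟨w, hw, rfl⟩
  refine ⟨⟨w.filter (fun n => 0 < n), by simp, ?_⟩, freeWord_filter w⟩
  rw [← hw]
  clear hw
  induction w with
  | nil => rfl
  | cons a w ih =>
    rcases Nat.eq_zero_or_pos a with rfl | ha
    · simpa using ih
    · simpa [ha] using ih

theorem isAdemFamily_monomial : IsAdemFamily fun n => Polynomial.monomial n (sq n) := by
  refine ⟨by simp only [isAdemFamily_sq.1]; rfl, fun n m hn hm => ?_⟩
  have h : ademSum (fun a b => Polynomial.monomial a (sq a) * Polynomial.monomial b (sq b)) n m =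
      ((Polynomial.monomial (n + m)).restrictScalars (ZMod 2))
        (ademSum (fun a b => sq a * sq b) n m) := by
    rw [map_ademSum]
    unfold ademSum
    simp only [Polynomial.monomial_mul_monomial, LinearMap.restrictScalars_apply]
    congr 1
    apply Finset.sum_congr rfl
    intro k hk
    simp only [Finset.mem_range] at hk
    rw [show n + m - k + k = n + m by omega]
  rw [h, isAdemFamily_sq.2 n m hn hm, map_zero]

/-- The map `A → A[X]` that sends an element `a` of degree `n` to `a X ^ n`. -/
def steenrodRho : Steenrod →ₐ[ZMod 2] Polynomial Steenrod := liftAdem _ isAdemFamily_monomial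

theorem steenrodRho_word (w : List ℕ) :
    steenrodRho (proj (freeWord w)) = Polynomial.monomial w.sum (proj (freeWord w)) := by
  induction w with
  | nil => simp [freeWord]
  | cons a w ih =>
    have : proj (freeWord (a :: w)) = sq a * proj (freeWord w) := by simp [freeWord, sq]
    rw [this, map_mul, ih, steenrodRho, liftAdem_sq, Polynomial.monomial_mul_monomial,
      List.sum_cons]

theorem steenrodRho_of_mem {n : ℕ} {a : Steenrod} (ha : a ∈ steenrodGr n) :
    steenrodRho a = Polynomial.monomial n a := by
  obtain ⟨f, hf, rfl⟩ := ha
  change f ∈ freeGr n at hf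
  change steenrodRho (proj f) = Polynomial.monomial n (proj f)
  induction hf using Submodule.span_induction with
  | mem f hf => obtain ⟨w, rfl, rfl⟩ := hf; exact steenrodRho_word w
  | zero => simp
  | add x y _ _ hx hy => rw [map_add, map_add, hx, hy, map_add]
  | smul c x _ hx => rw [map_smul, map_smul, hx, Polynomial.smul_monomial]

theorem iSup_steenrodGr : (⨆ n, steenrodGr n) = ⊤ := by
  unfold steenrodGr
  rw [← Submodule.map_iSup, iSup_freeGr, Submodule.map_top]
  exact LinearMap.range_eq_top.2 proj_surjective

theorem hasTruncations_steenrodGr : HasTruncations steenrodGr := by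
  refine ⟨iSup_steenrodGr, fun N => ?_⟩
  let τ : Steenrod →ₗ[ZMod 2] Steenrod := ∑ i ∈ Finset.range N,
    ((Polynomial.lcoeff Steenrod i).restrictScalars (ZMod 2)) ∘ₗ steenrodRho.toLinearMap
  have hτ {n : ℕ} {a : Steenrod} (ha : a ∈ steenrodGr n) : τ a = if n < N then a else 0 := by
    simp only [τ, LinearMap.sum_apply, LinearMap.comp_apply, AlgHom.toLinearMap_apply,
      LinearMap.restrictScalars_apply, Polynomial.lcoeff_apply, steenrodRho_of_mem ha,
      Polynomial.coeff_monomial]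
    simp
  refine ⟨τ, ?_, fun n hn a ha => ?_, fun n hn a ha => ?_⟩
  · have hle : LinearMap.range τ ≤ ⨆ i : Fin N, steenrodGr i := by
      rintro _ ⟨a, rfl⟩
      have ha : a ∈ ⨆ n, steenrodGr n := by rw [iSup_steenrodGr]; trivial
      induction ha using Submodule.iSup_induction' with
      | mem n a ha =>
        rw [hτ ha]
        split_ifs with h
        · exact Submodule.mem_iSup_of_mem (⟨n, h⟩ : Fin N) ha
        · exact Submodule.zero_mem _
      | zero => rw [map_zero]; exact Submodule.zero_mem _
      | add x y _ _ hx hy => rw [map_add]; exact Submodule.add_mem _ hx hy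
    have hf (n : ℕ) : FiniteDimensional (ZMod 2) (steenrodGr n) := by
      have := finiteDimensional_freeGr n
      unfold steenrodGr
      infer_instance
    exact Submodule.finiteDimensional_of_le hle
  · rw [hτ ha, if_neg (by omega)]
  · rw [hτ ha, if_pos hn]

theorem steenrodGr_mul_mem {i j : ℕ} {a b : Steenrod} (ha : a ∈ steenrodGr i)
    (hb : b ∈ steenrodGr j) : a * b ∈ steenrodGr (i + j) := by
  obtain ⟨f, hf, rfl⟩ := ha
  obtain ⟨g, hg, rfl⟩ := hb
  exact ⟨f * g, freeGr_mul_mem hf hg, map_mul proj f g⟩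

theorem steenrodGr_one_mem : (1 : Steenrod) ∈ steenrodGr 0 := ⟨1, freeGr_one_mem, map_one proj⟩

theorem sq_mem (n : ℕ) : sq n ∈ steenrodGr n := ⟨freeSq n, freeSq_mem n, rfl⟩

theorem tensorGr_mul_mem {i j : ℕ} {x y : Steenrod ⊗[ZMod 2] Steenrod}
    (hx : x ∈ tensorGr steenrodGr steenrodGr i) (hy : y ∈ tensorGr steenrodGr steenrodGr j) :
    x * y ∈ tensorGr steenrodGr steenrodGr (i + j) := by
  have h : tensorGr steenrodGr steenrodGr i * tensorGr steenrodGr steenrodGr j ≤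
      tensorGr steenrodGr steenrodGr (i + j) := by
    rw [tensorGr, tensorGr, Submodule.span_mul_span]
    apply Submodule.span_le.2
    rintro _ ⟨_, ⟨a, b, rfl, u, hu, v, hv, rfl⟩, _, ⟨c, d, rfl, u', hu', v', hv', rfl⟩, rfl⟩
    exact Submodule.subset_span ⟨a + c, b + d, by omega, u * u', steenrodGr_mul_mem hu hu',
      v * v', steenrodGr_mul_mem hv hv', Algebra.TensorProduct.tmul_mul_tmul _ _ _ _⟩
  exact h (Submodule.mul_mem_mul hx hy)

theorem diag_word_mem (w : List ℕ) :
    diag (proj (freeWord w)) ∈ tensorGr steenrodGr steenrodGr w.sum := by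
  induction w with
  | nil =>
    refine Submodule.subset_span ⟨0, 0, rfl, 1, steenrodGr_one_mem, 1, steenrodGr_one_mem, ?_⟩
    simp [freeWord]; rfl
  | cons a w ih =>
    have : proj (freeWord (a :: w)) = sq a * proj (freeWord w) := by simp [freeWord, sq]
    rw [this, map_mul, List.sum_cons]
    refine tensorGr_mul_mem ?_ ih
    rw [diag_sq]
    refine Submodule.sum_mem _ fun p hp => ?_
    exact Submodule.subset_span ⟨p.1, p.2, Finset.HasAntidiagonal.mem_antidiagonal.1 hp, _,
      sq_mem _, _, sq_mem _, rfl⟩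

theorem diag_mem {n : ℕ} {a : Steenrod} (ha : a ∈ steenrodGr n) :
    diag a ∈ tensorGr steenrodGr steenrodGr n := by
  obtain ⟨f, hf, rfl⟩ := ha
  change f ∈ freeGr n at hf
  change diag (proj f) ∈ _
  induction hf using Submodule.span_induction with
  | mem f hf => obtain ⟨w, rfl, rfl⟩ := hf; exact diag_word_mem w
  | zero => rw [map_zero, map_zero]; exact Submodule.zero_mem _
  | add x y _ _ hx hy => rw [map_add, map_add]; exact Submodule.add_mem _ hx hy
  | smul c x _ hx => rw [map_smul, map_smul]; exact Submodule.smul_mem _ _ hx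

theorem aug_eq_zero {n : ℕ} {a : Steenrod} (hn : n ≠ 0) (ha : a ∈ steenrodGr n) : aug a = 0 := by
  obtain ⟨f, hf, rfl⟩ := ha
  change f ∈ freeGr n at hf
  change aug (proj f) = 0
  induction hf using Submodule.span_induction with
  | mem f hf =>
    obtain ⟨w, rfl, rfl⟩ := hf
    induction w with
    | nil => simp at hn
    | cons a w ih =>
      have : proj (freeWord (a :: w)) = sq a * proj (freeWord w) := by simp [freeWord, sq]
      rw [this, map_mul, aug_sq]
      split_ifs with h
      · subst h
        rw [ih (by simpa using hn), mul_zero]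
      · rw [zero_mul]
  | zero => simp
  | add x y _ _ hx hy => rw [map_add, map_add, hx, hy, add_zero]
  | smul c x _ hx => rw [map_smul, map_smul, hx, smul_zero]

instance gradedSteenrod : GradedBialgebra (k := ZMod 2) steenrodGr where
  trunc := hasTruncations_steenrodGr
  one_mem := steenrodGr_one_mem
  mul_mem := steenrodGr_mul_mem
  comul_mem := diag_mem
  counit_eq_zero := aug_eq_zero

end
end SteenrodExt

namespace SteenrodExt
open AdemAux GradedAux
noncomputable section

/-- The ideal of relations: the kernel of the projection of the free algebra onto `A`. -/
def RF : Submodule (ZMod 2) FreeSteenrod := LinearMap.ker proj.toLinearMap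

/-- The product of the ideal of relations with itself. -/
def RF2 : Submodule (ZMod 2) FreeSteenrod := RF * RF

theorem mem_RF {f : FreeSteenrod} : f ∈ RF ↔ proj f = 0 := Iff.rfl

theorem mul_mem_RF_left (f : FreeSteenrod) {r : FreeSteenrod} (hr : r ∈ RF) : f * r ∈ RF := by
  rw [mem_RF] at *; rw [map_mul, hr, mul_zero]

theorem mul_mem_RF_right {r : FreeSteenrod} (hr : r ∈ RF) (f : FreeSteenrod) : r * f ∈ RF := by
  rw [mem_RF] at *; rw [map_mul, hr, zero_mul]

theorem mul_mem_RF2_left (f : FreeSteenrod) {r : FreeSteenrod} (hr : r ∈ RF2) : f * r ∈ RF2 := by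
  unfold RF2 at *
  induction hr using Submodule.mul_induction_on' with
  | mem_mul_mem a ha b hb =>
    rw [← mul_assoc]; exact Submodule.mul_mem_mul (mul_mem_RF_left f ha) hb
  | add x _ y _ hx hy => rw [mul_add]; exact Submodule.add_mem _ hx hy

theorem mul_mem_RF2_right {r : FreeSteenrod} (hr : r ∈ RF2) (f : FreeSteenrod) : r * f ∈ RF2 := by
  unfold RF2 at *
  induction hr using Submodule.mul_induction_on' with
  | mem_mul_mem a ha b hb =>
    rw [mul_assoc]; exact Submodule.mul_mem_mul ha (mul_mem_RF_right hb f)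
  | add x _ y _ hx hy => rw [add_mul]; exact Submodule.add_mem _ hx hy

/-- The quotient of the ideal of relations by its square. -/
def Rbar : Type := RF ⧸ RF2.submoduleOf RF

instance : AddCommGroup Rbar := inferInstanceAs (AddCommGroup (RF ⧸ RF2.submoduleOf RF))
instance : Module (ZMod 2) Rbar := inferInstanceAs (Module (ZMod 2) (RF ⧸ RF2.submoduleOf RF))

/-- The class of a relation. -/
def rbarMk : RF →ₗ[ZMod 2] Rbar := (RF2.submoduleOf RF).mkQ

theorem rbarMk_surjective : Function.Surjective rbarMk := Submodule.mkQ_surjective _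

theorem rbarMk_eq_zero {r : RF} : rbarMk r = 0 ↔ (r : FreeSteenrod) ∈ RF2 :=
  Submodule.Quotient.mk_eq_zero _

/-- The part of `Rbar` that comes from relations of degree `n`. -/
def rbarGr (n : ℕ) : Submodule (ZMod 2) Rbar := ((freeGr n).submoduleOf RF).map rbarMk

/-- Left multiplication of relations by an element of the free algebra, modulo `RF2`. -/
def freeLeft : FreeSteenrod →ₐ[ZMod 2] Module.End (ZMod 2) Rbar :=
  AlgHom.ofLinearMap
    { toFun := fun f => Submodule.mapQ _ _
        ((LinearMap.mulLeft (ZMod 2) f).restrict fun _ hr => mul_mem_RF_left f hr)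
        (fun _ hr => mul_mem_RF2_left f hr)
      map_add' := fun f g => LinearMap.ext fun x => by
        obtain ⟨r, rfl⟩ := rbarMk_surjective x
        exact congrArg rbarMk (Subtype.ext (add_mul f g (r : FreeSteenrod)))
      map_smul' := fun c f => LinearMap.ext fun x => by
        obtain ⟨r, rfl⟩ := rbarMk_surjective x
        exact congrArg rbarMk (Subtype.ext (smul_mul_assoc c f (r : FreeSteenrod))) }
    (LinearMap.ext fun x => by
      obtain ⟨r, rfl⟩ := rbarMk_surjective x
      exact congrArg rbarMk (Subtype.ext (one_mul (r : FreeSteenrod))))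
    (fun f g => LinearMap.ext fun x => by
      obtain ⟨r, rfl⟩ := rbarMk_surjective x
      exact congrArg rbarMk (Subtype.ext (mul_assoc f g (r : FreeSteenrod))))

/-- Right multiplication of relations by an element of the free algebra, modulo `RF2`. -/
def freeRight : FreeSteenrod →ₐ[ZMod 2] (Module.End (ZMod 2) Rbar)ᵐᵒᵖ :=
  AlgHom.ofLinearMap
    { toFun := fun f => MulOpposite.op (Submodule.mapQ _ _
        ((LinearMap.mulRight (ZMod 2) f).restrict fun _ hr => mul_mem_RF_right hr f)
        (fun _ hr => mul_mem_RF2_right hr f))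
      map_add' := fun f g => congrArg MulOpposite.op (LinearMap.ext fun x => by
        obtain ⟨r, rfl⟩ := rbarMk_surjective x
        exact congrArg rbarMk (Subtype.ext (mul_add (r : FreeSteenrod) f g)))
      map_smul' := fun c f => congrArg MulOpposite.op (LinearMap.ext fun x => by
        obtain ⟨r, rfl⟩ := rbarMk_surjective x
        exact congrArg rbarMk (Subtype.ext (mul_smul_comm c (r : FreeSteenrod) f))) }
    (congrArg MulOpposite.op (LinearMap.ext fun x => by
      obtain ⟨r, rfl⟩ := rbarMk_surjective x
      exact congrArg rbarMk (Subtype.ext (mul_one (r : FreeSteenrod)))))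
    (fun f g => congrArg MulOpposite.op (LinearMap.ext fun x => by
      obtain ⟨r, rfl⟩ := rbarMk_surjective x
      exact congrArg rbarMk (Subtype.ext (mul_assoc (r : FreeSteenrod) f g).symm)))

theorem ademRelation_mem {n m : ℕ} (hn : 0 < n) (hm : n < 2 * m) : ademRelation n m ∈ RF := by
  rw [mem_RF]
  have h : proj (ademRelation n m) = proj 0 := RingQuot.mkAlgHom_rel _ (AdemRel.adem n m hn hm)
  rw [h, map_zero]

theorem isAdemFamily_of_free {B : Type} [Ring B] [Algebra (ZMod 2) B]
    (g : FreeSteenrod →ₐ[ZMod 2] B) (hg : ∀ r ∈ RF, g r = 0) :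
    IsAdemFamily fun n => g (freeSq n) := by
  refine ⟨map_one g, fun n m hn hm => ?_⟩
  have h := hg _ (ademRelation_mem hn hm)
  rw [← h, ademRelation]
  exact ((map_ademSum g.toLinearMap _ n m).trans (by simp)).symm

/-- The homomorphism on `A` induced by a homomorphism on the free algebra that kills the ideal of
relations. -/
def descend {B : Type} [Ring B] [Algebra (ZMod 2) B]
    (g : FreeSteenrod →ₐ[ZMod 2] B) (hg : ∀ r ∈ RF, g r = 0) : Steenrod →ₐ[ZMod 2] B :=
  liftAdem _ (isAdemFamily_of_free g hg)

theorem descend_proj {B : Type} [Ring B] [Algebra (ZMod 2) B]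
    (g : FreeSteenrod →ₐ[ZMod 2] B) (hg : ∀ r ∈ RF, g r = 0) (f : FreeSteenrod) :
    descend g hg (proj f) = g f := by
  have : (descend g hg).comp proj = g := by
    apply FreeAlgebra.hom_ext
    funext n
    obtain ⟨m, rfl⟩ : ∃ m : ℕ, n = m.succPNat := ⟨n.natPred, by simp⟩
    exact liftAdem_sq _ _ (m + 1)
  exact DFunLike.congr_fun this f

/-- The left action of `A` on `Rbar`. -/
def leftAction : Steenrod →ₐ[ZMod 2] Module.End (ZMod 2) Rbar :=
  descend freeLeft fun f hf => LinearMap.ext fun x => by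
    obtain ⟨r, rfl⟩ := rbarMk_surjective x
    exact rbarMk_eq_zero.2 (Submodule.mul_mem_mul hf r.2)

/-- The right action of `A` on `Rbar`. -/
def rightAction : Steenrod →ₐ[ZMod 2] (Module.End (ZMod 2) Rbar)ᵐᵒᵖ :=
  descend freeRight fun f hf => congrArg MulOpposite.op (LinearMap.ext fun x => by
    obtain ⟨r, rfl⟩ := rbarMk_surjective x
    exact rbarMk_eq_zero.2 (Submodule.mul_mem_mul r.2 hf))

instance : Module Steenrod Rbar := Module.compHom Rbar leftAction.toRingHom

instance : Module Steenrodᵐᵒᵖ Rbar := Module.compHom Rbar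
  (((RingEquiv.opOp (Module.End (ZMod 2) Rbar)).symm.toRingHom).comp
    (RingHom.op rightAction.toRingHom))

theorem proj_smul (f : FreeSteenrod) (r : RF) :
    proj f • rbarMk r = rbarMk ⟨f * r, mul_mem_RF_left f r.2⟩ :=
  LinearMap.congr_fun (descend_proj freeLeft _ f) (rbarMk r)

theorem op_proj_smul (f : FreeSteenrod) (r : RF) :
    MulOpposite.op (proj f) • rbarMk r = rbarMk ⟨r * f, mul_mem_RF_right r.2 f⟩ :=
  LinearMap.congr_fun (congrArg MulOpposite.unop (descend_proj freeRight _ f)) (rbarMk r)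

instance : SMulCommClass Steenrod Steenrodᵐᵒᵖ Rbar where
  smul_comm a b x := by
    obtain ⟨f, rfl⟩ := proj_surjective a
    obtain ⟨b, rfl⟩ := MulOpposite.op_surjective b
    obtain ⟨g, rfl⟩ := proj_surjective b
    obtain ⟨r, rfl⟩ := rbarMk_surjective x
    rw [op_proj_smul, proj_smul, proj_smul, op_proj_smul]
    exact congrArg rbarMk (Subtype.ext (mul_assoc f (r : FreeSteenrod) g).symm)

/-- The free algebra modulo the square of the ideal of relations. -/
abbrev Fbar : Type := FreeSteenrod ⧸ RF2

/-- The inclusion of `Rbar` into `Fbar`. -/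
def rbarIncl : Rbar →ₗ[ZMod 2] Fbar := Submodule.mapQ _ _ RF.subtype fun _ hr => hr

theorem rbarIncl_mk (r : RF) : rbarIncl (rbarMk r) = RF2.mkQ r := rfl

theorem rbarIncl_injective : Function.Injective rbarIncl := by
  rw [injective_iff_map_eq_zero]
  intro x hx
  obtain ⟨r, rfl⟩ := rbarMk_surjective x
  rw [rbarIncl_mk] at hx
  exact rbarMk_eq_zero.2 ((Submodule.Quotient.mk_eq_zero _).1 hx)

theorem RF2_le : RF2 ≤ RF := Submodule.mul_le.2 fun _ _ _ hb => mul_mem_RF_left _ hb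

/-- The projection of `Fbar` onto `A`. -/
def fbarProj : Fbar →ₗ[ZMod 2] Steenrod := RF2.liftQ proj.toLinearMap RF2_le

theorem exact_rbarIncl : Function.Exact rbarIncl fbarProj := by
  intro x
  obtain ⟨f, rfl⟩ := RF2.mkQ_surjective x
  constructor
  · intro h
    exact ⟨rbarMk ⟨f, h⟩, rfl⟩
  · rintro ⟨y, hy⟩
    obtain ⟨r, rfl⟩ := rbarMk_surjective y
    rw [← hy]
    exact r.2

theorem fbarProj_surjective : Function.Surjective fbarProj := by
  intro a
  obtain ⟨f, rfl⟩ := proj_surjective a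
  exact ⟨RF2.mkQ f, rfl⟩

theorem freeDiag_mem {r : FreeSteenrod} (hr : r ∈ RF) :
    freeDiag r ∈ LinearMap.ker (TensorProduct.map proj.toLinearMap proj.toLinearMap) := by
  have h := diag_proj r
  rw [mem_RF.1 hr, map_zero] at h
  exact h.symm

theorem ker_map_proj_le :
    LinearMap.ker (TensorProduct.map proj.toLinearMap proj.toLinearMap) ≤
      Submodule.span (ZMod 2) {t : FreeSteenrod ⊗[ZMod 2] FreeSteenrod |
        ∃ x y, (x ∈ RF ∨ y ∈ RF) ∧ t = x ⊗ₜ[ZMod 2] y} := by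
  have hex : Function.Exact RF.subtype proj.toLinearMap := fun z => by simp [mem_RF]
  rw [TensorProduct.map_ker hex proj_surjective hex proj_surjective]
  refine sup_le ?_ ?_
  · rintro _ ⟨t, rfl⟩
    induction t with
    | zero => rw [map_zero]; exact Submodule.zero_mem _
    | add x y hx hy => rw [map_add]; exact Submodule.add_mem _ hx hy
    | tmul x y => exact Submodule.subset_span ⟨x, y, Or.inr y.2, rfl⟩
  · rintro _ ⟨t, rfl⟩
    induction t with
    | zero => rw [map_zero]; exact Submodule.zero_mem _
    | add x y hx hy => rw [map_add]; exact Submodule.add_mem _ hx hy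
    | tmul x y => exact Submodule.subset_span ⟨x, y, Or.inl x.2, rfl⟩

theorem map_mul_eq_zero {x y : FreeSteenrod ⊗[ZMod 2] FreeSteenrod}
    (hx : x ∈ LinearMap.ker (TensorProduct.map proj.toLinearMap proj.toLinearMap))
    (hy : y ∈ LinearMap.ker (TensorProduct.map proj.toLinearMap proj.toLinearMap)) :
    TensorProduct.map proj.toLinearMap RF2.mkQ (x * y) = 0 ∧
      TensorProduct.map RF2.mkQ proj.toLinearMap (x * y) = 0 := by
  have h := Submodule.mul_mem_mul (ker_map_proj_le hx) (ker_map_proj_le hy)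
  rw [Submodule.span_mul_span] at h
  generalize x * y = z at h
  have hz {a b : FreeSteenrod} (hab : a ∈ RF ∨ b ∈ RF) : proj (a * b) = 0 := by
    rcases hab with h | h
    · exact mul_mem_RF_right h b
    · exact mul_mem_RF_left a h
  have hq {a b : FreeSteenrod} (ha : a ∈ RF) (hb : b ∈ RF) : RF2.mkQ (a * b) = 0 :=
    (Submodule.Quotient.mk_eq_zero _).2 (Submodule.mul_mem_mul ha hb)
  induction h using Submodule.span_induction with
  | mem z h =>
    obtain ⟨_, ⟨a, b, hab, rfl⟩, _, ⟨c, d, hcd, rfl⟩, rfl⟩ := h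
    simp only [Algebra.TensorProduct.tmul_mul_tmul, TensorProduct.map_tmul,
      AlgHom.toLinearMap_apply]
    constructor
    · by_cases h1 : a ∈ RF ∨ c ∈ RF
      · rw [hz h1, TensorProduct.zero_tmul]
      · rw [hq (by tauto) (by tauto), TensorProduct.tmul_zero]
    · by_cases h1 : b ∈ RF ∨ d ∈ RF
      · rw [hz h1, TensorProduct.tmul_zero]
      · rw [hq (by tauto) (by tauto), TensorProduct.zero_tmul]
  | zero => simp
  | add x y _ _ hx hy => rw [map_add, map_add, hx.1, hy.1, hx.2, hy.2]; simp
  | smul c x _ hx => rw [map_smul, map_smul, hx.1, hx.2]; simp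

theorem map_freeDiag_RF2 {r : FreeSteenrod} (hr : r ∈ RF2) :
    TensorProduct.map proj.toLinearMap RF2.mkQ (freeDiag r) = 0 ∧
      TensorProduct.map RF2.mkQ proj.toLinearMap (freeDiag r) = 0 := by
  unfold RF2 at hr
  induction hr using Submodule.mul_induction_on' with
  | mem_mul_mem a ha b hb =>
    rw [map_mul]
    exact map_mul_eq_zero (freeDiag_mem ha) (freeDiag_mem hb)
  | add x _ y _ hx hy =>
    refine ⟨?_, ?_⟩
    · rw [map_add, map_add, hx.1, hy.1, add_zero]
    · rw [map_add, map_add, hx.2, hy.2, add_zero]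

/-- The diagonal of relations, in `A ⊗ Fbar`. -/
def leftDiag : Rbar →ₗ[ZMod 2] Steenrod ⊗[ZMod 2] Fbar :=
  (RF2.submoduleOf RF).liftQ
    (TensorProduct.map proj.toLinearMap RF2.mkQ ∘ₗ freeDiag.toLinearMap ∘ₗ RF.subtype)
    fun _ hr => (map_freeDiag_RF2 hr).1

/-- The diagonal of relations, in `Fbar ⊗ A`. -/
def rightDiag : Rbar →ₗ[ZMod 2] Fbar ⊗[ZMod 2] Steenrod :=
  (RF2.submoduleOf RF).liftQ
    (TensorProduct.map RF2.mkQ proj.toLinearMap ∘ₗ freeDiag.toLinearMap ∘ₗ RF.subtype)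
    fun _ hr => (map_freeDiag_RF2 hr).2

theorem leftDiag_mem (x : Rbar) : leftDiag x ∈ LinearMap.range (rbarIncl.lTensor Steenrod) := by
  obtain ⟨r, rfl⟩ := rbarMk_surjective x
  refine (lTensor_exact Steenrod exact_rbarIncl fbarProj_surjective _).1 ?_
  refine Eq.trans ?_ (freeDiag_mem r.2)
  change fbarProj.lTensor Steenrod (TensorProduct.map proj.toLinearMap RF2.mkQ _) = _
  rw [← LinearMap.comp_apply, LinearMap.lTensor_comp_map]
  rfl

theorem rightDiag_mem (x : Rbar) : rightDiag x ∈ LinearMap.range (rbarIncl.rTensor Steenrod) := by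
  obtain ⟨r, rfl⟩ := rbarMk_surjective x
  refine (rTensor_exact Steenrod exact_rbarIncl fbarProj_surjective _).1 ?_
  refine Eq.trans ?_ (freeDiag_mem r.2)
  change fbarProj.rTensor Steenrod (TensorProduct.map RF2.mkQ proj.toLinearMap _) = _
  rw [← LinearMap.comp_apply, LinearMap.rTensor_comp_map]
  rfl

/-- The left coaction of `A` on `Rbar`: the diagonal of a relation lies in
`F ⊗ RF + RF ⊗ F`, and the left coaction is its image in `A ⊗ Rbar`. -/
def leftCoaction : Rbar →ₗ[ZMod 2] Steenrod ⊗[ZMod 2] Rbar :=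
  (LinearEquiv.ofInjective (rbarIncl.lTensor Steenrod)
    (Module.Flat.lTensor_preserves_injective_linearMap _ rbarIncl_injective)).symm.toLinearMap ∘ₗ
    LinearMap.codRestrict _ leftDiag leftDiag_mem

/-- The right coaction of `A` on `Rbar`: the image of the diagonal of a relation in `Rbar ⊗ A`. -/
def rightCoaction : Rbar →ₗ[ZMod 2] Rbar ⊗[ZMod 2] Steenrod :=
  (LinearEquiv.ofInjective (rbarIncl.rTensor Steenrod)
    (Module.Flat.rTensor_preserves_injective_linearMap _ rbarIncl_injective)).symm.toLinearMap ∘ₗ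
    LinearMap.codRestrict _ rightDiag rightDiag_mem

theorem lTensor_leftCoaction (r : RF) : rbarIncl.lTensor Steenrod (leftCoaction (rbarMk r)) =
    TensorProduct.map proj.toLinearMap RF2.mkQ (freeDiag r) := by
  rw [leftCoaction, LinearMap.comp_apply]
  exact LinearEquiv.ofInjective_symm_apply (f := rbarIncl.lTensor Steenrod) _

theorem rTensor_rightCoaction (r : RF) : rbarIncl.rTensor Steenrod (rightCoaction (rbarMk r)) =
    TensorProduct.map RF2.mkQ proj.toLinearMap (freeDiag r) := by
  rw [rightCoaction, LinearMap.comp_apply]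
  exact LinearEquiv.ofInjective_symm_apply (f := rbarIncl.rTensor Steenrod) _

end
end SteenrodExt

namespace GradedAux
noncomputable section

/-- A singular extension of a graded Hopf algebra `A` by a graded vector space `R`: a direct sum
diagram `R ⇄ Â ⇄ A`, where `Â` is an algebra and a coalgebra (with no compatibility between the
product and the diagonal), such that `p` is a homomorphism of algebras whose kernel `i R` is an
ideal of square zero, and `s` is a homomorphism of coalgebras whose cokernel `R` is a coideal of
square zero; everything preserves degrees. -/
structure SingularHopfExtension (k A R : Type) [Field k] [Ring A] [Algebra k A] [Coalgebra k A]
    [AddCommGroup R] [Module k R] (𝒜 : ℕ → Submodule k A) (ℛ : ℕ → Submodule k R) where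
  /-- The extended algebra `Â`. -/
  carrier : Type
  [ring : Ring carrier]
  [algebra : Algebra k carrier]
  [coalgebra : Coalgebra k carrier]
  /-- The inclusion of `R`. -/
  i : R →ₗ[k] carrier
  /-- The projection onto `A`. -/
  p : carrier →ₐ[k] A
  /-- The projection onto `R`. -/
  q : carrier →ₗ[k] R
  /-- The inclusion of `A`. -/
  s : A →ₗc[k] carrier
  p_s : ∀ a, p (s a) = a
  q_i : ∀ r, q (i r) = r
  s_p_add_i_q : ∀ x, s (p x) + i (q x) = x
  i_mul_i : ∀ r r', i r * i r' = 0
  q_comul : ∀ x, TensorProduct.map q q (Coalgebra.comul (R := k) x) = 0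
  mul_mem : ∀ m n x y, x ∈ (𝒜 m).map s.toLinearMap ⊔ (ℛ m).map i →
    y ∈ (𝒜 n).map s.toLinearMap ⊔ (ℛ n).map i →
    x * y ∈ (𝒜 (m + n)).map s.toLinearMap ⊔ (ℛ (m + n)).map i
  comul_mem : ∀ n x, x ∈ (𝒜 n).map s.toLinearMap ⊔ (ℛ n).map i →
    Coalgebra.comul (R := k) x ∈ tensorGr (fun m => (𝒜 m).map s.toLinearMap ⊔ (ℛ m).map i)
      (fun m => (𝒜 m).map s.toLinearMap ⊔ (ℛ m).map i) n

attribute [instance] SingularHopfExtension.ring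
attribute [instance] SingularHopfExtension.algebra
attribute [instance] SingularHopfExtension.coalgebra

namespace SingularHopfExtension
variable {k A R : Type} [Field k] [Ring A] [Algebra k A] [Coalgebra k A] [AddCommGroup R]
  [Module k R] {𝒜 : ℕ → Submodule k A} {ℛ : ℕ → Submodule k R}

/-- The degree `n` part of `Â`: the sum of the degree `n` parts of `A` and of `R`. -/
def gr (E : SingularHopfExtension k A R 𝒜 ℛ) (n : ℕ) : Submodule k E.carrier :=
  (𝒜 n).map E.s.toLinearMap ⊔ (ℛ n).map E.i

/-- The extensions `E` and `E'` are the same as split extensions of algebras: the isomorphism of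
direct sum diagrams between them is an isomorphism of algebras. -/
def SameAlgebra (E E' : SingularHopfExtension k A R 𝒜 ℛ) : Prop :=
  ∃ θ : E.carrier ≃ₐ[k] E'.carrier, (∀ r, θ (E.i r) = E'.i r) ∧ (∀ a, θ (E.s a) = E'.s a) ∧
    (∀ x, E'.p (θ x) = E.p x) ∧ ∀ x, E'.q (θ x) = E.q x

/-- The extensions `E` and `E'` are the same as split extensions of coalgebras: the isomorphism of
direct sum diagrams between them is an isomorphism of coalgebras. -/
def SameCoalgebra (E E' : SingularHopfExtension k A R 𝒜 ℛ) : Prop :=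
  ∃ θ : E.carrier ≃ₗc[k] E'.carrier, (∀ r, θ (E.i r) = E'.i r) ∧ (∀ a, θ (E.s a) = E'.s a) ∧
    (∀ x, E'.p (θ x) = E.p x) ∧ ∀ x, E'.q (θ x) = E.q x

/-- The graded algebra extensions `R → Â → A` of `E` and of `E'` are isomorphic. -/
def AlgebraEquivalent (E E' : SingularHopfExtension k A R 𝒜 ℛ) : Prop :=
  ∃ ψ : E.carrier ≃ₐ[k] E'.carrier, (∀ r, ψ (E.i r) = E'.i r) ∧ (∀ x, E'.p (ψ x) = E.p x) ∧
    ∀ n, ∀ x ∈ E.gr n, ψ x ∈ E'.gr n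

/-- The graded coalgebra extensions `A → Â → R` of `E` and of `E'` are isomorphic. -/
def CoalgebraEquivalent (E E' : SingularHopfExtension k A R 𝒜 ℛ) : Prop :=
  ∃ ψ : E.carrier ≃ₗc[k] E'.carrier, (∀ a, ψ (E.s a) = E'.s a) ∧ (∀ x, E'.q (ψ x) = E.q x) ∧
    ∀ n, ∀ x ∈ E.gr n, ψ x ∈ E'.gr n

end SingularHopfExtension

/-- The linear forms on a graded vector space that vanish outside degree `n`. -/
def dualDegree {k V : Type} [Field k] [AddCommGroup V] [Module k V] (𝒱 : ℕ → Submodule k V)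
    (n : ℕ) : Submodule k (Module.Dual k V) where
  carrier := {f | ∀ m, m ≠ n → ∀ v ∈ 𝒱 m, f v = 0}
  zero_mem' := fun _ _ _ _ => rfl
  add_mem' := fun hf hg m hm v hv => by
    rw [LinearMap.add_apply, hf m hm v hv, hg m hm v hv, add_zero]
  smul_mem' := fun c _ hf m hm v hv => by
    rw [LinearMap.smul_apply, hf m hm v hv, smul_zero]

end
end GradedAux

namespace SteenrodExt
open AdemAux GradedAux
noncomputable section

/-- The operator `1 + T` on `V ⊗ V`, where `T` is the interchange of the factors (with coefficients
in `ZMod 2` there are no signs). -/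
def oneAddT {V : Type} [AddCommGroup V] [Module (ZMod 2) V] :
    V ⊗[ZMod 2] V →ₗ[ZMod 2] V ⊗[ZMod 2] V :=
  LinearMap.id + (TensorProduct.comm (ZMod 2) V V).toLinearMap

/-- The class in `Rbar` of the Adem relation `[n, m]`, for `0 < n < 2 m`. -/
def ademClass {n m : ℕ} (hn : 0 < n) (hm : n < 2 * m) : Rbar :=
  rbarMk ⟨ademRelation n m, ademRelation_mem hn hm⟩

/-- The element `S_n`: the sum of all `Sq^a ⊗ Sq^b` with `a + b = n - 1` and `a`, `b` odd. -/
def symElt (n : ℕ) : Steenrod ⊗[ZMod 2] Steenrod :=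
  ∑ t ∈ (Finset.HasAntidiagonal.antidiagonal (n - 1)).filter (fun t => Odd t.1 ∧ Odd t.2),
    sq t.1 ⊗ₜ[ZMod 2] sq t.2

/-- The symmetry operator on the product `Sq^n Sq^m` of two free generators:
`S_n δ(Sq^m) + δ(Sq^n) S_m + δ(Sq^(n-1)) S_(m+1)`, where `Sq^(-1) = 0`. -/
def symFree (n m : ℕ) : Steenrod ⊗[ZMod 2] Steenrod :=
  symElt n * diag (sq m) + diag (sq n) * symElt m +
    if n = 0 then 0 else diag (sq (n - 1)) * symElt (m + 1)

/-- The left action operator on the product `Sq^n Sq^m` of two free generators: the sum of all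
`Sq^a Sq^c ⊗ Sq^b Sq^d` with `a + b = n`, `c + d = m` and `b`, `c` odd. -/
def leftFree (n m : ℕ) : Steenrod ⊗[ZMod 2] Steenrod :=
  ∑ t ∈ (Finset.HasAntidiagonal.antidiagonal n).filter (fun t => Odd t.2),
    ∑ u ∈ (Finset.HasAntidiagonal.antidiagonal m).filter (fun u => Odd u.1),
      (sq t.1 * sq u.1) ⊗ₜ[ZMod 2] (sq t.2 * sq u.2)

/-- The symmetry operator on the Adem relation `[n, m]`. -/
def symAdem (n m : ℕ) : Steenrod ⊗[ZMod 2] Steenrod := ademSum symFree n m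

/-- The left action operator on the Adem relation `[n, m]`. -/
def leftAdem (n m : ℕ) : Steenrod ⊗[ZMod 2] Steenrod := ademSum leftFree n m

/-- The value on `a ⊗ [n, m]` of the left action operator. -/
def leftActionOperator (a : Steenrod) (n m : ℕ) : Steenrod ⊗[ZMod 2] Steenrod :=
  diag (kappa a) * leftAdem n m

/-- The grading of the desuspension of `Rbar`. -/
def desuspGr (n : ℕ) : Submodule (ZMod 2) Rbar := rbarGr (n + 1)

/-- `S` is the symmetry operator: it preserves degrees on the desuspension of `Rbar`, it is a
homomorphism of right modules over `A` (which acts on `A ⊗ A` through the diagonal), and it has the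
prescribed values on the preadmissible relations `α [n, m]`, that is, those for which
`0 < n < 2 m` and the monomial `α Sq^n` is admissible. -/
structure IsSymmetryOperator (S : Rbar →ₗ[ZMod 2] Steenrod ⊗[ZMod 2] Steenrod) : Prop where
  degree : ∀ n, ∀ r ∈ desuspGr n, S r ∈ tensorGr steenrodGr steenrodGr n
  right_linear : ∀ (r : Rbar) (a : Steenrod), S (MulOpposite.op a • r) = S r * diag a
  preadmissible : ∀ (α : List ℕ) (n m : ℕ) (hn : 0 < n) (hm : n < 2 * m),
    List.IsChain (fun a b => 2 * b ≤ a) (α ++ [n]) →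
    S (proj (freeWord α) • ademClass hn hm) = diag (proj (freeWord α)) * symAdem n m +
      oneAddT (leftActionOperator (proj (freeWord α)) n m)

/-- The singular extensions of the Steenrod algebra by the desuspension of `Rbar`. -/
abbrev SteenrodExtension : Type 1 :=
  SingularHopfExtension (ZMod 2) Steenrod Rbar steenrodGr desuspGr

/-- The conditions on the extended Steenrod algebra: the product is the one of the semidirect
product, the induced bimodule and bicomodule structures on `Rbar` are the given ones, and
`(1 + T) δ̂ = S q`. -/
structure IsExtendedSteenrod (S : Rbar →ₗ[ZMod 2] Steenrod ⊗[ZMod 2] Steenrod)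
    (E : SteenrodExtension) : Prop where
  q_mul : ∀ x y, E.q (x * y) = E.p x • E.q y + MulOpposite.op (E.p y) • E.q x
  mul_i : ∀ x r, x * E.i r = E.i (E.p x • r)
  i_mul : ∀ r x, E.i r * x = E.i (MulOpposite.op (E.p x) • r)
  left_coaction : ∀ x, E.q.lTensor E.carrier (Coalgebra.comul (R := ZMod 2) x) =
    E.s.toLinearMap.rTensor Rbar (leftCoaction (E.q x))
  right_coaction : ∀ x, E.q.rTensor E.carrier (Coalgebra.comul (R := ZMod 2) x) =
    E.s.toLinearMap.lTensor Rbar (rightCoaction (E.q x))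
  symmetry : ∀ x, oneAddT (Coalgebra.comul (R := ZMod 2) x) =
    TensorProduct.map E.s.toLinearMap E.s.toLinearMap (S (E.q x))

/-- The dual Steenrod algebra `A_*`. -/
abbrev DualSteenrod : Type := DualAlg steenrodGr

/-- The degree `n` part of the dual Steenrod algebra. -/
def dualSteenrodGr (n : ℕ) : Submodule (ZMod 2) DualSteenrod :=
  (dualDegree steenrodGr n).comap (DualAlg.toDual steenrodGr)

/-- The graded dual of the desuspension of `Rbar`. -/
abbrev DualRbar : Type := gradedDual desuspGr

/-- The degree `n` part of the graded dual of the desuspension of `Rbar`. -/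
def dualRbarGr (n : ℕ) : Submodule (ZMod 2) DualRbar :=
  (dualDegree desuspGr n).comap (gradedDual desuspGr).subtype

/-- An element `x` of `A_*` as a linear form on `A`. -/
abbrev evalA : DualSteenrod →ₗ[ZMod 2] Module.Dual (ZMod 2) Steenrod := DualAlg.toDual steenrodGr

/-- An element `ρ` of `DualRbar` as a linear form on `Rbar`. -/
abbrev evalR : DualRbar →ₗ[ZMod 2] Module.Dual (ZMod 2) Rbar := (gradedDual desuspGr).subtype

/-- The singular extensions of the dual Steenrod algebra by `DualRbar`. -/
abbrev DualSteenrodExtension : Type 1 :=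
  SingularHopfExtension (ZMod 2) DualSteenrod DualRbar dualSteenrodGr dualRbarGr

/-- The conditions on the dual of the extended Steenrod algebra: the coalgebra is the direct sum of
`A_*` and `DualRbar` with the diagonal given by the duals `t`, `t'` of the left and the right action
of `A` on `Rbar`; the induced action of `A_*` on `DualRbar` is dual to the coaction of `A` on
`Rbar`; and `s y * s x = s x * s y + i σ`, where `σ = S_* (x ⊗ y)` is the composite of `S` with the
linear form `x ⊗ y`. -/
structure IsDualExtendedSteenrod (S : Rbar →ₗ[ZMod 2] Steenrod ⊗[ZMod 2] Steenrod)
    (E : DualSteenrodExtension) : Prop where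
  comul_i : ∀ ρ : DualRbar, ∃ (t : DualSteenrod ⊗[ZMod 2] DualRbar)
    (t' : DualRbar ⊗[ZMod 2] DualSteenrod),
    (∀ (a : Steenrod) (r : Rbar), pairing evalA evalR t (a ⊗ₜ r) = evalR ρ (a • r)) ∧
    (∀ (r : Rbar) (a : Steenrod), pairing evalR evalA t' (r ⊗ₜ a) =
      evalR ρ (MulOpposite.op a • r)) ∧
    Coalgebra.comul (R := ZMod 2) (E.i ρ) =
      TensorProduct.map E.s.toLinearMap E.i t + TensorProduct.map E.i E.s.toLinearMap t'
  mul_i : ∀ (x : E.carrier) (ρ : DualRbar), ∃ ρ' : DualRbar,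
    (∀ r, evalR ρ' r = pairing evalA evalR (E.p x ⊗ₜ ρ) (leftCoaction r)) ∧ x * E.i ρ = E.i ρ'
  i_mul : ∀ (ρ : DualRbar) (x : E.carrier), ∃ ρ' : DualRbar,
    (∀ r, evalR ρ' r = pairing evalR evalA (ρ ⊗ₜ E.p x) (rightCoaction r)) ∧ E.i ρ * x = E.i ρ'
  commutation : ∀ x y : DualSteenrod, ∃ σ : DualRbar,
    (∀ r, evalR σ r = pairing evalA evalA (x ⊗ₜ y) (S r)) ∧
    E.s y * E.s x = E.s x * E.s y + E.i σ

end
end SteenrodExt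

open SteenrodExt GradedAux

/-!
The symmetry operator, the dual extension and the primitives all come from one fact of Milnor: the
dual Steenrod algebra `A_*` is a polynomial algebra on elements `ξ_1, ξ_2, …` (`xiEquiv`). It is
proved with the triangularity of the pairing between monomials in the `ξ_i` and admissible monomials
(`exists_separating`), which also shows that admissible monomials are linearly independent.

*The symmetry operator.* The map `freeSym : F_0 → A ⊗ A` is the upper right corner of an upper
triangular representation `symRep` of the free algebra by `3 × 3` matrices over `A ⊗ A`, with diagonal
entries `δ`, and with the corners `δ κ` and a derivation `freeDer` next to the diagonal. Thus
`freeSym (f g) = freeSym f * δ g + δ (κ f) * freeDer g + δ f * freeSym g`. The terms in which a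
relation meets `δ` or `δ κ` vanish, so that `freeSym` kills `R²` and induces `symOp`, which is right
linear. Its value on `α [n, m]` has the prescribed form because `freeDer [n, m]` is the symmetrization
of `L_R [n, m]` (`oneAddT_leftAdem`), by a computation with the parities of the exponents. Rewriting an
inadmissible pair at a time, and the independence of the admissible monomials, show that `R` is
spanned by the elements `α [n, m] β` with `α Sq^n` admissible (`RF_eq_preadmissibleSpan`), so that the
symmetry operator is unique.

*The dual of the symmetry operator.* The operator is symmetric (`swap_symOp`), and compatible with the
diagonals in the sense of `diagFst_symOp`. Hence its dual `dualSym : A_* × A_* → Rbar_*` is a symmetric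
biderivation. Moreover `dualSym (ξ_i, ξ_i) = 0`: on the free algebra, the functional `ξ_i ⊗ ξ_i` takes
on `freeSym f` the value of `ξ_(i+1) + ξ_1 ξ_i²` on the class of `f` in `A`, which is zero for a
relation `f` (`diagonalForm_xi_freeSym`). Since a biderivation of a polynomial algebra may be
prescribed on pairs of generators, there is a biderivation `U` with
`U (x, y) + U (y, x) = dualSym (x, y)` (`exists_biderivation`): it agrees with `dualSym` on
`(ξ_i, ξ_j)` for `i < j` and vanishes for `i ≥ j`.

*Existence.* A biderivation is a 2-cocycle, so that `U` defines a square zero extension of `A_*` by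
`Rbar_*` (`CocycleExt`), whose commutators are given by `dualSym`. With the coalgebra structure dual to
the semidirect product of `A` and `Rbar` it is the extension in the dual statement
(`exists_dualExtendedSteenrod`). Since `U` preserves degrees and everything is of finite type, `U` is
dual to a map `g : Rbar → A ⊗ A`, and adding `g` to the coactions gives a diagonal on the semidirect
product, dual to the product of `CocycleExt` (`exists_extendedSteenrod`).

*Uniqueness.* In any extension, the product of `A_*` with values in `Rbar_*`, or the dual of the
diagonal of `i r` projected to `A ⊗ A`, is a 2-cocycle whose symmetrization is `dualSym`. In
characteristic two, the sum of the cocycles of two extensions is therefore symmetric. A symmetric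
cocycle of a polynomial algebra is a coboundary, because the square zero extension that it defines is
commutative and then splits (`TwoCocycle.exists_primitive`). A primitive, which may be chosen to
preserve degrees (`exists_graded_primitive`), or its dual, shears one extension into the other.
-/

/-! ### Projections of graded vector spaces onto their homogeneous parts -/

namespace GradedAux
noncomputable section
variable {k U V : Type} [Field k] [AddCommGroup U] [Module k U] [AddCommGroup V] [Module k V]

/-- A grading `𝒱` of a vector space `V`, encoded by the projections `π n` onto the parts `𝒱 n`; that
the parts are independent follows from the existence of the projections. -/
structure DegreeProj (𝒱 : ℕ → Submodule k V) where
  /-- The projection onto the part of degree `n`. -/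
  π : ℕ → V →ₗ[k] V
  mem : ∀ n v, π n v ∈ 𝒱 n
  of_mem : ∀ {n v}, v ∈ 𝒱 n → π n v = v
  of_ne : ∀ {m n v}, m ≠ n → v ∈ 𝒱 n → π m v = 0
  top : (⨆ n, 𝒱 n) = ⊤

namespace DegreeProj
variable {𝒰 : ℕ → Submodule k U} {𝒱 : ℕ → Submodule k V} (p : DegreeProj 𝒰) (q : DegreeProj 𝒱)

theorem induction (q : DegreeProj 𝒱) {C : V → Prop} (mem : ∀ n, ∀ v ∈ 𝒱 n, C v) (add : ∀ v w, C v → C w → C (v + w))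
    (v : V) : C v := by
  have hv : v ∈ ⨆ n, 𝒱 n := by rw [q.top]; trivial
  induction hv using Submodule.iSup_induction' with
  | mem n v hv => exact mem n v hv
  | zero => exact mem 0 0 (Submodule.zero_mem _)
  | add x y _ _ hx hy => exact add x y hx hy

theorem exists_sum (v : V) : ∃ N, ∀ M, N ≤ M → ∑ n ∈ Finset.range M, q.π n v = v := by
  refine q.induction (C := fun v => ∃ N, ∀ M, N ≤ M → ∑ n ∈ Finset.range M, q.π n v = v) ?_ ?_ v
  · intro n v hv
    refine ⟨n + 1, fun M hM => ?_⟩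
    rw [Finset.sum_eq_single n, q.of_mem hv]
    · intro b _ hb; exact q.of_ne hb hv
    · intro h; simp only [Finset.mem_range] at h; omega
  · rintro v w ⟨N, hN⟩ ⟨N', hN'⟩
    refine ⟨max N N', fun M hM => ?_⟩
    simp only [map_add, Finset.sum_add_distrib]
    rw [hN M (le_of_max_le_left hM), hN' M (le_of_max_le_right hM)]

theorem mem_of_forall {v : V} {n : ℕ} (h : ∀ m, m ≠ n → q.π m v = 0) : v ∈ 𝒱 n := by
  obtain ⟨N, hN⟩ := q.exists_sum v
  rw [← hN N le_rfl]
  refine Submodule.sum_mem _ fun m _ => ?_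
  by_cases hm : m = n
  · subst hm; exact q.mem _ _
  · rw [h m hm]; exact Submodule.zero_mem _

theorem exists_sum_tensor (t : U ⊗[k] V) : ∃ N, ∀ M, N ≤ M →
    ∑ i ∈ Finset.range M, ∑ j ∈ Finset.range M, TensorProduct.map (p.π i) (q.π j) t = t := by
  induction t with
  | zero => exact ⟨0, fun M _ => by simp⟩
  | add x y hx hy =>
    obtain ⟨N, hN⟩ := hx
    obtain ⟨N', hN'⟩ := hy
    refine ⟨max N N', fun M hM => ?_⟩
    simp only [map_add, Finset.sum_add_distrib]
    rw [hN M (le_of_max_le_left hM), hN' M (le_of_max_le_right hM)]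
  | tmul u v =>
    obtain ⟨N, hN⟩ := p.exists_sum u
    obtain ⟨N', hN'⟩ := q.exists_sum v
    refine ⟨max N N', fun M hM => ?_⟩
    simp only [TensorProduct.map_tmul, ← TensorProduct.tmul_sum, ← TensorProduct.sum_tmul]
    rw [hN M (le_of_max_le_left hM), hN' M (le_of_max_le_right hM)]

theorem map_mem_tensorGr (i j : ℕ) (t : U ⊗[k] V) :
    TensorProduct.map (p.π i) (q.π j) t ∈ tensorGr 𝒰 𝒱 (i + j) := by
  induction t with
  | zero => rw [map_zero]; exact Submodule.zero_mem _
  | add x y hx hy => rw [map_add]; exact Submodule.add_mem _ hx hy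
  | tmul u v => exact Submodule.subset_span ⟨i, j, rfl, _, p.mem i u, _, q.mem j v, rfl⟩

theorem mem_tensorGr {t : U ⊗[k] V} {n : ℕ}
    (h : ∀ i j, i + j ≠ n → TensorProduct.map (p.π i) (q.π j) t = 0) : t ∈ tensorGr 𝒰 𝒱 n := by
  obtain ⟨N, hN⟩ := p.exists_sum_tensor q t
  rw [← hN N le_rfl]
  refine Submodule.sum_mem _ fun i _ => Submodule.sum_mem _ fun j _ => ?_
  by_cases hij : i + j = n
  · subst hij; exact p.map_mem_tensorGr q i j t
  · rw [h i j hij]; exact Submodule.zero_mem _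

theorem map_eq_zero {t : U ⊗[k] V} {n : ℕ} (ht : t ∈ tensorGr 𝒰 𝒱 n) {i j : ℕ} (h : i + j ≠ n) :
    TensorProduct.map (p.π i) (q.π j) t = 0 := by
  induction ht using Submodule.span_induction with
  | mem t ht =>
    obtain ⟨a, b, rfl, u, hu, v, hv, rfl⟩ := ht
    rw [TensorProduct.map_tmul]
    by_cases ha : i = a
    · rw [q.of_ne (show j ≠ b by omega) hv, TensorProduct.tmul_zero]
    · rw [p.of_ne ha hu, TensorProduct.zero_tmul]
  | zero => exact map_zero _
  | add x y _ _ hx hy => rw [map_add, hx, hy, add_zero]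
  | smul c x _ hx => rw [map_smul, hx, smul_zero]

end DegreeProj

theorem map_tensorGr {U' V' : Type} [AddCommGroup U'] [Module k U'] [AddCommGroup V'] [Module k V']
    {𝒰 : ℕ → Submodule k U} {𝒱 : ℕ → Submodule k V} {𝒰' : ℕ → Submodule k U'}
    {𝒱' : ℕ → Submodule k V'} {f : U →ₗ[k] U'} {g : V →ₗ[k] V'}
    (hf : ∀ n, ∀ u ∈ 𝒰 n, f u ∈ 𝒰' n) (hg : ∀ n, ∀ v ∈ 𝒱 n, g v ∈ 𝒱' n) {n : ℕ} {t : U ⊗[k] V}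
    (ht : t ∈ tensorGr 𝒰 𝒱 n) : TensorProduct.map f g t ∈ tensorGr 𝒰' 𝒱' n := by
  induction ht using Submodule.span_induction with
  | mem t ht =>
    obtain ⟨a, b, rfl, u, hu, v, hv, rfl⟩ := ht
    exact Submodule.subset_span ⟨a, b, rfl, _, hf _ _ hu, _, hg _ _ hv, rfl⟩
  | zero => rw [map_zero]; exact Submodule.zero_mem _
  | add x y _ _ hx hy => rw [map_add]; exact Submodule.add_mem _ hx hy
  | smul c x _ hx => rw [map_smul]; exact Submodule.smul_mem _ _ hx

end
end GradedAux

namespace SteenrodExt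
open AdemAux GradedAux
noncomputable section

theorem free_induction {C : FreeSteenrod → Prop} (word : ∀ w, C (freeWord w)) (zero : C 0)
    (add : ∀ f g, C f → C g → C (f + g)) (f : FreeSteenrod) : C f := by
  have hf : f ∈ ⨆ n, freeGr n := by rw [iSup_freeGr]; trivial
  induction hf using Submodule.iSup_induction' with
  | mem n v hv =>
    induction hv using Submodule.span_induction with
    | mem x hx => obtain ⟨w, -, rfl⟩ := hx; exact word w
    | zero => exact zero
    | add x y _ _ hx hy => exact add x y hx hy
    | smul c x _ hx =>
      obtain rfl | rfl : c = 0 ∨ c = 1 := by revert c; decide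
      · rwa [zero_smul]
      · rwa [one_smul]
  | zero => exact zero
  | add x y _ _ hx hy => exact add x y hx hy

theorem freeWord_cons (a : ℕ) (w : List ℕ) : freeWord (a :: w) = freeSq a * freeWord w := by
  simp [freeWord]

theorem freeWord_nil : freeWord [] = 1 := rfl

theorem free_hom_ext {M : Type} [AddCommGroup M] [Module (ZMod 2) M]
    {f g : FreeSteenrod →ₗ[ZMod 2] M} (h : ∀ w, f (freeWord w) = g (freeWord w)) : f = g := by
  apply LinearMap.ext
  intro x
  refine free_induction (C := fun x => f x = g x) h (by simp) (fun x y hx hy => ?_) x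
  rw [map_add, map_add, hx, hy]

/-- A linear property of elements of `A` may be checked on `1` and on left multiples by squares. -/
theorem steenrod_induction {C : Steenrod → Prop} (one : C 1) (mul : ∀ n a, C a → C (sq n * a))
    (zero : C 0) (add : ∀ a b, C a → C b → C (a + b)) (a : Steenrod) : C a := by
  obtain ⟨f, rfl⟩ := proj_surjective a
  refine free_induction (C := fun f => C (proj f)) (fun w => ?_) (by simpa using zero)
    (fun f g hf hg => by rw [map_add]; exact add _ _ hf hg) f
  induction w with
  | nil => simpa [freeWord_nil] using one
  | cons n w ih => rw [freeWord_cons, map_mul]; exact mul n _ ih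

/-- The projections of the Steenrod algebra onto its homogeneous parts. -/
def steenrodProj : DegreeProj steenrodGr where
  π n := ((Polynomial.lcoeff Steenrod n).restrictScalars (ZMod 2)) ∘ₗ steenrodRho.toLinearMap
  mem n a := by
    have ha : a ∈ ⨆ n, steenrodGr n := by rw [iSup_steenrodGr]; trivial
    induction ha using Submodule.iSup_induction' with
    | mem m a ha =>
      simp only [LinearMap.comp_apply, AlgHom.toLinearMap_apply, LinearMap.restrictScalars_apply,
        Polynomial.lcoeff_apply, steenrodRho_of_mem ha, Polynomial.coeff_monomial]
      split_ifs with h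
      · subst h; exact ha
      · exact Submodule.zero_mem _
    | zero => rw [map_zero]; exact Submodule.zero_mem _
    | add x y _ _ hx hy => rw [map_add]; exact Submodule.add_mem _ hx hy
  of_mem ha := by simp [steenrodRho_of_mem ha]
  of_ne h ha := by simp [steenrodRho_of_mem ha, Polynomial.coeff_monomial, h.symm]
  top := iSup_steenrodGr

/-- The map `F → F[X]` that sends an element `f` of degree `n` to `f X ^ n`. -/
def freeRho : FreeSteenrod →ₐ[ZMod 2] Polynomial FreeSteenrod :=
  FreeAlgebra.lift (ZMod 2) fun n : ℕ+ => Polynomial.monomial (n : ℕ) (freeSq n)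

theorem freeRho_word (w : List ℕ) :
    freeRho (freeWord w) = Polynomial.monomial w.sum (freeWord w) := by
  induction w with
  | nil => simp [freeWord]
  | cons a w ih =>
    rw [freeWord_cons, map_mul, ih, freeRho, freeLift_freeSq (fun n => Polynomial.monomial n (freeSq n))
      (by simp [freeSq]), Polynomial.monomial_mul_monomial, List.sum_cons]

theorem freeRho_of_mem {n : ℕ} {f : FreeSteenrod} (hf : f ∈ freeGr n) :
    freeRho f = Polynomial.monomial n f := by
  induction hf using Submodule.span_induction with
  | mem f hf => obtain ⟨w, rfl, rfl⟩ := hf; exact freeRho_word w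
  | zero => simp
  | add x y _ _ hx hy => rw [map_add, hx, hy, map_add]
  | smul c x _ hx => rw [map_smul, hx, Polynomial.smul_monomial]

/-- The projections of the free algebra onto its homogeneous parts. -/
def freeProj : DegreeProj freeGr where
  π n := ((Polynomial.lcoeff FreeSteenrod n).restrictScalars (ZMod 2)) ∘ₗ freeRho.toLinearMap
  mem n a := by
    have ha : a ∈ ⨆ n, freeGr n := by rw [iSup_freeGr]; trivial
    induction ha using Submodule.iSup_induction' with
    | mem m a ha =>
      simp only [LinearMap.comp_apply, AlgHom.toLinearMap_apply, LinearMap.restrictScalars_apply,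
        Polynomial.lcoeff_apply, freeRho_of_mem ha, Polynomial.coeff_monomial]
      split_ifs with h
      · subst h; exact ha
      · exact Submodule.zero_mem _
    | zero => rw [map_zero]; exact Submodule.zero_mem _
    | add x y _ _ hx hy => rw [map_add]; exact Submodule.add_mem _ hx hy
  of_mem ha := by simp [freeRho_of_mem ha]
  of_ne h ha := by simp [freeRho_of_mem ha, Polynomial.coeff_monomial, h.symm]
  top := iSup_freeGr

theorem freeProj_mul (n : ℕ) (f g : FreeSteenrod) : freeProj.π n (f * g) =
    ∑ t ∈ Finset.HasAntidiagonal.antidiagonal n, freeProj.π t.1 f * freeProj.π t.2 g := by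
  simp [freeProj, Polynomial.coeff_mul]

theorem proj_freeProj (n : ℕ) (f : FreeSteenrod) :
    proj (freeProj.π n f) = steenrodProj.π n (proj f) := by
  refine freeProj.induction (C := fun f => proj (freeProj.π n f) = steenrodProj.π n (proj f))
    (fun m f hf => ?_) (fun f g hf hg => by simp only [map_add, hf, hg]) f
  have hf' : proj f ∈ steenrodGr m := ⟨f, hf, rfl⟩
  by_cases h : n = m
  · subst h; rw [freeProj.of_mem hf, steenrodProj.of_mem hf']
  · rw [freeProj.of_ne h hf, steenrodProj.of_ne h hf', map_zero]

theorem freeProj_mem_RF (n : ℕ) {r : FreeSteenrod} (hr : r ∈ RF) : freeProj.π n r ∈ RF := by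
  rw [mem_RF, proj_freeProj, mem_RF.1 hr, map_zero]

theorem freeProj_mem_RF2 (n : ℕ) {r : FreeSteenrod} (hr : r ∈ RF2) : freeProj.π n r ∈ RF2 := by
  unfold RF2 at *
  induction hr using Submodule.mul_induction_on' with
  | mem_mul_mem a ha b hb =>
    rw [freeProj_mul]
    exact Submodule.sum_mem _ fun t _ =>
      Submodule.mul_mem_mul (freeProj_mem_RF _ ha) (freeProj_mem_RF _ hb)
  | add x _ y _ hx hy => rw [map_add]; exact Submodule.add_mem _ hx hy

/-- The projection of `Fbar` onto its part of degree `n`. -/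
def fbarDegree (n : ℕ) : Fbar →ₗ[ZMod 2] Fbar :=
  Submodule.mapQ _ _ (freeProj.π n) fun _ hr => freeProj_mem_RF2 n hr

/-- The projection of `Rbar` onto its part of degree `n`. -/
def rbarDegree (n : ℕ) : Rbar →ₗ[ZMod 2] Rbar :=
  Submodule.mapQ _ _ ((freeProj.π n).restrict fun _ hr => freeProj_mem_RF n hr)
    fun _ hr => freeProj_mem_RF2 n hr

theorem rbarDegree_mk (n : ℕ) (r : RF) :
    rbarDegree n (rbarMk r) = rbarMk ⟨freeProj.π n r, freeProj_mem_RF n r.2⟩ := rfl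

theorem rbarIncl_comp_rbarDegree (n : ℕ) :
    rbarIncl ∘ₗ rbarDegree n = fbarDegree n ∘ₗ rbarIncl := by
  apply LinearMap.ext
  intro x
  obtain ⟨r, rfl⟩ := rbarMk_surjective x
  rfl

theorem mem_freeGr_zero {f : FreeSteenrod} (hf : f ∈ freeGr 0) : ∃ c : ZMod 2, f = c • 1 := by
  induction hf using Submodule.span_induction with
  | mem f hf =>
    obtain ⟨w, hw, rfl⟩ := hf
    refine ⟨1, ?_⟩
    rw [one_smul]
    induction w with
    | nil => rfl
    | cons a w ih =>
      simp only [List.sum_cons, Nat.add_eq_zero_iff] at hw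
      rw [freeWord_cons, ih hw.2, hw.1, mul_one]; rfl
  | zero => exact ⟨0, by simp⟩
  | add x y _ _ hx hy =>
    obtain ⟨c, rfl⟩ := hx
    obtain ⟨d, rfl⟩ := hy
    exact ⟨c + d, by rw [add_smul]⟩
  | smul c x _ hx =>
    obtain ⟨d, rfl⟩ := hx
    exact ⟨c * d, by rw [mul_smul]⟩

theorem rbarDegree_zero (x : Rbar) : rbarDegree 0 x = 0 := by
  obtain ⟨r, rfl⟩ := rbarMk_surjective x
  rw [rbarDegree_mk]
  have h := freeProj_mem_RF 0 r.2
  obtain ⟨c, hc⟩ := mem_freeGr_zero (freeProj.mem 0 (r : FreeSteenrod))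
  have h2 : c = 0 := by
    have h3 := congrArg aug (mem_RF.1 h)
    rw [hc, map_smul, map_smul, map_one, map_one, map_zero] at h3
    simpa using h3
  rw [rbarMk_eq_zero]
  simp only [hc, h2, zero_smul]
  exact Submodule.zero_mem _

/-- The projections of the desuspension of `Rbar` onto its homogeneous parts. -/
def desuspProj : DegreeProj desuspGr where
  π n := rbarDegree (n + 1)
  mem n x := by
    obtain ⟨r, rfl⟩ := rbarMk_surjective x
    exact ⟨⟨freeProj.π (n + 1) r, freeProj_mem_RF _ r.2⟩, freeProj.mem _ _, rfl⟩
  of_mem {n x} hx := by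
    obtain ⟨r, hr, rfl⟩ := hx
    rw [rbarDegree_mk]
    exact congrArg rbarMk (Subtype.ext (freeProj.of_mem hr))
  of_ne {m n x} h hx := by
    obtain ⟨r, hr, rfl⟩ := hx
    rw [rbarDegree_mk, rbarMk_eq_zero]
    have : freeProj.π (m + 1) (r : FreeSteenrod) = 0 :=
      freeProj.of_ne (show m + 1 ≠ n + 1 by omega) hr
    simp only [this]
    exact Submodule.zero_mem _
  top := by
    rw [eq_top_iff]
    rintro x -
    obtain ⟨r, rfl⟩ := rbarMk_surjective x
    obtain ⟨N, hN⟩ := freeProj.exists_sum (r : FreeSteenrod)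
    have h : rbarMk r = ∑ n ∈ Finset.range (N + 1), rbarDegree n (rbarMk r) := by
      simp only [rbarDegree_mk, ← map_sum]
      refine congrArg rbarMk (Subtype.ext ?_)
      rw [AddSubmonoidClass.coe_finsetSum]
      exact (hN (N + 1) (by omega)).symm
    rw [h, Finset.sum_range_succ', rbarDegree_zero, add_zero]
    refine Submodule.sum_mem _ fun n _ => Submodule.mem_iSup_of_mem n ?_
    exact ⟨⟨freeProj.π (n + 1) r, freeProj_mem_RF _ r.2⟩, freeProj.mem _ _, rfl⟩

end
end SteenrodExt

/-! ### The dual Steenrod algebra -/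

namespace SteenrodExt
open AdemAux GradedAux
noncomputable section

/-- The interchange of factors, as a homomorphism of algebras. -/
def swap : Steenrod ⊗[ZMod 2] Steenrod →ₐ[ZMod 2] Steenrod ⊗[ZMod 2] Steenrod :=
  (Algebra.TensorProduct.comm (ZMod 2) Steenrod Steenrod).toAlgHom

@[simp] theorem swap_tmul (a b : Steenrod) : swap (a ⊗ₜ[ZMod 2] b) = b ⊗ₜ a := rfl

theorem swap_diag (a : Steenrod) : swap (diag a) = diag a := by
  have : swap.comp diag = diag := by
    apply steenrod_hom_ext
    intro n
    rw [AlgHom.comp_apply, diag_sq, map_sum]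
    exact Finset.sum_equiv (Equiv.prodComm ℕ ℕ) (by simp [add_comm]) (by simp)
  exact DFunLike.congr_fun this a

theorem evalA_mul (x y : DualSteenrod) (a : Steenrod) :
    evalA (x * y) a = pairing evalA evalA (x ⊗ₜ y) (diag a) := by
  have h (t : Steenrod ⊗[ZMod 2] Steenrod) :
      LinearMap.mul' (ZMod 2) (ZMod 2) (TensorProduct.map (evalA x) (evalA y) t) =
        pairing evalA evalA (x ⊗ₜ y) t := by
    induction t with
    | zero => simp
    | add t u ht hu => simp only [map_add, ht, hu]
    | tmul a b => simp
  exact h (diag a)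

theorem evalA_one (a : Steenrod) : evalA 1 a = aug a := rfl

theorem pairing_swap (x y : DualSteenrod) (t : Steenrod ⊗[ZMod 2] Steenrod) :
    pairing evalA evalA (x ⊗ₜ y) (swap t) = pairing evalA evalA (y ⊗ₜ x) t := by
  induction t with
  | zero => simp
  | add t u ht hu => simp only [map_add, ht, hu]
  | tmul a b => simp [mul_comm]

theorem evalA_injective : Function.Injective evalA := DualAlg.toDual_injective steenrodGr

theorem dual_ext {x y : DualSteenrod} (h : ∀ a, evalA x a = evalA y a) : x = y :=
  evalA_injective (LinearMap.ext h)

instance : CommRing DualSteenrod :=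
  { (inferInstance : Ring DualSteenrod) with
    mul_comm := fun x y => dual_ext fun a => by
      rw [evalA_mul, evalA_mul, ← pairing_swap, swap_diag] }

/-- The element of `A_*` given by a linear form on `A`. -/
def dualMk (f : Module.Dual (ZMod 2) Steenrod) (h : f ∈ gradedDual steenrodGr) : DualSteenrod :=
  ⟨WithConv.toConv f, h⟩

/-- The operator on `A_*` dual to left multiplication by `Sq^b`. -/
def lam (b : ℕ) : DualSteenrod →ₗ[ZMod 2] DualSteenrod where
  toFun x := dualMk (evalA x ∘ₗ LinearMap.mulLeft (ZMod 2) (sq b)) (by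
    obtain ⟨N, hN⟩ := x.2
    exact ⟨N, fun n hn v hv => hN (b + n) (by omega) _ (steenrodGr_mul_mem (sq_mem b) hv)⟩)
  map_add' _ _ := rfl
  map_smul' _ _ := rfl

theorem evalA_lam (b : ℕ) (x : DualSteenrod) (a : Steenrod) :
    evalA (lam b x) a = evalA x (sq b * a) := rfl

theorem pairing_lam (i j : ℕ) (x y : DualSteenrod) (t : Steenrod ⊗[ZMod 2] Steenrod) :
    pairing evalA evalA (x ⊗ₜ y) (sq i ⊗ₜ[ZMod 2] sq j * t) =
      pairing evalA evalA (lam i x ⊗ₜ lam j y) t := by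
  induction t with
  | zero => simp
  | add t u ht hu => simp only [map_add, ht, hu, mul_add]
  | tmul a b => simp [evalA_lam]

theorem pairing_diag_sq_mul (n : ℕ) (x y : DualSteenrod) (t : Steenrod ⊗[ZMod 2] Steenrod) :
    pairing evalA evalA (x ⊗ₜ y) (diag (sq n) * t) =
      ∑ p ∈ Finset.HasAntidiagonal.antidiagonal n,
        pairing evalA evalA (lam p.1 x ⊗ₜ lam p.2 y) t := by
  rw [diag_sq, Finset.sum_mul, map_sum]
  simp_rw [pairing_lam]

theorem lam_mul (n : ℕ) (x y : DualSteenrod) :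
    lam n (x * y) = ∑ p ∈ Finset.HasAntidiagonal.antidiagonal n, lam p.1 x * lam p.2 y := by
  apply dual_ext
  intro a
  rw [evalA_lam, evalA_mul, map_mul, pairing_diag_sq_mul, map_sum, LinearMap.sum_apply]
  simp_rw [evalA_mul]

theorem lam_one (n : ℕ) : lam n 1 = if n = 0 then 1 else 0 := by
  apply dual_ext
  intro a
  rw [evalA_lam, evalA_one, map_mul, aug_sq]
  split_ifs <;> simp [evalA_one]

/-! ### The Milnor generators -/

/-- The action of `Sq^n` on the span of the classes `x_i = x ^ (2 ^ i)` in the cohomology of the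
infinite real projective space. -/
def projectiveSq (n : ℕ) : Module.End (ZMod 2) (ℕ →₀ ZMod 2) :=
  Finsupp.linearCombination (ZMod 2) fun i =>
    if n = 0 then Finsupp.single i 1 else if n = 2 ^ i then Finsupp.single (i + 1) 1 else 0

theorem projectiveSq_single (n i : ℕ) : projectiveSq n (Finsupp.single i 1) =
    if n = 0 then Finsupp.single i 1 else if n = 2 ^ i then Finsupp.single (i + 1) 1 else 0 := by
  simp [projectiveSq]

theorem two_dvd_choose_of_add_eq_two_pow {i : ℕ} : ∀ {n m : ℕ}, 0 < n → 0 < m →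
    n + m = 2 ^ i → 2 ∣ (m - 1).choose n := by
  induction i with
  | zero => intro n m hn hm h; omega
  | succ i ih =>
    intro n m hn hm h
    have := Fact.mk Nat.prime_two
    have hl := Choose.choose_modEq_choose_mod_mul_choose_div_nat (p := 2) (n := m - 1) (k := n)
    refine (Nat.modEq_zero_iff_dvd.1 (hl.trans (Nat.modEq_zero_iff_dvd.2 ?_)))
    rw [pow_succ] at h
    rcases Nat.mod_two_eq_zero_or_one n with hn2 | hn2
    · refine Dvd.dvd.mul_left ?_ _
      rw [show (m - 1) / 2 = m / 2 - 1 by omega]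
      exact ih (by omega) (by omega) (by omega)
    · rw [hn2, show (m - 1) % 2 = 0 by omega]
      simp

theorem isAdemFamily_projectiveSq : IsAdemFamily projectiveSq := by
  have h0 : projectiveSq 0 = 1 := by
    apply Finsupp.lhom_ext'
    intro i
    apply LinearMap.ext_ring
    simp [projectiveSq_single]
  refine ⟨h0, fun n m hn hm => ?_⟩
  apply Finsupp.lhom_ext'
  intro i
  apply LinearMap.ext_ring
  have hpos (j : ℕ) : 0 < 2 ^ j := by positivity
  have h1 : (projectiveSq n * projectiveSq m) (Finsupp.single i 1) = 0 := by
    rw [Module.End.mul_apply, projectiveSq_single, if_neg (by omega)]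
    split_ifs with h
    · rw [projectiveSq_single, if_neg (by omega), if_neg]
      rw [pow_succ]; omega
    · exact map_zero _
  have h2 (l : ℕ) (hl : l ∈ Finset.range (n / 2 + 1)) (hl0 : l ≠ 0) :
      (projectiveSq (n + m - l) * projectiveSq l) (Finsupp.single i 1) = 0 := by
    simp only [Finset.mem_range] at hl
    rw [Module.End.mul_apply, projectiveSq_single, if_neg (by omega)]
    split_ifs with h
    · rw [projectiveSq_single, if_neg (by omega), if_neg]
      rw [pow_succ]; omega
    · exact map_zero _
  simp only [ademSum, LinearMap.comp_apply, Finsupp.lsingle_apply, LinearMap.add_apply,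
    LinearMap.sum_apply, LinearMap.smul_apply, h1, LinearMap.zero_apply, zero_add]
  rw [Finset.sum_eq_single 0]
  · simp only [Nat.sub_zero, h0, mul_one, mul_zero, projectiveSq_single]
    rw [if_neg (by omega)]
    split_ifs with h
    · have := two_dvd_choose_of_add_eq_two_pow hn (by omega) h
      rw [(ZMod.natCast_eq_zero_iff _ _).2 this, zero_smul]
    · exact smul_zero _
  · intro l hl hl0
    rw [h2 l hl hl0, smul_zero]
  · intro h; simp at h

/-- The action of the Steenrod algebra on the span of the classes `x_i`. -/
def projectiveRep : Steenrod →ₐ[ZMod 2] Module.End (ZMod 2) (ℕ →₀ ZMod 2) :=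
  liftAdem _ isAdemFamily_projectiveSq

/-- The linear form `ξ_j` on `A`: the coefficient of `x_j` in `a x_0`. -/
def xiForm (j : ℕ) : Module.Dual (ZMod 2) Steenrod :=
  Finsupp.lapply j ∘ₗ LinearMap.applyₗ (Finsupp.single 0 1) ∘ₗ projectiveRep.toLinearMap

theorem xiForm_apply (j : ℕ) (a : Steenrod) :
    xiForm j a = projectiveRep a (Finsupp.single 0 1) j := rfl

theorem projectiveSq_apply_zero (n : ℕ) (v : ℕ →₀ ZMod 2) :
    projectiveSq n v 0 = if n = 0 then v 0 else 0 := by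
  induction v using Finsupp.induction_linear with
  | zero => simp
  | add f g hf hg => rw [map_add, Finsupp.add_apply, hf, hg]; split_ifs <;> simp
  | single i c =>
    rw [← mul_one c, ← smul_eq_mul, ← Finsupp.smul_single, map_smul, projectiveSq_single]
    split_ifs <;> simp

theorem projectiveSq_apply_succ (n j : ℕ) (v : ℕ →₀ ZMod 2) :
    projectiveSq n v (j + 1) =
      (if n = 0 then v (j + 1) else 0) + if n = 2 ^ j then v j else 0 := by
  induction v using Finsupp.induction_linear with
  | zero => simp
  | add f g hf hg =>
    rw [(projectiveSq n).map_add, Finsupp.add_apply, hf, hg]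
    simp only [Finsupp.add_apply]
    split_ifs <;> ring
  | single i c =>
    rw [← mul_one c, ← smul_eq_mul, ← Finsupp.smul_single, map_smul, projectiveSq_single]
    by_cases h0 : n = 0
    · subst h0
      simp [(show (0 : ℕ) ≠ 2 ^ j from (by positivity : (0 : ℕ) < 2 ^ j).ne)]
    · by_cases hij : i = j
      · subst hij; simp [h0]; split_ifs <;> simp
      · have : n = 2 ^ i → n ≠ 2 ^ j := by
          rintro rfl h; exact hij (Nat.pow_right_injective le_rfl h)
        simp only [h0, if_false, Finsupp.smul_apply]
        split_ifs with h1 h2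
        · exact absurd h2 (this h1)
        · simp [hij]
        · simp [hij]
        · simp

theorem xiForm_zero_sq_mul (n : ℕ) (a : Steenrod) :
    xiForm 0 (sq n * a) = if n = 0 then xiForm 0 a else 0 := by
  rw [xiForm_apply, map_mul, Module.End.mul_apply, projectiveRep, liftAdem_sq,
    projectiveSq_apply_zero]; rfl

theorem xiForm_succ_sq_mul (n j : ℕ) (a : Steenrod) : xiForm (j + 1) (sq n * a) =
    (if n = 0 then xiForm (j + 1) a else 0) + if n = 2 ^ j then xiForm j a else 0 := by
  rw [xiForm_apply, map_mul, Module.End.mul_apply, projectiveRep, liftAdem_sq,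
    projectiveSq_apply_succ]; rfl

theorem xiForm_word {w : List ℕ} : ∀ {j : ℕ}, w.sum + 1 ≠ 2 ^ j →
    xiForm j (proj (freeWord w)) = 0 := by
  induction w with
  | nil =>
    intro j hj
    rw [freeWord_nil, map_one, xiForm_apply, map_one]
    have : j ≠ 0 := by rintro rfl; simp at hj
    simp [this.symm]
  | cons n w ih =>
    intro j hj
    rw [freeWord_cons, map_mul]
    change xiForm j (sq n * _) = 0
    rw [List.sum_cons] at hj
    cases j with
    | zero =>
      rw [xiForm_zero_sq_mul]
      split_ifs with h
      · exact ih (by omega)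
      · rfl
    | succ j =>
      rw [xiForm_succ_sq_mul]
      have h1 : (if n = 0 then xiForm (j + 1) (proj (freeWord w)) else 0) = 0 := by
        split_ifs with h
        · exact ih (by omega)
        · rfl
      have h2 : (if n = 2 ^ j then xiForm j (proj (freeWord w)) else 0) = 0 := by
        split_ifs with h
        · exact ih (by rw [pow_succ] at hj; omega)
        · rfl
      rw [h1, h2, add_zero]

theorem xiForm_of_mem {n j : ℕ} (h : n + 1 ≠ 2 ^ j) {a : Steenrod} (ha : a ∈ steenrodGr n) :
    xiForm j a = 0 := by
  obtain ⟨f, hf, rfl⟩ := ha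
  change f ∈ freeGr n at hf
  change xiForm j (proj f) = 0
  induction hf using Submodule.span_induction with
  | mem f hf => obtain ⟨w, rfl, rfl⟩ := hf; exact xiForm_word h
  | zero => simp
  | add x y _ _ hx hy => rw [map_add, map_add, hx, hy, add_zero]
  | smul c x _ hx => rw [map_smul, map_smul, hx, smul_zero]

/-- The element `ξ_j` of the dual Steenrod algebra, of degree `2 ^ j - 1`; in particular
`ξ_0 = 1`. -/
def xi (j : ℕ) : DualSteenrod :=
  dualMk (xiForm j) ⟨2 ^ j, fun _ hn _ hv => xiForm_of_mem (by omega) hv⟩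

theorem evalA_xi (j : ℕ) (a : Steenrod) : evalA (xi j) a = xiForm j a := rfl

theorem xi_mem (j : ℕ) : xi j ∈ dualSteenrodGr (2 ^ j - 1) := fun _ hm _ hv =>
  xiForm_of_mem (fun h => hm (by omega)) hv

theorem xi_zero : xi 0 = 1 := by
  apply dual_ext
  intro a
  rw [evalA_xi, evalA_one]
  refine steenrod_induction (C := fun a => xiForm 0 a = aug a) ?_ ?_ (by simp) ?_ a
  · rw [xiForm_apply, map_one, map_one]; simp
  · intro n a ha
    rw [xiForm_zero_sq_mul, map_mul, aug_sq, ha]; split_ifs <;> simp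
  · intro a b ha hb; rw [map_add, map_add, ha, hb]

theorem lam_xi_succ (n j : ℕ) :
    lam n (xi (j + 1)) = (if n = 0 then xi (j + 1) else 0) + if n = 2 ^ j then xi j else 0 := by
  apply dual_ext
  intro a
  rw [evalA_lam, evalA_xi, xiForm_succ_sq_mul, map_add, LinearMap.add_apply]
  congr 1 <;> split_ifs <;> simp [evalA_xi]

end
end SteenrodExt

/-! ### Admissible monomials -/

namespace SteenrodExt
open AdemAux GradedAux
noncomputable section

/-- The first exponent of the admissible monomial with the differences `r`. -/
def leadExponent : List ℕ → ℕ
  | [] => 0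
  | a :: r => a + 2 * leadExponent r

/-- The admissible sequence `(i_1, i_2, …)` with the differences `i_j - 2 i_{j+1}` in the list `r`. -/
def admWord : List ℕ → List ℕ
  | [] => []
  | a :: r => leadExponent (a :: r) :: admWord r

theorem exists_admWord {w : List ℕ} (hw : List.IsChain (fun a b => 2 * b ≤ a) w) :
    ∃ r, admWord r = w ∧ leadExponent r = w.headI := by
  induction w with
  | nil => exact ⟨[], rfl, rfl⟩
  | cons a w ih =>
    obtain ⟨r, hr, hr'⟩ := ih hw.tail
    have ha : 2 * leadExponent r ≤ a := by
      cases w with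
      | nil => rw [hr']; simp
      | cons b w => rw [hr']; exact (List.isChain_cons_cons.1 hw).1
    refine ⟨(a - 2 * leadExponent r) :: r, ?_, ?_⟩
    · rw [admWord, hr, leadExponent]; congr 1; omega
    · rw [leadExponent, List.headI_cons]; omega

theorem exists_not_admissible : ∀ w : List ℕ, List.IsChain (fun a b => 2 * b ≤ a) w ∨
    ∃ α n m β, w = α ++ n :: m :: β ∧ List.IsChain (fun a b => 2 * b ≤ a) (α ++ [n]) ∧ n < 2 * m
  | [] => Or.inl List.IsChain.nil
  | [a] => Or.inl (List.IsChain.singleton a)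
  | a :: b :: w => by
    by_cases hab : 2 * b ≤ a
    · rcases exists_not_admissible (b :: w) with h | ⟨α, n, m, β, h, h1, h2⟩
      · exact Or.inl (List.isChain_cons_cons.2 ⟨hab, h⟩)
      · refine Or.inr ⟨a :: α, n, m, β, by rw [h]; rfl, ?_, h2⟩
        cases α with
        | nil =>
          simp only [List.nil_append, List.cons.injEq] at h
          simp [← h.1, hab]
        | cons c α =>
          simp only [List.cons_append, List.cons.injEq] at h
          rw [List.cons_append, List.cons_append, List.isChain_cons_cons]
          exact ⟨h.1 ▸ hab, h1⟩
    · exact Or.inr ⟨[], a, b, w, rfl, List.IsChain.singleton a, by omega⟩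

/-- The moment `∑ j w_j` of a sequence of exponents, with positions counted from zero. -/
def moment : List ℕ → ℕ
  | [] => 0
  | _ :: w => moment w + w.sum

theorem moment_append_lt (α : List ℕ) {u v : List ℕ} (hs : u.sum = v.sum)
    (h : moment u < moment v) : moment (α ++ u) < moment (α ++ v) := by
  induction α with
  | nil => exact h
  | cons a α ih => simp only [List.cons_append, moment, List.sum_append, hs]; omega

theorem sum_filter_pos (w : List ℕ) : (w.filter (fun n => 0 < n)).sum = w.sum := by
  induction w with
  | nil => rfl
  | cons a w ih =>
    rcases Nat.eq_zero_or_pos a with rfl | ha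
    · simpa using ih
    · simpa [ha] using ih

theorem moment_filter_pos_le (w : List ℕ) : moment (w.filter (fun n => 0 < n)) ≤ moment w := by
  induction w with
  | nil => exact le_rfl
  | cons a w ih =>
    rcases Nat.eq_zero_or_pos a with rfl | ha
    · simp only [lt_self_iff_false, decide_false, Bool.false_eq_true, not_false_eq_true,
        List.filter_cons_of_neg, moment]; omega
    · simp only [ha, decide_true, List.filter_cons_of_pos, moment, sum_filter_pos]; omega

/-- The span of the right multiples of the preadmissible relations. -/
def preadmissibleSpan : Submodule (ZMod 2) FreeSteenrod :=
  Submodule.span (ZMod 2) {f | ∃ (α : List ℕ) (n m : ℕ) (β : List ℕ), 0 < n ∧ n < 2 * m ∧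
    List.IsChain (fun a b => 2 * b ≤ a) (α ++ [n]) ∧
    f = freeWord α * ademRelation n m * freeWord β}

/-- The span of the admissible monomials. -/
def admissibleSpan : Submodule (ZMod 2) FreeSteenrod :=
  Submodule.span (ZMod 2) (Set.range fun r => freeWord (admWord r))

/-- Rewriting the first inadmissible pair of a monomial by its Adem relation lowers the moment. -/
theorem freeWord_mem_sup : ∀ (N : ℕ) (w : List ℕ), moment w + w.length = N →
    freeWord w ∈ admissibleSpan ⊔ preadmissibleSpan := by
  intro N
  induction N using Nat.strong_induction_on with
  | _ N ih =>
    intro w hN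
    -- Since `Sq^0 = 1`, zero exponents can be dropped first, which lowers the length and does not
    -- raise the moment. Adem relations need a positive first exponent.
    by_cases h0 : 0 ∈ w
    · rw [← freeWord_filter]
      refine ih _ ?_ _ rfl
      have h1 : (w.filter (fun n => 0 < n)).length < w.length :=
        List.length_filter_lt_length_iff_exists.2 ⟨0, h0, by simp⟩
      have := moment_filter_pos_le w
      omega
    · rcases exists_not_admissible w with h | ⟨α, n, m, β, rfl, h1, h2⟩
      · obtain ⟨r, rfl, -⟩ := exists_admWord h
        exact Submodule.mem_sup_left (Submodule.subset_span ⟨r, rfl⟩)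
      · have hn : 0 < n := Nat.pos_of_ne_zero fun h => h0 (by simp [h])
        have e : freeWord (α ++ n :: m :: β) = freeWord α * ademRelation n m * freeWord β +
            ∑ k ∈ Finset.range (n / 2 + 1), ((Nat.choose (m - k - 1) (n - 2 * k) : ℕ) : ZMod 2) •
              freeWord (α ++ (n + m - k) :: k :: β) := by
          simp only [freeWord_append, freeWord_cons, ademRelation, ademSum, mul_add, add_mul,
            Finset.mul_sum, Finset.sum_mul, mul_smul_comm, smul_mul_assoc, mul_assoc]
          rw [add_assoc, ZModModule.add_self, add_zero]
        rw [e]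
        refine Submodule.add_mem _ (Submodule.mem_sup_right
          (Submodule.subset_span ⟨α, n, m, β, hn, h2, h1, rfl⟩))
          (Submodule.sum_mem _ fun k hk => Submodule.smul_mem _ _ ?_)
        simp only [Finset.mem_range] at hk
        refine ih _ ?_ _ rfl
        have := moment_append_lt α (u := (n + m - k) :: k :: β) (v := n :: m :: β)
          (by simp only [List.sum_cons]; omega) (by simp only [moment, List.sum_cons]; omega)
        simp only [List.length_append, List.length_cons] at hN ⊢
        omega

theorem sup_preadmissibleSpan : admissibleSpan ⊔ preadmissibleSpan = ⊤ := by
  rw [eq_top_iff]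
  rintro f -
  exact free_induction (fun w => freeWord_mem_sup _ w rfl) (Submodule.zero_mem _)
    (fun _ _ => Submodule.add_mem _) f

theorem preadmissibleSpan_le : preadmissibleSpan ≤ RF := by
  refine Submodule.span_le.2 ?_
  rintro _ ⟨α, n, m, β, hn, hm, -, rfl⟩
  exact mul_mem_RF_right (mul_mem_RF_left _ (ademRelation_mem hn hm)) _

/-! ### The Milnor basis -/

/-- The admissible monomial with the differences `r`, in the Steenrod algebra. -/
def admElt (r : List ℕ) : Steenrod := proj (freeWord (admWord r))

theorem admElt_cons (a : ℕ) (r : List ℕ) :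
    admElt (a :: r) = sq (leadExponent (a :: r)) * admElt r := by
  rw [admElt, admWord, freeWord_cons, map_mul]; rfl

/-- The monomial `ξ_c ^ r_1 ξ_{c+1} ^ r_2 ⋯`. -/
def xiMonomial (c : ℕ) : List ℕ → DualSteenrod
  | [] => 1
  | a :: r => xi c ^ a * xiMonomial (c + 1) r

theorem xiMonomial_zero_cons (a : ℕ) (r : List ℕ) : xiMonomial 0 (a :: r) = xiMonomial 1 r := by
  rw [xiMonomial, xi_zero, one_pow, one_mul]

/-- The highest nonzero value of `lam · x` is `y`, at `d`. -/
def IsTopLam (x : DualSteenrod) (d : ℕ) (y : DualSteenrod) : Prop :=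
  lam d x = y ∧ ∀ b, d < b → lam b x = 0

theorem IsTopLam.one : IsTopLam 1 0 1 :=
  ⟨by simp [lam_one], fun b hb => by rw [lam_one, if_neg (by omega)]⟩

theorem IsTopLam.mul {x x' y y' : DualSteenrod} {d d' : ℕ} (h : IsTopLam x d y)
    (h' : IsTopLam x' d' y') : IsTopLam (x * x') (d + d') (y * y') := by
  constructor
  · rw [lam_mul, Finset.sum_eq_single (d, d'), h.1, h'.1]
    · rintro ⟨a, b⟩ hab hne
      simp only [Finset.HasAntidiagonal.mem_antidiagonal] at hab
      rcases lt_trichotomy d a with h1 | h1 | h1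
      · rw [h.2 a h1, zero_mul]
      · exact absurd (Prod.ext h1.symm (by simp only; omega)) hne
      · rw [h'.2 b (by omega), mul_zero]
    · simp
  · intro b hb
    rw [lam_mul]
    refine Finset.sum_eq_zero fun p hp => ?_
    simp only [Finset.HasAntidiagonal.mem_antidiagonal] at hp
    by_cases h1 : d < p.1
    · rw [h.2 _ h1, zero_mul]
    · rw [h'.2 _ (by omega), mul_zero]

theorem IsTopLam.pow {x y : DualSteenrod} {d : ℕ} (h : IsTopLam x d y) (a : ℕ) :
    IsTopLam (x ^ a) (a * d) (y ^ a) := by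
  induction a with
  | zero => simpa using IsTopLam.one
  | succ a ih => rw [pow_succ, pow_succ, add_mul, one_mul]; exact ih.mul h

theorem IsTopLam.xi (j : ℕ) : IsTopLam (xi (j + 1)) (2 ^ j) (SteenrodExt.xi j) := by
  have h : 0 < 2 ^ j := by positivity
  exact ⟨by simp [lam_xi_succ], fun b hb => by
    rw [lam_xi_succ, if_neg (by omega), if_neg (by omega), add_zero]⟩

theorem isTopLam_xiMonomial (r : List ℕ) : ∀ c,
    IsTopLam (xiMonomial (c + 1) r) (2 ^ c * leadExponent r) (xiMonomial c r) := by
  induction r with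
  | nil => intro c; exact IsTopLam.one
  | cons a r ih =>
    intro c
    have := ((IsTopLam.xi c).pow a).mul (ih (c + 1))
    have e : 2 ^ c * leadExponent (a :: r) = a * 2 ^ c + 2 ^ (c + 1) * leadExponent r := by
      rw [leadExponent, pow_succ]; ring
    rw [e]
    exact this

theorem evalA_xiMonomial_of_lt {a b : ℕ} {r s : List ℕ}
    (h : leadExponent (a :: r) < leadExponent (b :: s)) :
    evalA (xiMonomial 1 (a :: r)) (admElt (b :: s)) = 0 := by
  rw [admElt_cons, ← evalA_lam, (isTopLam_xiMonomial (a :: r) 0).2 _ (by simpa using h)]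
  simp

theorem evalA_xiMonomial_of_eq {a b : ℕ} {r s : List ℕ}
    (h : leadExponent (b :: s) = leadExponent (a :: r)) :
    evalA (xiMonomial 1 (a :: r)) (admElt (b :: s)) = evalA (xiMonomial 1 r) (admElt s) := by
  have h2 := (isTopLam_xiMonomial (a :: r) 0).1
  rw [pow_zero, one_mul, xiMonomial_zero_cons] at h2
  rw [admElt_cons, ← evalA_lam, h, h2]

theorem evalA_xiMonomial_self (r : List ℕ) : evalA (xiMonomial 1 r) (admElt r) = 1 := by
  induction r with
  | nil => rw [xiMonomial, admElt, admWord, freeWord_nil, map_one proj, evalA_one, map_one aug]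
  | cons a r ih => rw [evalA_xiMonomial_of_eq rfl, ih]

/-- Milnor's triangularity: in a finite nonempty set of sequences of the same length there is one
whose monomial `ξ^r` vanishes on all the other admissible monomials. -/
theorem exists_separating (N : ℕ) : ∀ s : Finset (List ℕ), s.Nonempty → (∀ r ∈ s, r.length = N) →
    ∃ r ∈ s, ∀ u ∈ s, u ≠ r → evalA (xiMonomial 1 r) (admElt u) = 0 := by
  classical
  induction N with
  | zero =>
    rintro s ⟨r, hr⟩ h
    refine ⟨r, hr, fun u hu hne => absurd ?_ hne⟩
    rw [List.length_eq_zero_iff.1 (h u hu), List.length_eq_zero_iff.1 (h r hr)]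
  | succ N ih =>
    intro s hs h
    -- Among the sequences with the smallest leading exponent, separate the tails: the monomial of
    -- such a sequence vanishes on every admissible monomial with a larger leading exponent.
    obtain ⟨r₀, hr₀, hmin⟩ := s.exists_min_image leadExponent hs
    obtain ⟨t, ht, hsep⟩ := ih ((s.filter fun r => leadExponent r = leadExponent r₀).image List.tail)
      ⟨r₀.tail, Finset.mem_image_of_mem _ (by simp [hr₀])⟩ (by
        intro r hr
        obtain ⟨u, hu, rfl⟩ := Finset.mem_image.1 hr
        rw [List.length_tail, h u (Finset.mem_filter.1 hu).1]; rfl)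
    obtain ⟨r, hr, rfl⟩ := Finset.mem_image.1 ht
    obtain ⟨hrs, hrl⟩ := Finset.mem_filter.1 hr
    refine ⟨r, hrs, fun u hu hne => ?_⟩
    obtain ⟨a, r', rfl⟩ := List.exists_cons_of_length_eq_add_one (h r hrs)
    obtain ⟨b, u', rfl⟩ := List.exists_cons_of_length_eq_add_one (h u hu)
    rcases (hmin _ hu).lt_or_eq with hlt | heq
    · exact evalA_xiMonomial_of_lt (hrl ▸ hlt)
    · rw [evalA_xiMonomial_of_eq (heq.symm.trans hrl.symm)]
      refine hsep u' (Finset.mem_image.2 ⟨_, Finset.mem_filter.2 ⟨hu, heq.symm⟩, rfl⟩) ?_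
      rintro rfl
      apply hne
      have := heq.symm.trans hrl.symm
      simp only [leadExponent] at this
      rw [show b = a by omega]

end
end SteenrodExt

namespace SteenrodExt
open AdemAux GradedAux
noncomputable section

/-- The first `N` values of a sequence. -/
def initialList (N : ℕ) (R : ℕ → ℕ) : List ℕ := (List.range N).map R

theorem initialList_succ (N : ℕ) (R : ℕ → ℕ) :
    initialList (N + 1) R = R 0 :: initialList N (fun j => R (j + 1)) := by
  simp [initialList, List.range_succ_eq_map, Function.comp_def]

theorem initialList_add {N : ℕ} {R : ℕ → ℕ} (h : ∀ j, N ≤ j → R j = 0) (d : ℕ) :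
    initialList (N + d) R = initialList N R ++ List.replicate d 0 := by
  rw [initialList, List.range_add, List.map_append, initialList]
  congr 1
  rw [List.map_map, List.eq_replicate_iff]
  simp only [List.length_map, List.length_range, List.mem_map, true_and]
  rintro b ⟨a, -, rfl⟩
  exact h _ (Nat.le_add_right N a)

theorem leadExponent_append_zero (r : List ℕ) (d : ℕ) :
    leadExponent (r ++ List.replicate d 0) = leadExponent r := by
  induction r with
  | nil =>
    induction d with
    | zero => rfl
    | succ d ih => simpa [List.replicate_succ, leadExponent] using ih
  | cons a r ih => simp only [List.cons_append, leadExponent, ih]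

theorem freeWord_admWord_append_zero (r : List ℕ) (d : ℕ) :
    freeWord (admWord (r ++ List.replicate d 0)) = freeWord (admWord r) := by
  induction r with
  | nil =>
    induction d with
    | zero => rfl
    | succ d ih =>
      have h := leadExponent_append_zero [] (d + 1)
      rw [List.nil_append, List.replicate_succ] at h
      rw [List.nil_append] at ih
      have e : admWord (0 :: List.replicate d 0) =
        leadExponent (0 :: List.replicate d 0) :: admWord (List.replicate d 0) := rfl
      rw [List.nil_append, List.replicate_succ, e, h, freeWord_cons, ih]
      exact one_mul _
  | cons a r ih =>
    have h := leadExponent_append_zero (a :: r) d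
    rw [List.cons_append] at h ⊢
    rw [admWord, h, freeWord_cons, ih, admWord, freeWord_cons]

theorem freeWord_initialList {N N' : ℕ} {R : ℕ → ℕ} (h : ∀ j, N ≤ j → R j = 0)
    (h' : ∀ j, N' ≤ j → R j = 0) :
    freeWord (admWord (initialList N R)) = freeWord (admWord (initialList N' R)) := by
  wlog hle : N ≤ N' generalizing N N'
  · exact (this h' h (by omega)).symm
  obtain ⟨d, rfl⟩ := Nat.exists_eq_add_of_le hle
  rw [initialList_add h, freeWord_admWord_append_zero]

theorem xiMonomial_initialList (N : ℕ) : ∀ (c : ℕ) (R : ℕ → ℕ),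
    xiMonomial c (initialList N R) = ∏ j ∈ Finset.range N, xi (c + j) ^ R j := by
  induction N with
  | zero => intro c R; rfl
  | succ N ih =>
    intro c R
    rw [initialList_succ, xiMonomial, ih, Finset.prod_range_succ', mul_comm]
    congr 1
    exact Finset.prod_congr rfl fun j _ => by rw [add_assoc, add_comm 1 j]

/-- The homomorphism from the polynomial algebra onto `A_*` that sends the generators to
`ξ_1, ξ_2, …`. -/
def xiHom : MvPolynomial ℕ (ZMod 2) →ₐ[ZMod 2] DualSteenrod :=
  MvPolynomial.aeval fun j => xi (j + 1)

/-- The monomial in `ξ_1, ξ_2, …` with exponents `R`. -/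
def xiPow (R : ℕ →₀ ℕ) : DualSteenrod := xiHom (MvPolynomial.monomial R 1)

theorem xiPow_zero : xiPow 0 = 1 := map_one xiHom

theorem xiPow_add (R S : ℕ →₀ ℕ) : xiPow (R + S) = xiPow R * xiPow S := by
  rw [xiPow, xiPow, xiPow, ← map_mul, MvPolynomial.monomial_mul, one_mul]

theorem xiPow_single_one (j : ℕ) : xiPow (Finsupp.single j 1) = xi (j + 1) :=
  MvPolynomial.aeval_X _ j

theorem xiPow_eq {N : ℕ} {R : ℕ →₀ ℕ} (h : ∀ j, N ≤ j → R j = 0) :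
    xiPow R = xiMonomial 1 (initialList N R) := by
  rw [xiMonomial_initialList, xiPow, xiHom, MvPolynomial.aeval_monomial, map_one, one_mul,
    Finsupp.prod_of_support_subset (s := Finset.range N)]
  · exact Finset.prod_congr rfl fun j _ => by rw [add_comm 1 j]
  · intro j hj
    rw [Finsupp.mem_support_iff] at hj
    by_contra hcon
    exact hj (h j (by simpa using hcon))
  · simp

/-- A bound for the support of a sequence. -/
def supportBound (R : ℕ →₀ ℕ) : ℕ := R.support.sup id + 1

theorem eq_zero_of_supportBound_le {R : ℕ →₀ ℕ} {j : ℕ} (h : supportBound R ≤ j) : R j = 0 := by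
  by_contra hcon
  have := Finset.le_sup (f := id) (Finsupp.mem_support_iff.2 hcon)
  simp only [supportBound, id] at *
  omega

/-- The admissible monomial of the free algebra with the sequence of differences `R`. -/
def freeAdm (R : ℕ →₀ ℕ) : FreeSteenrod := freeWord (admWord (initialList (supportBound R) R))

theorem proj_freeAdm {N : ℕ} {R : ℕ →₀ ℕ} (h : ∀ j, N ≤ j → R j = 0) :
    proj (freeAdm R) = admElt (initialList N R) :=
  congrArg proj (freeWord_initialList (fun _ => eq_zero_of_supportBound_le) h)

theorem evalA_xiPow_self (R : ℕ →₀ ℕ) : evalA (xiPow R) (proj (freeAdm R)) = 1 := by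
  have h : ∀ j, supportBound R ≤ j → R j = 0 := fun _ => eq_zero_of_supportBound_le
  rw [xiPow_eq h, proj_freeAdm h, evalA_xiMonomial_self]

theorem exists_separating_finsupp {s : Finset (ℕ →₀ ℕ)} (hs : s.Nonempty) :
    ∃ R ∈ s, ∀ u ∈ s, u ≠ R → evalA (xiPow R) (proj (freeAdm u)) = 0 := by
  classical
  let N := s.sup supportBound
  have hN (R) (hR : R ∈ s) (j) (hj : N ≤ j) : R j = 0 :=
    eq_zero_of_supportBound_le ((Finset.le_sup hR).trans hj)
  obtain ⟨t, ht, hsep⟩ := exists_separating N (s.image fun R : ℕ →₀ ℕ => initialList N R)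
    (hs.image _) (by
      intro r hr
      obtain ⟨R, -, rfl⟩ := Finset.mem_image.1 hr
      simp [initialList])
  obtain ⟨R, hR, rfl⟩ := Finset.mem_image.1 ht
  refine ⟨R, hR, fun u hu hne => ?_⟩
  rw [xiPow_eq (hN R hR), proj_freeAdm (hN u hu)]
  refine hsep _ (Finset.mem_image_of_mem _ hu) fun heq => hne ?_
  ext j
  by_cases hj : N ≤ j
  · rw [hN R hR j hj, hN u hu j hj]
  · have := List.map_inj_left.1 heq j (by simpa using hj)
    exact this

/-- Linear combinations of admissible monomials, in the Steenrod algebra. -/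
def admMap : ((ℕ →₀ ℕ) →₀ ZMod 2) →ₗ[ZMod 2] Steenrod :=
  Finsupp.linearCombination (ZMod 2) fun R => proj (freeAdm R)

theorem exists_evalA_admMap_ne_zero {c : (ℕ →₀ ℕ) →₀ ZMod 2} (hc : c ≠ 0) :
    ∃ R ∈ c.support, evalA (xiPow R) (admMap c) ≠ 0 := by
  obtain ⟨R, hR, hsep⟩ := exists_separating_finsupp (Finsupp.support_nonempty_iff.2 hc)
  refine ⟨R, hR, ?_⟩
  rw [admMap, Finsupp.linearCombination_apply, Finsupp.sum, map_sum, Finset.sum_eq_single R,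
    map_smul, evalA_xiPow_self]
  · simpa using hR
  · intro u hu hne
    rw [map_smul, hsep u hu hne, smul_zero]
  · intro h; exact absurd hR h

theorem admMap_injective : Function.Injective admMap := by
  rw [injective_iff_map_eq_zero]
  intro c hc
  by_contra h
  obtain ⟨R, -, hR⟩ := exists_evalA_admMap_ne_zero h
  rw [hc, map_zero] at hR
  exact hR rfl

theorem admissibleSpan_eq : admissibleSpan = Submodule.span (ZMod 2) (Set.range freeAdm) := by
  refine le_antisymm (Submodule.span_le.2 ?_) (Submodule.span_mono ?_)
  · rintro _ ⟨r, rfl⟩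
    have hr : initialList r.length r.toFinsupp = r := by
      apply List.ext_getElem
      · simp [initialList]
      · intro n h1 h2
        simp [initialList, h2]
    refine Submodule.subset_span ⟨r.toFinsupp, ?_⟩
    rw [freeAdm, freeWord_initialList (fun _ => eq_zero_of_supportBound_le)
      (N' := r.length), hr]
    intro j hj
    simp [hj]
  · rintro _ ⟨R, rfl⟩
    exact ⟨_, rfl⟩

theorem admMap_surjective : Function.Surjective admMap := by
  intro a
  obtain ⟨f, rfl⟩ := proj_surjective a
  have hf : f ∈ admissibleSpan ⊔ preadmissibleSpan := by rw [sup_preadmissibleSpan]; trivial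
  obtain ⟨g, hg, r, hr, rfl⟩ := Submodule.mem_sup.1 hf
  rw [map_add, mem_RF.1 (preadmissibleSpan_le hr), add_zero]
  rw [admissibleSpan_eq] at hg
  obtain ⟨c, rfl⟩ := (Finsupp.mem_span_range_iff_exists_finsupp).1 hg
  refine ⟨c, ?_⟩
  rw [admMap, Finsupp.linearCombination_apply, Finsupp.sum, Finsupp.sum, map_sum]
  simp_rw [map_smul]

/-- The ideal of relations is spanned by the right multiples of the preadmissible relations, since the
admissible monomials are linearly independent in `A`. -/
theorem RF_eq_preadmissibleSpan : RF = preadmissibleSpan := by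
  refine le_antisymm (fun f hf => ?_) preadmissibleSpan_le
  have hf' : f ∈ admissibleSpan ⊔ preadmissibleSpan := by rw [sup_preadmissibleSpan]; trivial
  obtain ⟨g, hg, r, hr, rfl⟩ := Submodule.mem_sup.1 hf'
  rw [mem_RF, map_add, mem_RF.1 (preadmissibleSpan_le hr), add_zero] at hf
  rw [admissibleSpan_eq] at hg
  obtain ⟨c, rfl⟩ := (Finsupp.mem_span_range_iff_exists_finsupp).1 hg
  have hc : admMap c = 0 := by
    rw [← hf, admMap, Finsupp.linearCombination_apply, Finsupp.sum, Finsupp.sum, map_sum]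
    simp_rw [map_smul]
  rw [admMap_injective (hc.trans (map_zero admMap).symm), Finsupp.sum_zero_index, zero_add]
  exact hr

theorem eq_zero_of_evalA_xiPow {a : Steenrod} (h : ∀ R, evalA (xiPow R) a = 0) : a = 0 := by
  obtain ⟨c, rfl⟩ := admMap_surjective a
  by_contra hne
  obtain ⟨R, -, hR⟩ := exists_evalA_admMap_ne_zero (c := c) (by rintro rfl; simp at hne)
  exact hR (h R)

theorem dualSteenrodGr_one_mem : (1 : DualSteenrod) ∈ dualSteenrodGr 0 :=
  fun _ hm _ ha => aug_eq_zero hm ha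

theorem dualSteenrodGr_mul_mem {m n : ℕ} {x y : DualSteenrod} (hx : x ∈ dualSteenrodGr m)
    (hy : y ∈ dualSteenrodGr n) : x * y ∈ dualSteenrodGr (m + n) := by
  intro l hl a ha
  rw [evalA_mul]
  have h := diag_mem ha
  generalize diag a = z at h
  induction h using Submodule.span_induction with
  | mem t ht =>
    obtain ⟨i, j, rfl, u, hu, v, hv, rfl⟩ := ht
    rw [pairing_tmul]
    by_cases hi : i = m
    · rw [hy j (by omega) v hv, mul_zero]
    · rw [hx i hi u hu, zero_mul]
  | zero => simp
  | add x y _ _ hx hy => rw [map_add, hx, hy, add_zero]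
  | smul c x _ hx => rw [map_smul, hx, smul_zero]

/-- The degree of the monomial with exponents `R`. -/
def xiWeight : (ℕ →₀ ℕ) →+ ℕ := Finsupp.weight fun j => 2 ^ (j + 1) - 1

theorem xiWeight_single_one (j : ℕ) : xiWeight (Finsupp.single j 1) = 2 ^ (j + 1) - 1 := by
  simp [xiWeight, Finsupp.weight_single]

/-- Induction over the monomials in the `ξ_j`. -/
theorem xi_induction {C : (ℕ →₀ ℕ) → Prop} (zero : C 0) (single : ∀ j, C (Finsupp.single j 1))
    (add : ∀ R S, C R → C S → C (R + S)) (R : ℕ →₀ ℕ) : C R := by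
  induction R using Finsupp.induction_linear with
  | zero => exact zero
  | add R S hR hS => exact add R S hR hS
  | single j n =>
    induction n with
    | zero => simpa using zero
    | succ n ih => rw [Finsupp.single_add]; exact add _ _ ih (single j)

theorem xiPow_mem (R : ℕ →₀ ℕ) : xiPow R ∈ dualSteenrodGr (xiWeight R) := by
  refine xi_induction (C := fun R => xiPow R ∈ dualSteenrodGr (xiWeight R)) ?_ (fun j => ?_)
    (fun R S hR hS => ?_) R
  · rw [xiPow_zero, map_zero]; exact dualSteenrodGr_one_mem
  · rw [xiPow_single_one, xiWeight_single_one]; exact xi_mem _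
  · rw [xiPow_add, map_add]; exact dualSteenrodGr_mul_mem hR hS

theorem proj_freeAdm_mem (R : ℕ →₀ ℕ) : proj (freeAdm R) ∈ steenrodGr (xiWeight R) := by
  have h : proj (freeAdm R) ∈ steenrodGr (admWord (initialList (supportBound R) R)).sum :=
    ⟨_, freeWord_mem _, rfl⟩
  by_cases hs : (admWord (initialList (supportBound R) R)).sum = xiWeight R
  · rwa [hs] at h
  · exact absurd (evalA_xiPow_self R) (by rw [xiPow_mem R _ hs _ h]; decide)

theorem finite_xiWeight (n : ℕ) : {R | xiWeight R = n}.Finite := by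
  have hli : LinearIndependent (ZMod 2) fun R => proj (freeAdm R) := admMap_injective
  have h2 : LinearIndependent (ZMod 2) fun R : {R | xiWeight R = n} =>
      (⟨proj (freeAdm R), (congrArg (_ ∈ steenrodGr ·) R.2).mp (proj_freeAdm_mem R)⟩ : steenrodGr n) :=
    LinearIndependent.of_comp (steenrodGr n).subtype
      (hli.comp (fun R : {R | xiWeight R = n} => (R : ℕ →₀ ℕ)) Subtype.val_injective)
  have := finiteDimensional_freeGr n
  have : FiniteDimensional (ZMod 2) (steenrodGr n) := by unfold steenrodGr; infer_instance
  exact Set.finite_coe_iff.1 h2.finite_of_isNoetherian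

theorem exists_milnorElt (R : ℕ →₀ ℕ) : ∃ e ∈ steenrodGr (xiWeight R),
    ∀ S, evalA (xiPow S) e = if S = R then 1 else 0 := by
  classical
  let s := (finite_xiWeight (xiWeight R)).toFinset
  have hs (S) : S ∈ s ↔ xiWeight S = xiWeight R := by simp [s]
  -- The matrix of values of the monomials `ξ^J` on the admissible monomials in one degree is square
  -- with trivial kernel, hence it is invertible.
  let M : (s → ZMod 2) →ₗ[ZMod 2] (s → ZMod 2) := LinearMap.pi fun J =>
    evalA (xiPow J) ∘ₗ Fintype.linearCombination (ZMod 2) fun I : s => proj (freeAdm I)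
  have hM : Function.Injective M := by
    rw [injective_iff_map_eq_zero]
    intro c hc
    have h1 : admMap (Finsupp.embDomain (Function.Embedding.subtype _) (Finsupp.equivFunOnFinite.symm c)) =
        Fintype.linearCombination (ZMod 2) (fun I : s => proj (freeAdm I)) c := by
      rw [admMap, Finsupp.linearCombination_embDomain, Fintype.linearCombination_apply,
        Finsupp.linearCombination_apply, Finsupp.sum_fintype _ _ (by simp)]
      rfl
    by_contra hne
    obtain ⟨J, hJ, hJ'⟩ := exists_evalA_admMap_ne_zero
      (c := Finsupp.embDomain (Function.Embedding.subtype _) (Finsupp.equivFunOnFinite.symm c)) (by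
        intro h
        rw [Finsupp.embDomain_eq_zero] at h
        exact hne (funext fun I => DFunLike.congr_fun h I))
    rw [Finsupp.support_embDomain] at hJ
    obtain ⟨J', -, rfl⟩ := Finset.mem_map.1 hJ
    rw [h1] at hJ'
    exact hJ' (congrFun hc J')
  obtain ⟨c, hc⟩ := LinearMap.injective_iff_surjective.1 hM fun J => if (J : ℕ →₀ ℕ) = R then 1 else 0
  have hmem : Fintype.linearCombination (ZMod 2) (fun I : s => proj (freeAdm I)) c ∈
      steenrodGr (xiWeight R) := by
    rw [Fintype.linearCombination_apply]
    exact Submodule.sum_mem _ fun I _ => Submodule.smul_mem _ _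
      ((hs I).1 I.2 ▸ proj_freeAdm_mem (I : ℕ →₀ ℕ))
  refine ⟨_, hmem, fun S => ?_⟩
  by_cases hS : S ∈ s
  · exact congrFun hc ⟨S, hS⟩
  · rw [hs] at hS
    rw [xiPow_mem S _ (Ne.symm hS) _ hmem, if_neg (by rintro rfl; exact hS rfl)]

/-- The element of the Milnor basis dual to the monomial with exponents `R`. -/
def milnorElt (R : ℕ →₀ ℕ) : Steenrod := (exists_milnorElt R).choose

theorem milnorElt_mem (R : ℕ →₀ ℕ) : milnorElt R ∈ steenrodGr (xiWeight R) :=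
  (exists_milnorElt R).choose_spec.1

theorem evalA_milnorElt (S R : ℕ →₀ ℕ) :
    evalA (xiPow S) (milnorElt R) = if S = R then 1 else 0 :=
  (exists_milnorElt R).choose_spec.2 S

theorem finite_evalA_xiPow (a : Steenrod) : (Function.support fun R => evalA (xiPow R) a).Finite := by
  refine steenrodProj.induction
    (C := fun a => (Function.support fun R => evalA (xiPow R) a).Finite) (fun n a ha => ?_)
    (fun a b ha hb => ?_) a
  · refine (finite_xiWeight n).subset fun R hR => ?_
    by_contra hne
    exact hR (xiPow_mem R n (Ne.symm hne) a ha)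
  · refine (ha.union hb).subset ?_
    simp_rw [map_add]
    exact Function.support_add _ _

/-- The values of the monomials in the `ξ_j` on an element of `A`. -/
def milnorCoord : Steenrod →ₗ[ZMod 2] (ℕ →₀ ℕ) →₀ ZMod 2 where
  toFun a := Finsupp.ofSupportFinite _ (finite_evalA_xiPow a)
  map_add' a b := by ext R; simp [Finsupp.ofSupportFinite_coe]
  map_smul' c a := by ext R; simp [Finsupp.ofSupportFinite_coe]

theorem milnorCoord_apply (a : Steenrod) (R : ℕ →₀ ℕ) : milnorCoord a R = evalA (xiPow R) a := rfl

theorem milnorCoord_milnorElt (R : ℕ →₀ ℕ) : milnorCoord (milnorElt R) = Finsupp.single R 1 := by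
  ext S
  rw [milnorCoord_apply, evalA_milnorElt, Finsupp.single_apply]
  simp only [eq_comm]

theorem milnorCoord_bijective : Function.Bijective milnorCoord := by
  constructor
  · rw [injective_iff_map_eq_zero]
    intro a ha
    exact eq_zero_of_evalA_xiPow fun R => by rw [← milnorCoord_apply, ha]; rfl
  · rw [← LinearMap.range_eq_top, eq_top_iff]
    rintro c -
    induction c using Finsupp.induction_linear with
    | zero => exact Submodule.zero_mem _
    | add c d hc hd => exact Submodule.add_mem _ hc hd
    | single R c =>
      rw [← mul_one c, ← smul_eq_mul, ← Finsupp.smul_single]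
      exact Submodule.smul_mem _ _ ⟨milnorElt R, milnorCoord_milnorElt R⟩

/-- The Milnor basis of the Steenrod algebra: its coordinates are the monomials in the `ξ_j`. -/
def milnorBasis : Module.Basis (ℕ →₀ ℕ) (ZMod 2) Steenrod :=
  Module.Basis.ofRepr (LinearEquiv.ofBijective milnorCoord milnorCoord_bijective)

theorem milnorBasis_repr (a : Steenrod) (R : ℕ →₀ ℕ) :
    milnorBasis.repr a R = evalA (xiPow R) a := rfl

theorem milnorBasis_apply (R : ℕ →₀ ℕ) : milnorBasis R = milnorElt R := by
  apply milnorBasis.repr.injective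
  rw [Module.Basis.repr_self]
  exact (milnorCoord_milnorElt R).symm

theorem eq_sum_xiPow {x : DualSteenrod} {s : Finset (ℕ →₀ ℕ)}
    (hs : ∀ R, R ∉ s → evalA x (milnorElt R) = 0) :
    x = ∑ R ∈ s, evalA x (milnorElt R) • xiPow R := by
  apply evalA_injective
  apply milnorBasis.ext
  intro R
  rw [milnorBasis_apply, map_sum, LinearMap.sum_apply]
  simp_rw [map_smul, LinearMap.smul_apply, evalA_milnorElt]
  simp only [smul_eq_mul, mul_ite, mul_one, mul_zero, Finset.sum_ite_eq']
  split_ifs with h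
  · rfl
  · exact hs R h

theorem dualSteenrodGr_le (n : ℕ) : dualSteenrodGr n ≤
    Submodule.span (ZMod 2) {x | ∃ R, xiWeight R = n ∧ x = xiPow R} := by
  intro x hx
  rw [eq_sum_xiPow (x := x) (s := (finite_xiWeight n).toFinset)]
  · refine Submodule.sum_mem _ fun R hR => Submodule.smul_mem _ _ (Submodule.subset_span ⟨R, ?_, rfl⟩)
    simpa using hR
  · intro R hR
    exact hx _ (by simpa using hR) _ (milnorElt_mem R)

theorem xiHom_bijective : Function.Bijective xiHom := by
  constructor
  · rw [injective_iff_map_eq_zero]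
    intro p hp
    have h : ∀ (p : MvPolynomial ℕ (ZMod 2)) R, evalA (xiHom p) (milnorElt R) = p.coeff R := by
      intro p R
      induction p using MvPolynomial.induction_on' with
      | monomial S c =>
        rw [MvPolynomial.coeff_monomial, ← mul_one c, ← smul_eq_mul, ← MvPolynomial.smul_monomial,
          map_smul, map_smul, LinearMap.smul_apply]
        change c • evalA (xiPow S) _ = _
        rw [evalA_milnorElt]
        simp
      | add p q hp hq => rw [map_add, map_add, LinearMap.add_apply, hp, hq, MvPolynomial.coeff_add]
    ext R
    rw [← h, hp]
    simp
  · intro x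
    obtain ⟨N, hN⟩ := x.2
    have hfin : (⋃ n : Fin N, {R | xiWeight R = n}).Finite :=
      Set.finite_iUnion fun n => finite_xiWeight n
    have hx := eq_sum_xiPow (x := x) (s := hfin.toFinset) (by
      intro R hR
      refine hN (xiWeight R) ?_ _ (milnorElt_mem R)
      by_contra hlt
      apply hR
      simp only [Set.Finite.mem_toFinset, Set.mem_iUnion, Set.mem_ofPred_eq]
      exact ⟨⟨xiWeight R, by omega⟩, rfl⟩)
    rw [hx]
    refine ⟨∑ R ∈ hfin.toFinset, evalA x (milnorElt R) • MvPolynomial.monomial R 1, ?_⟩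
    rw [map_sum]
    simp_rw [map_smul]
    rfl

/-- Milnor's theorem: `A_*` is the polynomial algebra on `ξ_1, ξ_2, …`. -/
def xiEquiv : MvPolynomial ℕ (ZMod 2) ≃ₐ[ZMod 2] DualSteenrod :=
  AlgEquiv.ofBijective xiHom xiHom_bijective

theorem xiEquiv_X (j : ℕ) : xiEquiv (MvPolynomial.X j) = xi (j + 1) := xiPow_single_one j

end
end SteenrodExt

/-! ### The symmetry operator -/

namespace SteenrodExt
open AdemAux GradedAux
noncomputable section

theorem symElt_zero : symElt 0 = 0 := rfl

theorem kappa_one : kappa 1 = 0 := by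
  have := kappa_sq 0
  rwa [isAdemFamily_sq.1, if_pos rfl] at this

theorem symElt_one : symElt 1 = 0 := rfl

/-- The upper triangular representation of the free algebra whose upper right corner is the symmetry
operator. -/
def symRep : FreeSteenrod →ₐ[ZMod 2] Matrix (Fin 3) (Fin 3) (Steenrod ⊗[ZMod 2] Steenrod) :=
  FreeAlgebra.lift (ZMod 2) fun n : ℕ+ =>
    !![diag (sq n), diag (kappa (sq n)), symElt n; 0, diag (sq n), symElt (n + 1); 0, 0, diag (sq n)]

theorem symRep_freeSq (n : ℕ) : symRep (freeSq n) =
    !![diag (sq n), diag (kappa (sq n)), symElt n; 0, diag (sq n), symElt (n + 1);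
      0, 0, diag (sq n)] := by
  refine freeLift_freeSq (fun n => !![diag (sq n), diag (kappa (sq n)), symElt n; 0, diag (sq n),
    symElt (n + 1); 0, 0, diag (sq n)]) ?_ n
  simp only [isAdemFamily_sq.1, kappa_one, map_one, map_zero, symElt_zero, zero_add, symElt_one]
  exact (Matrix.one_fin_three (α := Steenrod ⊗[ZMod 2] Steenrod)).symm

/-- The symmetry operator on the free algebra. -/
def freeSym : FreeSteenrod →ₗ[ZMod 2] Steenrod ⊗[ZMod 2] Steenrod :=
  Matrix.entryLinearMap (ZMod 2) _ 0 2 ∘ₗ symRep.toLinearMap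

/-- The derivation from the free algebra to `A ⊗ A` that sends `Sq^n` to `S_(n+1)`. -/
def freeDer : FreeSteenrod →ₗ[ZMod 2] Steenrod ⊗[ZMod 2] Steenrod :=
  Matrix.entryLinearMap (ZMod 2) _ 1 2 ∘ₗ symRep.toLinearMap

theorem freeSym_eq (f : FreeSteenrod) : freeSym f = symRep f 0 2 := rfl

theorem freeDer_eq (f : FreeSteenrod) : freeDer f = symRep f 1 2 := rfl

theorem symRep_apply (f : FreeSteenrod) : symRep f =
    !![diag (proj f), diag (kappa (proj f)), freeSym f; 0, diag (proj f), freeDer f;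
      0, 0, diag (proj f)] := by
  refine free_induction (C := fun f => symRep f =
    !![diag (proj f), diag (kappa (proj f)), freeSym f; 0, diag (proj f), freeDer f;
      0, 0, diag (proj f)]) (fun w => ?_) ?_ (fun f g hf hg => ?_) f
  · induction w with
    | nil =>
      rw [freeWord_nil, freeSym_eq, freeDer_eq, map_one symRep, map_one, map_one, kappa_one, map_zero,
        Matrix.one_fin_three]
      rfl
    | cons n w ih =>
      rw [freeSym_eq, freeDer_eq, freeWord_cons, map_mul symRep, map_mul proj, ih, symRep_freeSq,
        Matrix.mul_fin_three, kappa_mul]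
      change _ = !![diag (sq n * _), diag (sq n * _ + kappa (sq n) * _), _; _, _, _; _, _, _]
      simp [map_mul, map_add]
      rfl
  · ext i j
    fin_cases i <;> fin_cases j <;> simp
  · rw [map_add symRep, hf, hg]
    ext i j
    fin_cases i <;> fin_cases j <;> simp

theorem freeSym_mul (f g : FreeSteenrod) : freeSym (f * g) =
    freeSym f * diag (proj g) + diag (proj f) * freeSym g + diag (kappa (proj f)) * freeDer g := by
  rw [freeSym_eq, map_mul, symRep_apply, symRep_apply g, Matrix.mul_fin_three]
  simp only [Matrix.of_apply, Matrix.cons_val]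
  abel

theorem freeDer_mul (f g : FreeSteenrod) : freeDer (f * g) =
    freeDer f * diag (proj g) + diag (proj f) * freeDer g := by
  rw [freeDer_eq, map_mul, symRep_apply, symRep_apply g, Matrix.mul_fin_three]
  simp only [Matrix.of_apply, Matrix.cons_val]
  simp [add_comm]

theorem freeSym_freeSq (n : ℕ) : freeSym (freeSq n) = symElt n := by
  rw [freeSym_eq, symRep_freeSq]; rfl

theorem freeDer_freeSq (n : ℕ) : freeDer (freeSq n) = symElt (n + 1) := by
  rw [freeDer_eq, symRep_freeSq]; rfl

theorem freeSym_one : freeSym 1 = 0 := freeSym_freeSq 0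

theorem freeDer_one : freeDer 1 = 0 := freeDer_freeSq 0

theorem freeSym_freeSq_mul (n : ℕ) (f : FreeSteenrod) : freeSym (freeSq n * f) =
    symElt n * diag (proj f) + diag (sq n) * freeSym f + diag (kappa (sq n)) * freeDer f := by
  rw [freeSym_mul, freeSym_freeSq]; rfl

theorem freeDer_freeSq_mul (n : ℕ) (f : FreeSteenrod) : freeDer (freeSq n * f) =
    symElt (n + 1) * diag (proj f) + diag (sq n) * freeDer f := by
  rw [freeDer_mul, freeDer_freeSq]; rfl

theorem oneAddT_apply (t : Steenrod ⊗[ZMod 2] Steenrod) : oneAddT t = t + swap t := rfl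

theorem oneAddT_diag_mul (a : Steenrod) (t : Steenrod ⊗[ZMod 2] Steenrod) :
    oneAddT (diag a * t) = diag a * oneAddT t := by
  rw [oneAddT_apply, oneAddT_apply, map_mul, swap_diag, mul_add]

theorem freeSym_freeSq_mul_freeSq (n m : ℕ) : freeSym (freeSq n * freeSq m) = symFree n m := by
  rw [freeSym_freeSq_mul, freeSym_freeSq, freeDer_freeSq, symFree, kappa_sq]
  congr 1
  split_ifs <;> simp

theorem freeSym_ademRelation (n m : ℕ) : freeSym (ademRelation n m) = symAdem n m := by
  rw [ademRelation, map_ademSum, symAdem]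
  simp_rw [freeSym_freeSq_mul_freeSq]

/-- The projection of `A` onto its part of odd degree. -/
def oddPart : Steenrod →ₗ[ZMod 2] Steenrod :=
  ((Polynomial.lsum fun i => ((i : ZMod 2) • LinearMap.id : Steenrod →ₗ[ZMod 2] Steenrod)
    : Polynomial Steenrod →ₗ[ZMod 2] Steenrod)) ∘ₗ steenrodRho.toLinearMap

theorem oddPart_of_mem {n : ℕ} {a : Steenrod} (ha : a ∈ steenrodGr n) :
    oddPart a = (n : ZMod 2) • a := by
  simp [oddPart, steenrodRho_of_mem ha, Polynomial.lsum_apply, Polynomial.sum_monomial_index]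

theorem natCast_mul_smul_eq_ite {M : Type*} [AddCommGroup M] [Module (ZMod 2) M] (a b : ℕ) (x : M) :
    (if Odd a ∧ Odd b then x else 0) = ((a : ZMod 2) * b) • x := by
  have h (c : ℕ) : (c : ZMod 2) = if Odd c then 1 else 0 := by
    split_ifs with hc
    · exact (ZMod.natCast_eq_one_iff_odd).2 hc
    · exact (ZMod.natCast_eq_zero_iff_even).2 (Nat.not_odd_iff_even.1 hc)
  rw [h a, h b]
  split_ifs <;> simp_all

/-- The product `Sq^a Sq^c ⊗ Sq^b Sq^d` for `t = (a, b)` and `u = (c, d)`. -/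
def sqProd (t u : ℕ × ℕ) : Steenrod ⊗[ZMod 2] Steenrod :=
  (sq t.1 * sq u.1) ⊗ₜ[ZMod 2] (sq t.2 * sq u.2)

theorem leftFree_eq (n m : ℕ) : leftFree n m =
    ∑ t ∈ Finset.HasAntidiagonal.antidiagonal n, ∑ u ∈ Finset.HasAntidiagonal.antidiagonal m,
      ((t.2 : ZMod 2) * u.1) • sqProd t u := by
  rw [leftFree, Finset.sum_filter]
  refine Finset.sum_congr rfl fun t _ => ?_
  rw [Finset.sum_filter]
  simp_rw [← natCast_mul_smul_eq_ite]
  split_ifs with h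
  · exact Finset.sum_congr rfl fun u _ => by simp [h, sqProd]
  · simp [h]

theorem symElt_succ_mul_diag (n m : ℕ) : symElt (n + 1) * diag (sq m) =
    ∑ t ∈ Finset.HasAntidiagonal.antidiagonal n, ∑ u ∈ Finset.HasAntidiagonal.antidiagonal m,
      ((t.1 : ZMod 2) * t.2) • sqProd t u := by
  rw [symElt, Nat.add_sub_cancel, Finset.sum_filter, diag_sq, Finset.sum_mul_sum]
  refine Finset.sum_congr rfl fun t _ => Finset.sum_congr rfl fun u _ => ?_
  rw [natCast_mul_smul_eq_ite, smul_mul_assoc, Algebra.TensorProduct.tmul_mul_tmul]; rfl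

theorem diag_mul_symElt_succ (n m : ℕ) : diag (sq n) * symElt (m + 1) =
    ∑ t ∈ Finset.HasAntidiagonal.antidiagonal n, ∑ u ∈ Finset.HasAntidiagonal.antidiagonal m,
      ((u.1 : ZMod 2) * u.2) • sqProd t u := by
  rw [symElt, Nat.add_sub_cancel, Finset.sum_filter, diag_sq, Finset.sum_mul_sum]
  refine Finset.sum_congr rfl fun t _ => Finset.sum_congr rfl fun u _ => ?_
  rw [natCast_mul_smul_eq_ite, mul_smul_comm, Algebra.TensorProduct.tmul_mul_tmul]; rfl

theorem oddPart_diag_mul (n m : ℕ) :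
    TensorProduct.map oddPart oddPart (diag (sq n * sq m)) =
    ∑ t ∈ Finset.HasAntidiagonal.antidiagonal n, ∑ u ∈ Finset.HasAntidiagonal.antidiagonal m,
      (((t.1 : ZMod 2) + u.1) * (t.2 + u.2)) • sqProd t u := by
  rw [map_mul, diag_sq, diag_sq, Finset.sum_mul_sum, map_sum]
  refine Finset.sum_congr rfl fun t _ => ?_
  rw [map_sum]
  refine Finset.sum_congr rfl fun u _ => ?_
  rw [Algebra.TensorProduct.tmul_mul_tmul, TensorProduct.map_tmul,
    oddPart_of_mem (steenrodGr_mul_mem (sq_mem _) (sq_mem _)),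
    oddPart_of_mem (steenrodGr_mul_mem (sq_mem _) (sq_mem _)), TensorProduct.smul_tmul_smul]
  push_cast
  rfl

/-- The symmetrization of the left action operator differs from `freeDer` by the part of the diagonal
in `A_odd ⊗ A_odd`, which depends only on the product in `A`: in terms of exponents,
`t₂ u₁ + t₁ u₂ = t₁ t₂ + u₁ u₂ + (t₁ + u₁) (t₂ + u₂)` modulo 2. -/
theorem oneAddT_leftFree (n m : ℕ) : oneAddT (leftFree n m) =
    freeDer (freeSq n * freeSq m) + TensorProduct.map oddPart oddPart (diag (sq n * sq m)) := by
  have hsw : swap (leftFree n m) =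
      ∑ t ∈ Finset.HasAntidiagonal.antidiagonal n, ∑ u ∈ Finset.HasAntidiagonal.antidiagonal m,
        ((t.1 : ZMod 2) * u.2) • sqProd t u := by
    rw [leftFree_eq, map_sum]
    refine Finset.sum_equiv (Equiv.prodComm ℕ ℕ) (by simp [add_comm]) fun t _ => ?_
    rw [map_sum]
    refine Finset.sum_equiv (Equiv.prodComm ℕ ℕ) (by simp [add_comm]) fun u _ => ?_
    rw [map_smul]; rfl
  rw [oneAddT_apply, hsw, leftFree_eq, freeDer_freeSq_mul, freeDer_freeSq]
  change _ = symElt (n + 1) * diag (sq m) + _ + _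
  rw [symElt_succ_mul_diag, diag_mul_symElt_succ, oddPart_diag_mul]
  simp only [← Finset.sum_add_distrib, ← add_smul]
  refine Finset.sum_congr rfl fun t _ => Finset.sum_congr rfl fun u _ => ?_
  congr 1
  generalize (t.1 : ZMod 2) = a
  generalize (t.2 : ZMod 2) = b
  generalize (u.1 : ZMod 2) = c
  generalize (u.2 : ZMod 2) = d
  revert a b c d
  decide

theorem oneAddT_leftAdem {n m : ℕ} (hn : 0 < n) (hm : n < 2 * m) :
    oneAddT (leftAdem n m) = freeDer (ademRelation n m) := by
  -- The part in `A_odd ⊗ A_odd` factors through `proj`, which kills the Adem relation.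
  have h : TensorProduct.map oddPart oddPart (diag (proj (ademRelation n m))) = 0 := by
    rw [mem_RF.1 (ademRelation_mem hn hm), map_zero, map_zero]
  have h2 : TensorProduct.map oddPart oddPart (diag (proj (ademRelation n m))) =
      ademSum (fun a b => TensorProduct.map oddPart oddPart (diag (sq a * sq b))) n m := by
    rw [ademRelation]
    refine (map_ademSum (TensorProduct.map oddPart oddPart ∘ₗ diag.toLinearMap ∘ₗ
      proj.toLinearMap) (fun a b => freeSq a * freeSq b) n m).trans ?_
    congr 1
    funext a b
    simp only [LinearMap.comp_apply, AlgHom.toLinearMap_apply, map_mul proj]; rfl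
  rw [leftAdem, map_ademSum, ademRelation, map_ademSum]
  simp_rw [oneAddT_leftFree]
  rw [h] at h2
  rw [← add_zero (ademSum (fun a b => freeDer (freeSq a * freeSq b)) n m), h2]
  simp only [ademSum, smul_add, Finset.sum_add_distrib]
  abel

theorem freeSym_of_mem_RF2 {f : FreeSteenrod} (hf : f ∈ RF2) : freeSym f = 0 := by
  unfold RF2 at hf
  induction hf using Submodule.mul_induction_on' with
  | mem_mul_mem a ha b hb => rw [freeSym_mul, mem_RF.1 ha, mem_RF.1 hb]; simp
  | add x _ y _ hx hy => rw [map_add, hx, hy, add_zero]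

/-- The symmetry operator. -/
def symOp : Rbar →ₗ[ZMod 2] Steenrod ⊗[ZMod 2] Steenrod :=
  (RF2.submoduleOf RF).liftQ (freeSym ∘ₗ RF.subtype) fun _ hr => freeSym_of_mem_RF2 hr

theorem symOp_mk (r : RF) : symOp (rbarMk r) = freeSym r := rfl

theorem symElt_mem (n : ℕ) : symElt (n + 1) ∈ tensorGr steenrodGr steenrodGr n := by
  refine Submodule.sum_mem _ fun t ht => Submodule.subset_span ⟨t.1, t.2, ?_, _, sq_mem _, _,
    sq_mem _, rfl⟩
  simpa using (Finset.mem_filter.1 ht).1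

theorem freeDer_word_mem (w : List ℕ) :
    freeDer (freeWord w) ∈ tensorGr steenrodGr steenrodGr w.sum := by
  induction w with
  | nil => rw [freeWord_nil, freeDer_one]; exact Submodule.zero_mem _
  | cons a w ih =>
    rw [freeWord_cons, freeDer_freeSq_mul, List.sum_cons]
    exact Submodule.add_mem _ (tensorGr_mul_mem (symElt_mem a) (diag_word_mem w))
      (tensorGr_mul_mem (diag_mem (sq_mem a)) ih)

theorem freeSym_word_mem (w : List ℕ) : ∀ n, w.sum = n + 1 →
    freeSym (freeWord w) ∈ tensorGr steenrodGr steenrodGr n := by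
  induction w with
  | nil => intro n h; simp at h
  | cons a w ih =>
    intro n h
    rw [List.sum_cons] at h
    rw [freeWord_cons, freeSym_freeSq_mul, kappa_sq]
    refine Submodule.add_mem _ (Submodule.add_mem _ ?_ ?_) ?_
    · rcases a with _ | a
      · rw [symElt_zero, zero_mul]; exact Submodule.zero_mem _
      · obtain rfl : n = a + w.sum := by omega
        exact tensorGr_mul_mem (symElt_mem a) (diag_word_mem w)
    · by_cases hw : w.sum = 0
      · have : freeSym (freeWord w) = 0 := by
          obtain ⟨c, hc⟩ := mem_freeGr_zero (f := freeWord w) (hw ▸ freeWord_mem w)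
          rw [hc, map_smul, freeSym_one, smul_zero]
        rw [this, mul_zero]; exact Submodule.zero_mem _
      · obtain rfl : n = a + (w.sum - 1) := by omega
        exact tensorGr_mul_mem (diag_mem (sq_mem a)) (ih _ (by omega))
    · split_ifs with ha
      · rw [map_zero, zero_mul]; exact Submodule.zero_mem _
      · obtain rfl : n = (a - 1) + w.sum := by omega
        exact tensorGr_mul_mem (diag_mem (sq_mem _)) (freeDer_word_mem w)

theorem isSymmetryOperator_symOp : IsSymmetryOperator symOp where
  degree n r hr := by
    obtain ⟨⟨f, hf⟩, hfn, rfl⟩ := hr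
    rw [symOp_mk]
    change f ∈ freeGr (n + 1) at hfn
    change freeSym f ∈ _
    clear hf
    induction hfn using Submodule.span_induction with
    | mem f hf => obtain ⟨w, hw, rfl⟩ := hf; exact freeSym_word_mem w n hw
    | zero => rw [map_zero]; exact Submodule.zero_mem _
    | add x y _ _ hx hy => rw [map_add]; exact Submodule.add_mem _ hx hy
    | smul c x _ hx => rw [map_smul]; exact Submodule.smul_mem _ _ hx
  right_linear r a := by
    obtain ⟨r, rfl⟩ := rbarMk_surjective r
    obtain ⟨f, rfl⟩ := proj_surjective a
    rw [op_proj_smul, symOp_mk, symOp_mk, freeSym_mul, mem_RF.1 r.2]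
    simp
  preadmissible α n m hn hm _ := by
    rw [ademClass, proj_smul, symOp_mk, freeSym_mul, freeSym_ademRelation,
      mem_RF.1 (ademRelation_mem hn hm), leftActionOperator, oneAddT_diag_mul, oneAddT_leftAdem hn hm]
    simp

theorem IsSymmetryOperator.eq_symOp {S : Rbar →ₗ[ZMod 2] Steenrod ⊗[ZMod 2] Steenrod}
    (hS : IsSymmetryOperator S) : S = symOp := by
  apply LinearMap.ext
  intro x
  obtain ⟨⟨r, hr⟩, rfl⟩ := rbarMk_surjective x
  have hr' := hr
  rw [RF_eq_preadmissibleSpan] at hr'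
  induction hr' using Submodule.span_induction with
  | mem r h =>
    obtain ⟨α, n, m, β, hn, hm, hc, rfl⟩ := h
    have e : rbarMk ⟨freeWord α * ademRelation n m * freeWord β, hr⟩ =
        MulOpposite.op (proj (freeWord β)) • (proj (freeWord α) • ademClass hn hm) := by
      rw [ademClass, proj_smul, op_proj_smul]
    rw [e, hS.right_linear, isSymmetryOperator_symOp.right_linear, hS.preadmissible _ _ _ _ _ hc,
      isSymmetryOperator_symOp.preadmissible _ _ _ _ _ hc]
  | zero =>
    have : rbarMk ⟨0, hr⟩ = 0 := map_zero rbarMk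
    rw [this, map_zero, map_zero]
  | add x y hx hy ihx ihy =>
    replace hx : x ∈ RF := by rw [RF_eq_preadmissibleSpan]; exact hx
    replace hy : y ∈ RF := by rw [RF_eq_preadmissibleSpan]; exact hy
    have : rbarMk ⟨x + y, hr⟩ = rbarMk ⟨x, hx⟩ + rbarMk ⟨y, hy⟩ := map_add rbarMk ⟨x, hx⟩ ⟨y, hy⟩
    rw [this, map_add, map_add, ihx, ihy]
  | smul c x hx ihx =>
    replace hx : x ∈ RF := by rw [RF_eq_preadmissibleSpan]; exact hx
    have : rbarMk ⟨c • x, hr⟩ = c • rbarMk ⟨x, hx⟩ := map_smul rbarMk c ⟨x, hx⟩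
    rw [this, map_smul, map_smul, ihx]

end
end SteenrodExt

/-! ### The symmetry operator is a symmetric coderivation -/

namespace SteenrodExt
open AdemAux GradedAux
noncomputable section

theorem swap_symElt (n : ℕ) : swap (symElt n) = symElt n := by
  rw [symElt, map_sum]
  exact Finset.sum_equiv (Equiv.prodComm ℕ ℕ) (by simp [add_comm, and_comm]) (by simp)

theorem swap_freeDer (f : FreeSteenrod) : swap (freeDer f) = freeDer f := by
  have h : swap.toLinearMap ∘ₗ freeDer = freeDer := free_hom_ext fun w => by
    simp only [LinearMap.comp_apply, AlgHom.toLinearMap_apply]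
    induction w with
    | nil => rw [freeWord_nil, freeDer_one, map_zero]
    | cons n w ih =>
      rw [freeWord_cons, freeDer_freeSq_mul, map_add, map_mul, map_mul, ih, swap_symElt, swap_diag,
        swap_diag]
  exact LinearMap.congr_fun h f

theorem swap_freeSym (f : FreeSteenrod) : swap (freeSym f) = freeSym f := by
  have h : swap.toLinearMap ∘ₗ freeSym = freeSym := free_hom_ext fun w => by
    simp only [LinearMap.comp_apply, AlgHom.toLinearMap_apply]
    induction w with
    | nil => rw [freeWord_nil, freeSym_one, map_zero]
    | cons n w ih =>
      simp only [freeWord_cons, freeSym_freeSq_mul, map_add, map_mul, ih, swap_symElt, swap_diag,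
        swap_freeDer]
  exact LinearMap.congr_fun h f

/-- The triple tensor product of the Steenrod algebra. -/
abbrev Steenrod3 : Type := Steenrod ⊗[ZMod 2] (Steenrod ⊗[ZMod 2] Steenrod)

/-- The diagonal applied to the first factor. -/
def diagFst : Steenrod ⊗[ZMod 2] Steenrod →ₐ[ZMod 2] Steenrod3 :=
  (Algebra.TensorProduct.assoc (ZMod 2) (ZMod 2) (ZMod 2) Steenrod Steenrod Steenrod).toAlgHom.comp
    (Algebra.TensorProduct.map diag (AlgHom.id (ZMod 2) Steenrod))

/-- The diagonal applied to the second factor. -/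
def diagSnd : Steenrod ⊗[ZMod 2] Steenrod →ₐ[ZMod 2] Steenrod3 :=
  Algebra.TensorProduct.map (AlgHom.id (ZMod 2) Steenrod) diag

/-- The interchange of the first two of three factors. -/
def swapFst : Steenrod3 →ₐ[ZMod 2] Steenrod3 :=
  (Algebra.TensorProduct.leftComm (ZMod 2) Steenrod Steenrod Steenrod).toAlgHom

@[simp] theorem swapFst_tmul (a b c : Steenrod) :
    swapFst (a ⊗ₜ[ZMod 2] (b ⊗ₜ[ZMod 2] c)) = b ⊗ₜ (a ⊗ₜ c) := rfl

theorem diagSnd_diag (a : Steenrod) : diagSnd (diag a) = diagFst (diag a) :=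
  (Coalgebra.coassoc_apply (R := ZMod 2) a).symm

theorem swapFst_diagFst (t : Steenrod ⊗[ZMod 2] Steenrod) : swapFst (diagFst t) = diagFst t := by
  induction t with
  | zero => simp
  | add x y hx hy => rw [map_add, map_add, hx, hy]
  | tmul a b =>
    have h (u : Steenrod ⊗[ZMod 2] Steenrod) :
        swapFst (Algebra.TensorProduct.assoc (ZMod 2) (ZMod 2) (ZMod 2) Steenrod Steenrod Steenrod
          (u ⊗ₜ b)) = Algebra.TensorProduct.assoc (ZMod 2) (ZMod 2) (ZMod 2) Steenrod Steenrod
          Steenrod (swap u ⊗ₜ b) := by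
      induction u with
      | zero => simp
      | add x y hx hy => simp only [TensorProduct.add_tmul, map_add, hx, hy]
      | tmul c d => rfl
    refine (h (diag a)).trans ?_
    rw [swap_diag]; rfl

theorem swapFst_diagSnd_diag (a : Steenrod) : swapFst (diagSnd (diag a)) = diagSnd (diag a) := by
  rw [diagSnd_diag, swapFst_diagFst]

theorem lTensor_kappa_diag (a : Steenrod) :
    kappa.lTensor Steenrod (diag a) = diag (kappa a) := by
  have hmul (t u : Steenrod ⊗[ZMod 2] Steenrod) : kappa.lTensor Steenrod (t * u) =
      t * kappa.lTensor Steenrod u + kappa.lTensor Steenrod t * u := by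
    induction t with
    | zero => simp
    | add x y hx hy => simp only [add_mul, map_add, hx, hy]; abel
    | tmul a b =>
      induction u with
      | zero => simp
      | add x y hx hy => simp only [mul_add, map_add, hx, hy]; abel
      | tmul c d => simp [kappa_mul, TensorProduct.tmul_add]
  have hsq (n : ℕ) : kappa.lTensor Steenrod (diag (sq n)) = diag (kappa (sq n)) := by
    rw [diag_sq, map_sum, kappa_sq]
    cases n with
    | zero => simp [isAdemFamily_sq.1, kappa_one]
    | succ n =>
      rw [if_neg (Nat.succ_ne_zero n), Nat.add_sub_cancel, diag_sq, Finset.Nat.antidiagonal_succ',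
        Finset.sum_cons]
      simp [isAdemFamily_sq.1, kappa_one, kappa_sq]
  refine steenrod_induction (C := fun a => kappa.lTensor Steenrod (diag a) = diag (kappa a))
    ?_ (fun n a ha => ?_) (by simp) (fun a b ha hb => by simp only [map_add, ha, hb]) a
  · have := hsq 0
    rwa [isAdemFamily_sq.1] at this
  · rw [map_mul, hmul, hsq, ha, kappa_mul, map_add, map_mul, map_mul]

/-- The operator `proj ⊗ g` on the diagonal of the free algebra. -/
def coact (g : FreeSteenrod →ₗ[ZMod 2] Steenrod ⊗[ZMod 2] Steenrod) :
    FreeSteenrod ⊗[ZMod 2] FreeSteenrod →ₗ[ZMod 2] Steenrod3 :=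
  TensorProduct.map proj.toLinearMap g

theorem coact_diag_freeDiag (f : FreeSteenrod) :
    coact (diag.toLinearMap ∘ₗ proj.toLinearMap) (freeDiag f) = diagSnd (diag (proj f)) := by
  rw [diag_proj]
  have h (t : FreeSteenrod ⊗[ZMod 2] FreeSteenrod) :
      coact (diag.toLinearMap ∘ₗ proj.toLinearMap) t =
        diagSnd (Algebra.TensorProduct.map proj proj t) := by
    induction t with
    | zero => simp
    | add x y hx hy => simp only [map_add, hx, hy]
    | tmul a b => rfl
  exact h _

theorem coact_kappa_freeDiag (f : FreeSteenrod) :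
    coact (diag.toLinearMap ∘ₗ kappa ∘ₗ proj.toLinearMap) (freeDiag f) =
      diagSnd (diag (kappa (proj f))) := by
  rw [← lTensor_kappa_diag, diag_proj]
  have h (t : FreeSteenrod ⊗[ZMod 2] FreeSteenrod) :
      coact (diag.toLinearMap ∘ₗ kappa ∘ₗ proj.toLinearMap) t =
        diagSnd (kappa.lTensor Steenrod (Algebra.TensorProduct.map proj proj t)) := by
    induction t with
    | zero => simp
    | add x y hx hy => simp only [map_add, hx, hy]
    | tmul a b => rfl
  exact h _

theorem coact_freeDer_mul (t u : FreeSteenrod ⊗[ZMod 2] FreeSteenrod) : coact freeDer (t * u) =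
    coact freeDer t * coact (diag.toLinearMap ∘ₗ proj.toLinearMap) u +
      coact (diag.toLinearMap ∘ₗ proj.toLinearMap) t * coact freeDer u := by
  induction t with
  | zero => simp
  | add x y hx hy => simp only [add_mul, map_add, hx, hy]; abel
  | tmul a b =>
    induction u with
    | zero => simp
    | add x y hx hy => simp only [mul_add, map_add, hx, hy]; abel
    | tmul c d => simp [coact, freeDer_mul, TensorProduct.tmul_add]

theorem coact_freeSym_mul (t u : FreeSteenrod ⊗[ZMod 2] FreeSteenrod) : coact freeSym (t * u) =
    coact freeSym t * coact (diag.toLinearMap ∘ₗ proj.toLinearMap) u +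
      coact (diag.toLinearMap ∘ₗ proj.toLinearMap) t * coact freeSym u +
      coact (diag.toLinearMap ∘ₗ kappa ∘ₗ proj.toLinearMap) t * coact freeDer u := by
  induction t with
  | zero => simp
  | add x y hx hy => simp only [add_mul, map_add, hx, hy]; abel
  | tmul a b =>
    induction u with
    | zero => simp
    | add x y hx hy => simp only [mul_add, map_add, hx, hy]; abel
    | tmul c d => simp [coact, freeSym_mul, TensorProduct.tmul_add]

theorem sum_antidiagonal_assoc {M : Type*} [AddCommMonoid M] (n : ℕ) (F : ℕ → ℕ → ℕ → M) :
    ∑ p ∈ Finset.HasAntidiagonal.antidiagonal n, ∑ q ∈ Finset.HasAntidiagonal.antidiagonal p.1,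
      F q.1 q.2 p.2 =
    ∑ p ∈ Finset.HasAntidiagonal.antidiagonal n, ∑ q ∈ Finset.HasAntidiagonal.antidiagonal p.2,
      F p.1 q.1 q.2 := by
  rw [Finset.sum_sigma', Finset.sum_sigma']
  refine Finset.sum_bij' (fun t _ => ⟨(t.2.1, t.2.2 + t.1.2), (t.2.2, t.1.2)⟩)
    (fun t _ => ⟨(t.1.1 + t.2.1, t.2.2), (t.1.1, t.2.1)⟩) ?_ ?_ ?_ ?_ ?_
  all_goals rintro ⟨⟨a, b⟩, c, d⟩ h
  all_goals simp only [Finset.mem_sigma, Finset.HasAntidiagonal.mem_antidiagonal] at h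
  · refine Finset.mem_sigma.2 ⟨Finset.HasAntidiagonal.mem_antidiagonal.2 ?_,
      Finset.HasAntidiagonal.mem_antidiagonal.2 ?_⟩ <;> simp only [] <;> omega
  · refine Finset.mem_sigma.2 ⟨Finset.HasAntidiagonal.mem_antidiagonal.2 ?_,
      Finset.HasAntidiagonal.mem_antidiagonal.2 ?_⟩ <;> simp only [] <;> omega
  · obtain ⟨-, rfl⟩ := h; rfl
  · obtain ⟨-, rfl⟩ := h; rfl
  · rfl

theorem sum_antidiagonal_swap {M : Type*} [AddCommMonoid M] (n : ℕ) (F : ℕ → ℕ → ℕ → M) :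
    ∑ p ∈ Finset.HasAntidiagonal.antidiagonal n, ∑ q ∈ Finset.HasAntidiagonal.antidiagonal p.2,
      F q.1 p.1 q.2 =
    ∑ p ∈ Finset.HasAntidiagonal.antidiagonal n, ∑ q ∈ Finset.HasAntidiagonal.antidiagonal p.2,
      F p.1 q.1 q.2 := by
  rw [← sum_antidiagonal_assoc, ← sum_antidiagonal_assoc n (fun a b c => F b a c)]
  exact Finset.sum_congr rfl fun p _ =>
    Finset.sum_equiv (Equiv.prodComm ℕ ℕ) (by simp [add_comm]) (by simp)

theorem symElt_succ (n : ℕ) : symElt (n + 1) = ∑ t ∈ Finset.HasAntidiagonal.antidiagonal n,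
    ((t.1 : ZMod 2) * t.2) • sq t.1 ⊗ₜ[ZMod 2] sq t.2 := by
  rw [symElt, Nat.add_sub_cancel, Finset.sum_filter]
  exact Finset.sum_congr rfl fun t _ => natCast_mul_smul_eq_ite _ _ _

theorem diagFst_symElt_succ (n : ℕ) : diagFst (symElt (n + 1)) =
    ∑ p ∈ Finset.HasAntidiagonal.antidiagonal n, sq p.1 ⊗ₜ[ZMod 2] symElt (p.2 + 1) +
    swapFst (∑ p ∈ Finset.HasAntidiagonal.antidiagonal n, sq p.1 ⊗ₜ[ZMod 2] symElt (p.2 + 1)) := by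
  have h1 : diagFst (symElt (n + 1)) = ∑ p ∈ Finset.HasAntidiagonal.antidiagonal n,
      ∑ q ∈ Finset.HasAntidiagonal.antidiagonal p.1, (((q.1 : ZMod 2) + q.2) * p.2) •
        sq q.1 ⊗ₜ[ZMod 2] (sq q.2 ⊗ₜ[ZMod 2] sq p.2) := by
    rw [symElt_succ, map_sum]
    refine Finset.sum_congr rfl fun p _ => ?_
    rw [map_smul]
    have : diagFst (sq p.1 ⊗ₜ[ZMod 2] sq p.2) = ∑ q ∈ Finset.HasAntidiagonal.antidiagonal p.1,
        sq q.1 ⊗ₜ[ZMod 2] (sq q.2 ⊗ₜ[ZMod 2] sq p.2) := by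
      simp only [diagFst, AlgHom.comp_apply, Algebra.TensorProduct.map_tmul, diag_sq,
        TensorProduct.sum_tmul, map_sum]
      rfl
    rw [this, Finset.smul_sum]
    refine Finset.sum_congr rfl fun q hq => ?_
    rw [← Finset.HasAntidiagonal.mem_antidiagonal.1 hq, Nat.cast_add]
  have h2 : ∑ p ∈ Finset.HasAntidiagonal.antidiagonal n, sq p.1 ⊗ₜ[ZMod 2] symElt (p.2 + 1) =
      ∑ p ∈ Finset.HasAntidiagonal.antidiagonal n, ∑ q ∈ Finset.HasAntidiagonal.antidiagonal p.2,
        ((q.1 : ZMod 2) * q.2) • sq p.1 ⊗ₜ[ZMod 2] (sq q.1 ⊗ₜ[ZMod 2] sq q.2) := by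
    simp_rw [symElt_succ, TensorProduct.tmul_sum, TensorProduct.tmul_smul]
  rw [h1, h2, sum_antidiagonal_assoc n
    (fun a b c => (((a : ZMod 2) + b) * c) • sq a ⊗ₜ[ZMod 2] (sq b ⊗ₜ[ZMod 2] sq c))]
  simp_rw [map_sum, map_smul, swapFst_tmul]
  rw [sum_antidiagonal_swap n
    (fun a b c => ((a : ZMod 2) * c) • sq a ⊗ₜ[ZMod 2] (sq b ⊗ₜ[ZMod 2] sq c))]
  simp_rw [← Finset.sum_add_distrib, ← add_smul, add_mul]
  refine Finset.sum_congr rfl fun p _ => Finset.sum_congr rfl fun q _ => ?_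
  rw [add_comm]

theorem diagFst_freeDer (f : FreeSteenrod) : diagFst (freeDer f) =
    coact freeDer (freeDiag f) + swapFst (coact freeDer (freeDiag f)) := by
  have hsq (n : ℕ) : diagFst (freeDer (freeSq n)) =
      coact freeDer (freeDiag (freeSq n)) + swapFst (coact freeDer (freeDiag (freeSq n))) := by
    have : coact freeDer (freeDiag (freeSq n)) =
        ∑ p ∈ Finset.HasAntidiagonal.antidiagonal n, sq p.1 ⊗ₜ[ZMod 2] symElt (p.2 + 1) := by
      rw [freeDiag_freeSq, map_sum]
      exact Finset.sum_congr rfl fun p _ => by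
        rw [coact, TensorProduct.map_tmul, freeDer_freeSq]; rfl
    rw [this, freeDer_freeSq, diagFst_symElt_succ]
  have h : diagFst.toLinearMap ∘ₗ freeDer = coact freeDer ∘ₗ freeDiag.toLinearMap +
      swapFst.toLinearMap ∘ₗ coact freeDer ∘ₗ freeDiag.toLinearMap := free_hom_ext fun w => by
    simp only [LinearMap.comp_apply, AlgHom.toLinearMap_apply, LinearMap.add_apply]
    induction w with
    | nil => exact hsq 0
    | cons n w ih =>
      rw [freeWord_cons, freeDer_mul, map_add, map_mul, map_mul, ih, hsq, map_mul freeDiag,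
        coact_freeDer_mul, coact_diag_freeDiag, coact_diag_freeDiag]
      simp only [map_add, map_mul, swapFst_diagSnd_diag, ← diagSnd_diag]
      noncomm_ring
  exact LinearMap.congr_fun h f

/-- The symmetry operator is a coderivation in its first factor, already on the free algebra. -/
theorem diagFst_freeSym (f : FreeSteenrod) : diagFst (freeSym f) =
    coact freeSym (freeDiag f) + swapFst (coact freeSym (freeDiag f)) := by
  have hsq (n : ℕ) : diagFst (freeSym (freeSq n)) =
      coact freeSym (freeDiag (freeSq n)) + swapFst (coact freeSym (freeDiag (freeSq n))) := by
    have : coact freeSym (freeDiag (freeSq n)) =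
        ∑ p ∈ Finset.HasAntidiagonal.antidiagonal n, sq p.1 ⊗ₜ[ZMod 2] symElt p.2 := by
      rw [freeDiag_freeSq, map_sum]
      exact Finset.sum_congr rfl fun p _ => by
        rw [coact, TensorProduct.map_tmul, freeSym_freeSq]; rfl
    rw [this, freeSym_freeSq]
    cases n with
    | zero => simp [symElt_zero]
    | succ n =>
      have : ∑ p ∈ Finset.HasAntidiagonal.antidiagonal (n + 1), sq p.1 ⊗ₜ[ZMod 2] symElt p.2 =
          ∑ p ∈ Finset.HasAntidiagonal.antidiagonal n, sq p.1 ⊗ₜ[ZMod 2] symElt (p.2 + 1) := by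
        rw [Finset.Nat.antidiagonal_succ', Finset.sum_cons]
        simp [symElt_zero]
      rw [this, diagFst_symElt_succ]
  have h : diagFst.toLinearMap ∘ₗ freeSym = coact freeSym ∘ₗ freeDiag.toLinearMap +
      swapFst.toLinearMap ∘ₗ coact freeSym ∘ₗ freeDiag.toLinearMap := free_hom_ext fun w => by
    simp only [LinearMap.comp_apply, AlgHom.toLinearMap_apply, LinearMap.add_apply]
    induction w with
    | nil => exact hsq 0
    | cons n w ih =>
      rw [freeWord_cons, freeSym_mul, map_add, map_add, map_mul, map_mul, map_mul, ih, hsq,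
        diagFst_freeDer, map_mul freeDiag, coact_freeSym_mul, coact_diag_freeDiag,
        coact_diag_freeDiag, coact_kappa_freeDiag]
      simp only [map_add, map_mul, swapFst_diagSnd_diag, ← diagSnd_diag]
      noncomm_ring
  exact LinearMap.congr_fun h f

/-! ### The symmetry operator is alternating -/

theorem sum_antidiagonal_symmetric {M : Type*} [AddCommGroup M] [Module (ZMod 2) M] (n : ℕ)
    (g : ℕ → ℕ → M) (hg : ∀ a b, g a b = g b a) :
    ∑ p ∈ Finset.HasAntidiagonal.antidiagonal n, g p.1 p.2 =
      if Even n then g (n / 2) (n / 2) else 0 := by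
  rw [← Finset.sum_filter_add_sum_filter_not _ (fun p : ℕ × ℕ => p.1 = p.2)]
  have h0 : ∑ p ∈ (Finset.HasAntidiagonal.antidiagonal n).filter (fun p => ¬ p.1 = p.2),
      g p.1 p.2 = 0 := by
    refine Finset.sum_involution (fun p _ => p.swap) ?_ ?_ ?_ ?_
    · rintro ⟨a, b⟩ -
      simp only [Prod.fst_swap, Prod.snd_swap]
      rw [hg b a, ZModModule.add_self]
    · rintro ⟨a, b⟩ h - heq
      exact (Finset.mem_filter.1 h).2 (congrArg Prod.snd heq)
    · rintro ⟨a, b⟩ h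
      simp only [Finset.mem_filter, Finset.HasAntidiagonal.mem_antidiagonal, Prod.swap] at h ⊢
      omega
    · rintro ⟨a, b⟩ -; rfl
  rw [h0, add_zero]
  split_ifs with hn
  · rw [Finset.sum_eq_single (n / 2, n / 2)]
    · rintro ⟨a, b⟩ h hne
      simp only [Finset.mem_filter, Finset.HasAntidiagonal.mem_antidiagonal] at h
      exact absurd (Prod.ext (by simp only; omega) (by simp only; omega)) hne
    · intro h
      have hm : n / 2 + n / 2 = n := by obtain ⟨m, rfl⟩ := hn; omega
      exact (h (Finset.mem_filter.2 ⟨Finset.HasAntidiagonal.mem_antidiagonal.2 hm, rfl⟩)).elim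
  · refine Finset.sum_eq_zero ?_
    rintro ⟨a, b⟩ h
    simp only [Finset.mem_filter, Finset.HasAntidiagonal.mem_antidiagonal] at h
    exact absurd ⟨a, by omega⟩ hn

/-- The value of `x ⊗ x` on a tensor. -/
def diagonalForm (x : DualSteenrod) : Module.Dual (ZMod 2) (Steenrod ⊗[ZMod 2] Steenrod) :=
  pairing evalA evalA (x ⊗ₜ x)

theorem diagonalForm_diag (x : DualSteenrod) (a : Steenrod) :
    diagonalForm x (diag a) = evalA (x ^ 2) a := by
  rw [pow_two, evalA_mul]; rfl

theorem diagonalForm_one_diag_mul (n : ℕ) (t : Steenrod ⊗[ZMod 2] Steenrod) :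
    diagonalForm 1 (diag (SteenrodExt.sq n) * t) = if n = 0 then diagonalForm 1 t else 0 := by
  rw [diagonalForm, pairing_diag_sq_mul]
  simp_rw [lam_one]
  split_ifs with h
  · subst h; simp
  · refine Finset.sum_eq_zero fun p hp => ?_
    rw [Finset.HasAntidiagonal.mem_antidiagonal] at hp
    by_cases h1 : p.1 = 0
    · simp [show p.2 ≠ 0 by omega]
    · simp [h1]

/-- For a symmetric tensor only the diagonal term `Sq^(n/2) ⊗ Sq^(n/2)` of `δ (Sq^n)` contributes: the
other terms cancel in pairs. -/
theorem diagonalForm_xi_diag_mul (i n : ℕ) {t : Steenrod ⊗[ZMod 2] Steenrod} (ht : swap t = t) :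
    diagonalForm (xi (i + 1)) (diag (SteenrodExt.sq n) * t) =
      (if n = 0 then diagonalForm (xi (i + 1)) t else 0) +
        if n = 2 ^ (i + 1) then diagonalForm (xi i) t else 0 := by
  have hpos : 0 < 2 ^ i := by positivity
  rw [diagonalForm, pairing_diag_sq_mul, sum_antidiagonal_symmetric n
    (fun a b => pairing evalA evalA (lam a (xi (i + 1)) ⊗ₜ lam b (xi (i + 1))) t)
    (fun a b => by rw [← pairing_swap, ht]), lam_xi_succ, pow_succ]
  by_cases h0 : n = 0
  · subst h0
    simp [hpos.ne]
  · by_cases h1 : n = 2 ^ i * 2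
    · subst h1
      simp [diagonalForm]
    · rw [if_neg h0, if_neg h1]
      split_ifs with he h2 h3 h3
      · obtain ⟨m, rfl⟩ := he; omega
      · obtain ⟨m, rfl⟩ := he; omega
      · obtain ⟨m, rfl⟩ := he; omega
      · simp
      · simp

theorem diagonalForm_one_symElt_mul (n : ℕ) (t : Steenrod ⊗[ZMod 2] Steenrod) :
    diagonalForm 1 (symElt (n + 1) * t) = 0 := by
  rw [symElt_succ, Finset.sum_mul, map_sum]
  refine Finset.sum_eq_zero fun p _ => ?_
  rw [smul_mul_assoc, map_smul, diagonalForm, pairing_lam, lam_one]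
  split_ifs with h
  · simp [h]
  · simp

theorem diagonalForm_xi_symElt_mul (i n : ℕ) (t : Steenrod ⊗[ZMod 2] Steenrod) :
    diagonalForm (xi (i + 1)) (symElt (n + 1) * t) =
      if i = 0 ∧ n = 2 then diagonalForm 1 t else 0 := by
  rw [symElt_succ, Finset.sum_mul, map_sum]
  have h (a : ℕ) : (a : ZMod 2) • lam a (xi (i + 1)) = if i = 0 ∧ a = 1 then 1 else 0 := by
    rw [lam_xi_succ]
    by_cases h0 : a = 0
    · simp [h0]
    · by_cases h1 : a = 2 ^ i
      · subst h1
        rcases Nat.eq_zero_or_pos i with rfl | hi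
        · simp [xi_zero]
        · have : ((2 ^ i : ℕ) : ZMod 2) = 0 :=
            (ZMod.natCast_eq_zero_iff _ _).2 (dvd_pow_self 2 hi.ne')
          rw [this, zero_smul, if_neg (by omega)]
      · have : ¬ (i = 0 ∧ a = 1) := by rintro ⟨rfl, rfl⟩; simp at h1
        simp [h0, h1, this]
  have h2 (p : ℕ × ℕ) : diagonalForm (xi (i + 1))
      (((p.1 : ZMod 2) * p.2) • SteenrodExt.sq p.1 ⊗ₜ[ZMod 2] SteenrodExt.sq p.2 * t) =
      pairing evalA evalA ((if i = 0 ∧ p.1 = 1 then (1 : DualSteenrod) else 0) ⊗ₜ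
        (if i = 0 ∧ p.2 = 1 then (1 : DualSteenrod) else 0)) t := by
    rw [smul_mul_assoc, map_smul, diagonalForm, pairing_lam, ← h, ← h,
      TensorProduct.smul_tmul_smul, map_smul]
    rfl
  simp_rw [h2]
  split_ifs with h3
  · obtain ⟨rfl, rfl⟩ := h3
    rw [Finset.sum_eq_single (1, 1)]
    · simp [diagonalForm]
    · rintro ⟨a, b⟩ hp hne
      rw [Finset.HasAntidiagonal.mem_antidiagonal] at hp
      have : a ≠ 1 := by rintro rfl; exact hne (Prod.ext rfl (by simp only at hp ⊢; omega))
      simp [this]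
    · intro h; simp at h
  · refine Finset.sum_eq_zero ?_
    rintro ⟨a, b⟩ hp
    rw [Finset.HasAntidiagonal.mem_antidiagonal] at hp
    simp only at hp ⊢
    by_cases ha : i = 0 ∧ a = 1
    · rw [if_neg (show ¬ (i = 0 ∧ b = 1) by omega)]; simp
    · rw [if_neg ha]; simp

theorem evalA_xi_sq_mul (i n : ℕ) (a : Steenrod) : evalA (xi (i + 1) ^ 2) (SteenrodExt.sq n * a) =
    (if n = 0 then evalA (xi (i + 1) ^ 2) a else 0) +
      if n = 2 ^ (i + 1) then evalA (xi i ^ 2) a else 0 := by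
  rw [← diagonalForm_diag, map_mul, diagonalForm_xi_diag_mul i n (swap_diag a), diagonalForm_diag,
    diagonalForm_diag]

theorem diagonalForm_one_freeDer (w : List ℕ) : diagonalForm 1 (freeDer (freeWord w)) = 0 := by
  induction w with
  | nil => rw [freeWord_nil, freeDer_one, map_zero]
  | cons n w ih =>
    rw [freeWord_cons, freeDer_freeSq_mul, map_add, diagonalForm_one_symElt_mul,
      diagonalForm_one_diag_mul, ih]
    simp

theorem diagonalForm_one_freeSym (w : List ℕ) : diagonalForm 1 (freeSym (freeWord w)) = 0 := by
  induction w with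
  | nil => rw [freeWord_nil, freeSym_one, map_zero]
  | cons n w ih =>
    rw [freeWord_cons, freeSym_freeSq_mul, map_add, map_add, diagonalForm_one_diag_mul, ih,
      kappa_sq]
    cases n with
    | zero => simp [symElt_zero]
    | succ n =>
      rw [diagonalForm_one_symElt_mul, if_neg n.succ_ne_zero, if_neg n.succ_ne_zero,
        Nat.add_sub_cancel, diagonalForm_one_diag_mul, diagonalForm_one_freeDer]
      simp

theorem diagonalForm_xi_freeDer (w : List ℕ) : ∀ i, diagonalForm (xi (i + 1)) (freeDer (freeWord w)) =
    evalA (xi (i + 1) ^ 2) (proj (freeWord w)) := by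
  induction w with
  | nil =>
    intro i
    rw [freeWord_nil, freeDer_one, map_zero, map_one, ← diagonalForm_diag, map_one,
      Algebra.TensorProduct.one_def, diagonalForm, pairing_tmul, evalA_xi, xiForm_apply, map_one]
    simp
  | cons n w ih =>
    intro i
    rw [freeWord_cons, freeDer_freeSq_mul, map_add, diagonalForm_xi_symElt_mul,
      diagonalForm_xi_diag_mul i n (swap_freeDer _), map_mul]
    change _ = evalA _ (SteenrodExt.sq n * _)
    rw [evalA_xi_sq_mul, ih, diagonalForm_diag]
    cases i with
    | zero =>
      rw [xi_zero, diagonalForm_one_freeDer]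
      by_cases h : n = 2
      · subst h; simp
      · simp [h]
    | succ i => rw [ih]; simp

theorem evalA_xi_one_mul (n : ℕ) (y : DualSteenrod) (a : Steenrod) :
    evalA (xi 1 * y) (SteenrodExt.sq n * a) = evalA (xi 1 * lam n y) a +
      if n = 0 then 0 else evalA y (SteenrodExt.sq (n - 1) * a) := by
  rw [← evalA_lam, lam_mul]
  cases n with
  | zero =>
    rw [Finset.Nat.antidiagonal_zero, Finset.sum_singleton, if_pos rfl, add_zero, lam_xi_succ]
    simp
  | succ n =>
    rw [Finset.Nat.antidiagonal_succ, Finset.sum_cons, Finset.sum_map, if_neg n.succ_ne_zero,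
      Nat.add_sub_cancel, ← evalA_lam, map_add, LinearMap.add_apply, lam_xi_succ]
    simp only [Function.Embedding.coe_prodMap, Function.Embedding.coeFn_mk]
    rw [Finset.sum_eq_single (0, n)]
    · simp [lam_xi_succ, xi_zero]
    · rintro ⟨b, c⟩ hp hne
      rw [Finset.HasAntidiagonal.mem_antidiagonal] at hp
      have : b ≠ 0 := by rintro rfl; exact hne (Prod.ext rfl (by simp only at hp ⊢; omega))
      simp [lam_xi_succ, this]
    · intro h; simp at h

/-- The diagonal values of the symmetry operator depend only on classes in `A`, hence vanish on
relations. -/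
theorem diagonalForm_xi_freeSym (w : List ℕ) : ∀ i,
    diagonalForm (xi (i + 1)) (freeSym (freeWord w)) =
      evalA (xi (i + 2) + xi 1 * xi (i + 1) ^ 2) (proj (freeWord w)) := by
  induction w with
  | nil =>
    intro i
    rw [freeWord_nil, freeSym_one, map_zero, map_one proj, map_add, LinearMap.add_apply, evalA_mul,
      map_one diag,
      Algebra.TensorProduct.one_def, pairing_tmul, evalA_xi, evalA_xi, xiForm_apply, xiForm_apply,
      map_one]
    simp
  | cons n w ih =>
    intro i
    rw [freeWord_cons, freeSym_freeSq_mul, map_add, map_add,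
      diagonalForm_xi_diag_mul i n (swap_freeSym _), map_mul proj]
    change _ = evalA _ (SteenrodExt.sq n * _)
    rw [map_add, LinearMap.add_apply, evalA_xi_one_mul, evalA_xi, xiForm_succ_sq_mul, ih, kappa_sq]
    have hl : lam n (xi (i + 1) ^ 2) = (if n = 0 then xi (i + 1) ^ 2 else 0) +
        if n = 2 ^ (i + 1) then xi i ^ 2 else 0 := by
      apply dual_ext
      intro a
      rw [evalA_lam, evalA_xi_sq_mul, map_add, LinearMap.add_apply]
      congr 1 <;> split_ifs <;> simp
    rw [hl]
    cases n with
    | zero =>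
      have : (0 : ℕ) ≠ 2 ^ (i + 1) := (by positivity : (0 : ℕ) < 2 ^ (i + 1)).ne
      simp [symElt_zero, this, evalA_xi]
    | succ n =>
      rw [diagonalForm_xi_symElt_mul, if_neg n.succ_ne_zero, if_neg n.succ_ne_zero,
        if_neg n.succ_ne_zero, if_neg n.succ_ne_zero, if_neg n.succ_ne_zero,
        Nat.add_sub_cancel, diagonalForm_xi_diag_mul i n (swap_freeDer _), diagonalForm_xi_freeDer,
        evalA_xi_sq_mul, zero_add, zero_add, zero_add, diagonalForm_diag, ← evalA_xi]
      cases i with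
      | zero =>
        rw [xi_zero, diagonalForm_one_freeDer, diagonalForm_one_freeSym]
        by_cases h1 : n + 1 = 2 ^ (0 + 1)
        · obtain rfl : n = 1 := by omega
          simp [ZModModule.add_self]
        · rw [if_neg h1, if_neg h1, if_neg h1]
          by_cases h2 : n = 2
          · subst h2; simp
          · simp [h2]
      | succ i =>
        rw [ih, diagonalForm_xi_freeDer, if_neg (by omega)]
        by_cases h1 : n + 1 = 2 ^ (i + 1 + 1)
        · simp [h1, add_assoc]
        · simp [h1]

theorem diagonalForm_xi_symOp (i : ℕ) (r : Rbar) : diagonalForm (xi (i + 1)) (symOp r) = 0 := by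
  obtain ⟨r, rfl⟩ := rbarMk_surjective r
  have h : diagonalForm (xi (i + 1)) ∘ₗ freeSym =
      evalA (xi (i + 2) + xi 1 * xi (i + 1) ^ 2) ∘ₗ proj.toLinearMap :=
    free_hom_ext fun w => diagonalForm_xi_freeSym w i
  refine (LinearMap.congr_fun h r).trans ?_
  rw [LinearMap.comp_apply, AlgHom.toLinearMap_apply, mem_RF.1 r.2, map_zero]

end
end SteenrodExt

/-! ### The coactions on relations -/

namespace SteenrodExt
open AdemAux GradedAux
noncomputable section

theorem freeDiag_swap (f : FreeSteenrod) :
    TensorProduct.comm (ZMod 2) FreeSteenrod FreeSteenrod (freeDiag f) = freeDiag f := by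
  have h : (Algebra.TensorProduct.comm (ZMod 2) FreeSteenrod FreeSteenrod).toAlgHom.comp freeDiag =
      freeDiag := by
    apply FreeAlgebra.hom_ext
    funext n
    obtain ⟨m, rfl⟩ : ∃ m : ℕ, n = m.succPNat := ⟨n.natPred, by simp⟩
    change Algebra.TensorProduct.comm (ZMod 2) FreeSteenrod FreeSteenrod
      (freeDiag (freeSq (m + 1))) = freeDiag (freeSq (m + 1))
    rw [freeDiag_freeSq, map_sum]
    exact Finset.sum_equiv (Equiv.prodComm ℕ ℕ) (by simp [add_comm]) (by simp)
  exact DFunLike.congr_fun h f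

theorem freeDiag_coassoc (f : FreeSteenrod) :
    TensorProduct.assoc (ZMod 2) FreeSteenrod FreeSteenrod FreeSteenrod
      (freeDiag.toLinearMap.rTensor FreeSteenrod (freeDiag f)) =
    freeDiag.toLinearMap.lTensor FreeSteenrod (freeDiag f) := by
  have h : ((Algebra.TensorProduct.assoc (ZMod 2) (ZMod 2) (ZMod 2) FreeSteenrod FreeSteenrod
      FreeSteenrod).toAlgHom.comp (Algebra.TensorProduct.map freeDiag (AlgHom.id _ _))).comp
        freeDiag = (Algebra.TensorProduct.map (AlgHom.id _ _) freeDiag).comp freeDiag := by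
    apply FreeAlgebra.hom_ext
    funext n
    obtain ⟨m, rfl⟩ : ∃ m : ℕ, n = m.succPNat := ⟨n.natPred, by simp⟩
    change Algebra.TensorProduct.assoc (ZMod 2) (ZMod 2) (ZMod 2) FreeSteenrod FreeSteenrod
      FreeSteenrod (Algebra.TensorProduct.map freeDiag (AlgHom.id _ _)
        (freeDiag (freeSq (m + 1)))) = Algebra.TensorProduct.map (AlgHom.id _ _) freeDiag
          (freeDiag (freeSq (m + 1)))
    rw [freeDiag_freeSq, map_sum, map_sum, map_sum]
    simp only [Algebra.TensorProduct.map_tmul, freeDiag_freeSq, AlgHom.id_apply,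
      TensorProduct.sum_tmul, TensorProduct.tmul_sum, map_sum, Algebra.TensorProduct.assoc_tmul]
    exact sum_antidiagonal_assoc (m + 1)
      (fun a b c => freeSq a ⊗ₜ[ZMod 2] (freeSq b ⊗ₜ[ZMod 2] freeSq c))
  exact DFunLike.congr_fun h f

theorem freeDiag_mem_tensorGr {n : ℕ} {f : FreeSteenrod} (hf : f ∈ freeGr n) :
    freeDiag f ∈ tensorGr freeGr freeGr n := by
  have hmul {i j : ℕ} {x y : FreeSteenrod ⊗[ZMod 2] FreeSteenrod}
      (hx : x ∈ tensorGr freeGr freeGr i) (hy : y ∈ tensorGr freeGr freeGr j) :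
      x * y ∈ tensorGr freeGr freeGr (i + j) := by
    have h : tensorGr freeGr freeGr i * tensorGr freeGr freeGr j ≤
        tensorGr freeGr freeGr (i + j) := by
      rw [tensorGr, tensorGr, Submodule.span_mul_span]
      apply Submodule.span_le.2
      rintro _ ⟨_, ⟨a, b, rfl, u, hu, v, hv, rfl⟩, _, ⟨c, d, rfl, u', hu', v', hv', rfl⟩, rfl⟩
      exact Submodule.subset_span ⟨a + c, b + d, by omega, u * u', freeGr_mul_mem hu hu',
        v * v', freeGr_mul_mem hv hv', Algebra.TensorProduct.tmul_mul_tmul _ _ _ _⟩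
    exact h (Submodule.mul_mem_mul hx hy)
  induction hf using Submodule.span_induction with
  | mem f hf =>
    obtain ⟨w, rfl, rfl⟩ := hf
    induction w with
    | nil =>
      refine Submodule.subset_span ⟨0, 0, rfl, 1, freeGr_one_mem, 1, freeGr_one_mem, ?_⟩
      rw [freeWord_nil, map_one freeDiag, Algebra.TensorProduct.one_def]
    | cons a w ih =>
      rw [freeWord_cons, map_mul, List.sum_cons]
      refine hmul ?_ ih
      rw [freeDiag_freeSq]
      exact Submodule.sum_mem _ fun p hp => Submodule.subset_span
        ⟨p.1, p.2, Finset.HasAntidiagonal.mem_antidiagonal.1 hp, _, freeSq_mem _, _,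
          freeSq_mem _, rfl⟩
  | zero => rw [map_zero]; exact Submodule.zero_mem _
  | add x y _ _ hx hy => rw [map_add]; exact Submodule.add_mem _ hx hy
  | smul c x _ hx => rw [map_smul]; exact Submodule.smul_mem _ _ hx

theorem lTensor_rbarIncl_injective (V : Type) [AddCommGroup V] [Module (ZMod 2) V] :
    Function.Injective (rbarIncl.lTensor V) :=
  Module.Flat.lTensor_preserves_injective_linearMap _ rbarIncl_injective

theorem comm_leftCoaction (r : Rbar) :
    TensorProduct.comm (ZMod 2) Steenrod Rbar (leftCoaction r) = rightCoaction r := by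
  obtain ⟨r, rfl⟩ := rbarMk_surjective r
  apply Module.Flat.rTensor_preserves_injective_linearMap (M := Steenrod) _ rbarIncl_injective
  have h (t : Steenrod ⊗[ZMod 2] Rbar) :
      rbarIncl.rTensor Steenrod (TensorProduct.comm (ZMod 2) Steenrod Rbar t) =
        TensorProduct.comm (ZMod 2) Steenrod Fbar (rbarIncl.lTensor Steenrod t) := by
    induction t with
    | zero => simp
    | add x y hx hy => simp only [map_add, hx, hy]
    | tmul a b => rfl
  have h2 (t : FreeSteenrod ⊗[ZMod 2] FreeSteenrod) :
      TensorProduct.comm (ZMod 2) Steenrod Fbar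
        (TensorProduct.map proj.toLinearMap RF2.mkQ t) =
      TensorProduct.map RF2.mkQ proj.toLinearMap
        (TensorProduct.comm (ZMod 2) FreeSteenrod FreeSteenrod t) := by
    induction t with
    | zero => simp
    | add x y hx hy => simp only [map_add, hx, hy]
    | tmul a b => rfl
  rw [h, lTensor_leftCoaction, rTensor_rightCoaction, h2, freeDiag_swap]

/-- The left coaction of `A` on `Fbar`. -/
def fbarCoaction : Fbar →ₗ[ZMod 2] Steenrod ⊗[ZMod 2] Fbar :=
  RF2.liftQ (TensorProduct.map proj.toLinearMap RF2.mkQ ∘ₗ freeDiag.toLinearMap)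
    fun _ hr => (map_freeDiag_RF2 hr).1

theorem lTensor_leftCoaction_eq (r : Rbar) :
    rbarIncl.lTensor Steenrod (leftCoaction r) = fbarCoaction (rbarIncl r) := by
  obtain ⟨r, rfl⟩ := rbarMk_surjective r
  exact lTensor_leftCoaction r

theorem fbarCoaction_coassoc (x : Fbar) :
    TensorProduct.assoc (ZMod 2) Steenrod Steenrod Fbar
      (diag.toLinearMap.rTensor Fbar (fbarCoaction x)) =
    fbarCoaction.lTensor Steenrod (fbarCoaction x) := by
  obtain ⟨f, rfl⟩ := RF2.mkQ_surjective x
  change TensorProduct.assoc (ZMod 2) Steenrod Steenrod Fbar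
      (diag.toLinearMap.rTensor Fbar (TensorProduct.map proj.toLinearMap RF2.mkQ (freeDiag f))) =
    fbarCoaction.lTensor Steenrod (TensorProduct.map proj.toLinearMap RF2.mkQ (freeDiag f))
  have h1 (t : FreeSteenrod ⊗[ZMod 2] FreeSteenrod) :
      TensorProduct.assoc (ZMod 2) Steenrod Steenrod Fbar
        (diag.toLinearMap.rTensor Fbar (TensorProduct.map proj.toLinearMap RF2.mkQ t)) =
      TensorProduct.map proj.toLinearMap (TensorProduct.map proj.toLinearMap RF2.mkQ)
        (TensorProduct.assoc (ZMod 2) FreeSteenrod FreeSteenrod FreeSteenrod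
          (freeDiag.toLinearMap.rTensor FreeSteenrod t)) := by
    induction t with
    | zero => simp
    | add x y hx hy => simp only [map_add, hx, hy]
    | tmul a b =>
      simp only [TensorProduct.map_tmul, LinearMap.rTensor_tmul, AlgHom.toLinearMap_apply,
        diag_proj]
      generalize freeDiag a = u
      induction u with
      | zero => simp
      | add x y hx hy => simp only [map_add, TensorProduct.add_tmul, hx, hy]
      | tmul c d => rfl
  have h2 (t : FreeSteenrod ⊗[ZMod 2] FreeSteenrod) :
      fbarCoaction.lTensor Steenrod (TensorProduct.map proj.toLinearMap RF2.mkQ t) =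
      TensorProduct.map proj.toLinearMap (TensorProduct.map proj.toLinearMap RF2.mkQ)
        (freeDiag.toLinearMap.lTensor FreeSteenrod t) := by
    induction t with
    | zero => simp
    | add x y hx hy => simp only [map_add, hx, hy]
    | tmul a b => rfl
  rw [h1, h2, freeDiag_coassoc]

theorem leftCoaction_coassoc (r : Rbar) :
    TensorProduct.assoc (ZMod 2) Steenrod Steenrod Rbar
      (diag.toLinearMap.rTensor Rbar (leftCoaction r)) =
    leftCoaction.lTensor Steenrod (leftCoaction r) := by
  apply Module.Flat.lTensor_preserves_injective_linearMap (M := Steenrod) _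
    (lTensor_rbarIncl_injective Steenrod)
  have h1 (t : Steenrod ⊗[ZMod 2] Rbar) :
      (rbarIncl.lTensor Steenrod).lTensor Steenrod (TensorProduct.assoc (ZMod 2) Steenrod Steenrod
        Rbar (diag.toLinearMap.rTensor Rbar t)) = TensorProduct.assoc (ZMod 2) Steenrod Steenrod
          Fbar (diag.toLinearMap.rTensor Fbar (rbarIncl.lTensor Steenrod t)) := by
    induction t with
    | zero => simp
    | add x y hx hy => simp only [map_add, hx, hy]
    | tmul a b =>
      simp only [LinearMap.rTensor_tmul, LinearMap.lTensor_tmul, AlgHom.toLinearMap_apply]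
      generalize diag a = u
      induction u with
      | zero => simp
      | add x y hx hy => simp only [map_add, TensorProduct.add_tmul, hx, hy]
      | tmul c d => rfl
  have h2 (t : Steenrod ⊗[ZMod 2] Rbar) :
      (rbarIncl.lTensor Steenrod).lTensor Steenrod (leftCoaction.lTensor Steenrod t) =
        fbarCoaction.lTensor Steenrod (rbarIncl.lTensor Steenrod t) := by
    induction t with
    | zero => simp
    | add x y hx hy => simp only [map_add, hx, hy]
    | tmul a b => simp only [LinearMap.lTensor_tmul, lTensor_leftCoaction_eq]
  rw [h1, h2, lTensor_leftCoaction_eq, fbarCoaction_coassoc]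

theorem leftCoaction_counit (r : Rbar) :
    aug.toLinearMap.rTensor Rbar (leftCoaction r) = 1 ⊗ₜ r := by
  have hf (f : FreeSteenrod) :
      TensorProduct.map (aug.toLinearMap ∘ₗ proj.toLinearMap) LinearMap.id (freeDiag f) =
        (1 : ZMod 2) ⊗ₜ[ZMod 2] f := by
    have h : (Algebra.TensorProduct.map (aug.comp proj) (AlgHom.id (ZMod 2) FreeSteenrod)).comp
        freeDiag = Algebra.TensorProduct.includeRight := by
      apply FreeAlgebra.hom_ext
      funext n
      obtain ⟨m, rfl⟩ : ∃ m : ℕ, n = m.succPNat := ⟨n.natPred, by simp⟩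
      change Algebra.TensorProduct.map (aug.comp proj) (AlgHom.id (ZMod 2) FreeSteenrod)
        (freeDiag (freeSq (m + 1))) = 1 ⊗ₜ freeSq (m + 1)
      rw [freeDiag_freeSq, map_sum, Finset.sum_eq_single (0, m + 1)]
      · simp [freeSq]
      · rintro ⟨a, b⟩ h hne
        have ha : a ≠ 0 := by rintro rfl; apply hne; simpa using h
        have : aug (proj (freeSq a)) = 0 := (aug_sq a).trans (if_neg ha)
        simp [this]
      · simp
    exact DFunLike.congr_fun h f
  obtain ⟨r, rfl⟩ := rbarMk_surjective r
  apply lTensor_rbarIncl_injective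
  have h1 (t : Steenrod ⊗[ZMod 2] Rbar) :
      rbarIncl.lTensor (ZMod 2) (aug.toLinearMap.rTensor Rbar t) =
        aug.toLinearMap.rTensor Fbar (rbarIncl.lTensor Steenrod t) := by
    induction t with
    | zero => simp
    | add x y hx hy => simp only [map_add, hx, hy]
    | tmul a b => rfl
  have h2 (t : FreeSteenrod ⊗[ZMod 2] FreeSteenrod) :
      aug.toLinearMap.rTensor Fbar (TensorProduct.map proj.toLinearMap RF2.mkQ t) =
        RF2.mkQ.lTensor (ZMod 2)
          (TensorProduct.map (aug.toLinearMap ∘ₗ proj.toLinearMap) LinearMap.id t) := by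
    induction t with
    | zero => simp
    | add x y hx hy => simp only [map_add, hx, hy]
    | tmul a b => rfl
  rw [h1, lTensor_leftCoaction, h2, hf]
  rfl

theorem leftCoaction_mem {n : ℕ} {r : Rbar} (hr : r ∈ desuspGr n) :
    leftCoaction r ∈ tensorGr steenrodGr desuspGr n := by
  refine steenrodProj.mem_tensorGr desuspProj fun i j hij => ?_
  obtain ⟨r, hr, rfl⟩ := hr
  apply lTensor_rbarIncl_injective
  have h1 (t : Steenrod ⊗[ZMod 2] Rbar) :
      rbarIncl.lTensor Steenrod (TensorProduct.map (steenrodProj.π i) (desuspProj.π j) t) =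
        TensorProduct.map (steenrodProj.π i) (fbarDegree (j + 1))
          (rbarIncl.lTensor Steenrod t) := by
    induction t with
    | zero => simp
    | add x y hx hy => simp only [map_add, hx, hy]
    | tmul a b =>
      simp only [LinearMap.lTensor_tmul, TensorProduct.map_tmul]
      congr 1
      exact LinearMap.congr_fun (rbarIncl_comp_rbarDegree (j + 1)) b
  have h2 (t : FreeSteenrod ⊗[ZMod 2] FreeSteenrod) :
      TensorProduct.map (steenrodProj.π i) (fbarDegree (j + 1))
        (TensorProduct.map proj.toLinearMap RF2.mkQ t) = TensorProduct.map proj.toLinearMap RF2.mkQ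
          (TensorProduct.map (freeProj.π i) (freeProj.π (j + 1)) t) := by
    induction t with
    | zero => simp
    | add x y hx hy => simp only [map_add, hx, hy]
    | tmul a b =>
      simp only [TensorProduct.map_tmul, AlgHom.toLinearMap_apply, proj_freeProj]
      rfl
  have hr' : (r : FreeSteenrod) ∈ freeGr (n + 1) := hr
  rw [h1, lTensor_leftCoaction, h2,
    freeProj.map_eq_zero freeProj (freeDiag_mem_tensorGr hr') (by omega), map_zero, map_zero]

/-- The symmetry operator is a coderivation in its first factor. -/
theorem diagFst_symOp (r : Rbar) : diagFst (symOp r) = symOp.lTensor Steenrod (leftCoaction r) +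
    swapFst (symOp.lTensor Steenrod (leftCoaction r)) := by
  obtain ⟨r, rfl⟩ := rbarMk_surjective r
  let symBar : Fbar →ₗ[ZMod 2] Steenrod ⊗[ZMod 2] Steenrod :=
    RF2.liftQ freeSym fun _ hf => freeSym_of_mem_RF2 hf
  have h1 (t : Steenrod ⊗[ZMod 2] Rbar) :
      symOp.lTensor Steenrod t = symBar.lTensor Steenrod (rbarIncl.lTensor Steenrod t) := by
    rw [← LinearMap.comp_apply, ← LinearMap.lTensor_comp]
    congr 2
    apply LinearMap.ext
    intro x
    obtain ⟨r, rfl⟩ := rbarMk_surjective x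
    rfl
  have h2 : symOp.lTensor Steenrod (leftCoaction (rbarMk r)) = coact freeSym (freeDiag r) := by
    rw [h1, lTensor_leftCoaction, ← LinearMap.comp_apply, LinearMap.lTensor_comp_map]
    rfl
  rw [h2, symOp_mk, diagFst_freeSym]

end
end SteenrodExt

/-! ### Square zero extensions of commutative algebras -/

namespace GradedAux
noncomputable section

/-- A bilinear 2-cocycle of the commutative algebra `B` with values in the symmetric bimodule `M`. -/
structure TwoCocycle (k B M : Type) [CommRing k] [CommRing B] [Algebra k B] [AddCommGroup M]
    [Module k M] [Module B M] where
  /-- The underlying bilinear map. -/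
  map : B →ₗ[k] B →ₗ[k] M
  cocycle : ∀ x y z, x • map y z + map x (y * z) = map (x * y) z + z • map x y

variable {k B M : Type} [CommRing k] [CommRing B] [Algebra k B] [AddCommGroup M] [Module k M]
  [Module B M]

/-- The square zero extension of `B` by `M` given by a 2-cocycle `c`: the module `B × M` with the
product `(x, m) (y, n) = (x y, x n + y m + c (x, y))`. -/
def CocycleExt (_c : TwoCocycle k B M) : Type := B × M

namespace TwoCocycle
variable (c : TwoCocycle k B M)

theorem map_one_right (x : B) : c.map x 1 = x • c.map 1 1 := by
  have h := c.cocycle x 1 1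
  rw [mul_one, mul_one, one_smul, add_left_inj] at h
  exact h.symm

theorem map_one_left (x : B) : c.map 1 x = x • c.map 1 1 := by
  have h := c.cocycle 1 1 x
  rw [one_mul, one_mul, one_smul, add_right_inj] at h
  exact h

end TwoCocycle

namespace CocycleExt
variable (c : TwoCocycle k B M)

instance : AddCommGroup (CocycleExt c) := inferInstanceAs (AddCommGroup (B × M))
instance : Module k (CocycleExt c) := inferInstanceAs (Module k (B × M))

/-- The inclusion of `B`, a linear section of the projection onto `B`. -/
def inl : B →ₗ[k] CocycleExt c := LinearMap.inl k B M

/-- The inclusion of `M`. -/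
def inr : M →ₗ[k] CocycleExt c := LinearMap.inr k B M

/-- The projection onto `B`. -/
def fst : CocycleExt c →ₗ[k] B := LinearMap.fst k B M

/-- The projection onto `M`. -/
def snd : CocycleExt c →ₗ[k] M := LinearMap.snd k B M

variable {c}

theorem ext {u v : CocycleExt c} (h1 : fst c u = fst c v) (h2 : snd c u = snd c v) : u = v :=
  Prod.ext h1 h2

@[simp] theorem fst_inl (x : B) : fst c (inl c x) = x := rfl
@[simp] theorem snd_inl (x : B) : snd c (inl c x) = 0 := rfl
@[simp] theorem fst_inr (m : M) : fst c (inr c m) = 0 := rfl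
@[simp] theorem snd_inr (m : M) : snd c (inr c m) = m := rfl

theorem inl_fst_add_inr_snd (u : CocycleExt c) : inl c (fst c u) + inr c (snd c u) = u :=
  ext (by simp) (by simp)

instance : Mul (CocycleExt c) :=
  ⟨fun u v => (fst c u * fst c v, fst c u • snd c v + fst c v • snd c u + c.map (fst c u) (fst c v))⟩

instance : One (CocycleExt c) := ⟨((1 : B), -c.map 1 1)⟩

@[simp] theorem fst_mul (u v : CocycleExt c) : fst c (u * v) = fst c u * fst c v := rfl

@[simp] theorem snd_mul (u v : CocycleExt c) :
    snd c (u * v) = fst c u • snd c v + fst c v • snd c u + c.map (fst c u) (fst c v) := rfl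

@[simp] theorem fst_one : fst c 1 = 1 := rfl

@[simp] theorem snd_one : snd c 1 = -c.map 1 1 := rfl

instance : Ring (CocycleExt c) :=
  { (inferInstance : AddCommGroup (CocycleExt c)),
    (inferInstance : Mul (CocycleExt c)), (inferInstance : One (CocycleExt c)) with
    left_distrib := fun u v w => ext (by simp [mul_add])
      (by simp only [snd_mul, map_add, smul_add, add_smul]; abel)
    right_distrib := fun u v w => ext (by simp [add_mul])
      (by simp only [snd_mul, map_add, smul_add, add_smul, LinearMap.add_apply]; abel)
    zero_mul := fun u => ext (zero_mul (fst c u))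
      (show (0 : B) • snd c u + fst c u • (0 : M) + c.map 0 (fst c u) = 0 by simp)
    mul_zero := fun u => ext (mul_zero (fst c u))
      (show fst c u • (0 : M) + (0 : B) • snd c u + c.map (fst c u) 0 = 0 by simp)
    one_mul := fun u => ext (one_mul (fst c u))
      (by rw [snd_mul, fst_one, snd_one, c.map_one_left (fst c u)]; simp)
    mul_one := fun u => ext (mul_one (fst c u))
      (by rw [snd_mul, fst_one, snd_one, c.map_one_right (fst c u)]; simp)
    mul_assoc := fun u v w => ext (by simp [mul_assoc]) (by
      have h := c.cocycle (fst c u) (fst c v) (fst c w)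
      simp only [snd_mul, fst_mul, smul_add, smul_smul]
      rw [eq_sub_of_add_eq h]
      simp only [mul_comm (fst c w)]
      abel) }

variable [IsScalarTower k B M]

instance : Algebra k (CocycleExt c) := Algebra.ofModule
  (fun r u v => ext (by simp) (by
    simp only [snd_mul, map_smul, smul_add, LinearMap.smul_apply, smul_assoc]
    rw [smul_comm r (fst c v)]))
  (fun r u v => ext (by simp) (by
    simp only [snd_mul, map_smul, smul_add, smul_assoc]
    rw [smul_comm r (fst c u)]))

end CocycleExt

theorem exists_mvPolynomial_hom {σ D : Type} [Ring D] [Algebra k D] (hD : ∀ x y : D, x * y = y * x)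
    (d : σ → D) : ∃ φ : MvPolynomial σ k →ₐ[k] D, ∀ i, φ (MvPolynomial.X i) = d i := by
  let _ : CommRing D := { (inferInstance : Ring D) with mul_comm := hD }
  exact ⟨MvPolynomial.aeval d, fun i => MvPolynomial.aeval_X _ _⟩

variable [IsScalarTower k B M]

/-- A symmetric cocycle of a polynomial algebra is a coboundary, and the values on the generators of
the cochain that it bounds are arbitrary: the square zero extension is commutative, so that the
projection has a multiplicative section with given values on the generators. -/
theorem TwoCocycle.exists_primitive {σ : Type} (e : MvPolynomial σ k ≃ₐ[k] B) (c : TwoCocycle k B M)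
    (hc : ∀ x y, c.map x y = c.map y x) (m : σ → M) :
    ∃ V : B →ₗ[k] M, (∀ i, V (e (MvPolynomial.X i)) = m i) ∧
      ∀ x y, V (x * y) = x • V y + y • V x + c.map x y := by
  obtain ⟨φ, hφX⟩ := exists_mvPolynomial_hom (k := k) (D := CocycleExt c)
    (fun u v => CocycleExt.ext (by simp [mul_comm]) (by
      rw [CocycleExt.snd_mul, CocycleExt.snd_mul, hc,
        add_comm (CocycleExt.fst c u • CocycleExt.snd c v)]))
    fun i => CocycleExt.inl c (e (MvPolynomial.X i)) + CocycleExt.inr c (m i)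
  let π : CocycleExt c →ₐ[k] B := AlgHom.ofLinearMap (CocycleExt.fst c) rfl fun _ _ => rfl
  have hφ : π.comp φ = e.toAlgHom := by
    apply MvPolynomial.algHom_ext
    intro i
    rw [AlgHom.comp_apply, hφX]
    exact add_zero _
  have hfst (p) : CocycleExt.fst c (φ p) = e p := DFunLike.congr_fun hφ p
  refine ⟨CocycleExt.snd c ∘ₗ φ.toLinearMap ∘ₗ e.symm.toLinearMap, fun i => ?_, fun x y => ?_⟩
  · simp only [LinearMap.comp_apply, AlgEquiv.toLinearMap_apply, AlgEquiv.symm_apply_apply,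
      AlgHom.toLinearMap_apply, hφX, map_add, CocycleExt.snd_inl, CocycleExt.snd_inr, zero_add]
  · simp only [LinearMap.comp_apply, AlgEquiv.toLinearMap_apply, map_mul, AlgHom.toLinearMap_apply]
    rw [CocycleExt.snd_mul, hfst, hfst, AlgEquiv.apply_symm_apply, AlgEquiv.apply_symm_apply]

end
end GradedAux

/-! ### Graded duality -/

namespace GradedAux
noncomputable section
variable {k U V R L M N : Type} [Field k] [AddCommGroup U] [Module k U] [AddCommGroup V]
  [Module k V] [AddCommGroup R] [Module k R] [AddCommGroup L] [Module k L] [AddCommGroup M]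
  [Module k M] [AddCommGroup N] [Module k N]

/-- The linear map `j` identifies `M` with the graded dual of `V`. -/
structure IsGradedDual (𝒱 : ℕ → Submodule k V) (j : M →ₗ[k] Module.Dual k V) : Prop where
  injective : Function.Injective j
  range_eq : LinearMap.range j = gradedDual 𝒱

/-- The elements of `M` that are, under `j`, linear forms that vanish outside degree `n`. -/
def dualGr (𝒱 : ℕ → Submodule k V) (j : M →ₗ[k] Module.Dual k V) (n : ℕ) : Submodule k M :=
  (dualDegree 𝒱 n).comap j

theorem pairing_flip (j : M →ₗ[k] Module.Dual k U) (j' : N →ₗ[k] Module.Dual k V) (s : M ⊗[k] N)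
    (t : U ⊗[k] V) : pairing j.flip j'.flip t s = pairing j j' s t := by
  induction t with
  | zero => simp
  | add t t' ht ht' => simp only [map_add, LinearMap.add_apply, ht, ht']
  | tmul u v =>
    induction s with
    | zero => simp
    | add s s' hs hs' => simp only [map_add, LinearMap.add_apply, hs, hs']
    | tmul x y => rw [pairing_tmul, pairing_tmul]; rfl

namespace IsGradedDual
variable {𝒰 : ℕ → Submodule k U} {𝒱 : ℕ → Submodule k V} {ℛ : ℕ → Submodule k R}
  {i : L →ₗ[k] Module.Dual k U} {j : M →ₗ[k] Module.Dual k V} {l : N →ₗ[k] Module.Dual k R}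

theorem mem (hj : IsGradedDual 𝒱 j) (x : M) : j x ∈ gradedDual 𝒱 := by
  rw [← hj.range_eq]; exact LinearMap.mem_range_self j x

/-- A linear map to the dual of `V` whose values are in the graded dual, as a map to `M`. -/
def lift (hj : IsGradedDual 𝒱 j) (g : U →ₗ[k] Module.Dual k V) (hg : ∀ u, g u ∈ gradedDual 𝒱) : U →ₗ[k] M :=
  (LinearEquiv.ofInjective j hj.injective).symm.toLinearMap ∘ₗ
    LinearMap.codRestrict _ g fun u => by rw [hj.range_eq]; exact hg u

theorem apply_lift (hj : IsGradedDual 𝒱 j) (g : U →ₗ[k] Module.Dual k V)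
    (hg : ∀ u, g u ∈ gradedDual 𝒱) (u : U) :
    j (hj.lift g hg u) = g u :=
  LinearEquiv.ofInjective_symm_apply (f := j) (h := hj.injective) _

theorem comp_mem (q : DegreeProj 𝒱) (n : ℕ) (f : Module.Dual k V) :
    f ∘ₗ q.π n ∈ gradedDual 𝒱 :=
  ⟨n + 1, fun m hm v hv => by rw [LinearMap.comp_apply, q.of_ne (by omega) hv, map_zero]⟩

/-- The projection of `M` onto its part of degree `n`, dual to that of `V`. -/
def degree (hj : IsGradedDual 𝒱 j) (q : DegreeProj 𝒱) (n : ℕ) : M →ₗ[k] M :=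
  hj.lift (LinearMap.lcomp k k (q.π n) ∘ₗ j) fun x => comp_mem q n (j x)

theorem degree_apply (hj : IsGradedDual 𝒱 j) (q : DegreeProj 𝒱) (n : ℕ) (x : M) (v : V) :
    j (hj.degree q n x) v = j x (q.π n v) :=
  LinearMap.congr_fun (hj.apply_lift _ (fun x => comp_mem q n (j x)) x) v

theorem degree_mem (hj : IsGradedDual 𝒱 j) (q : DegreeProj 𝒱) (n : ℕ) (x : M) :
    hj.degree q n x ∈ dualGr 𝒱 j n := fun m hm v hv => by
  rw [degree_apply, q.of_ne hm.symm hv, map_zero]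

/-- The projections of `M` onto its homogeneous parts. -/
def proj (hj : IsGradedDual 𝒱 j) (q : DegreeProj 𝒱) : DegreeProj (dualGr 𝒱 j) where
  π := hj.degree q
  mem := hj.degree_mem q
  of_mem {n x} hx := by
    apply hj.injective
    apply LinearMap.ext
    refine q.induction (fun m v hv => ?_) (fun v w hv hw => by rw [map_add, map_add, hv, hw])
    rw [degree_apply]
    by_cases h : n = m
    · subst h; rw [q.of_mem hv]
    · rw [q.of_ne h hv, map_zero, hx m (Ne.symm h) v hv]
  of_ne {m n x} h hx := by
    apply hj.injective
    apply LinearMap.ext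
    intro v
    rw [degree_apply, map_zero]
    exact hx m h _ (q.mem m v)
  top := by
    rw [eq_top_iff]
    rintro x -
    obtain ⟨N, hN⟩ := hj.mem x
    have hx : x = ∑ n ∈ Finset.range N, hj.degree q n x := by
      apply hj.injective
      rw [map_sum]
      apply LinearMap.ext
      refine q.induction (fun m v hv => ?_) (fun v w hv hw => by rw [map_add, map_add, hv, hw])
      rw [LinearMap.sum_apply]
      simp_rw [degree_apply]
      rw [← map_sum]
      by_cases hm : m < N
      · rw [Finset.sum_eq_single_of_mem m (Finset.mem_range.2 hm)
          (fun n _ hn => q.of_ne hn hv), q.of_mem hv]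
      · rw [Finset.sum_eq_zero, map_zero, hN m (by omega) v hv]
        intro n hn
        exact q.of_ne (by rw [Finset.mem_range] at hn; omega) hv
    rw [hx]
    exact Submodule.sum_mem _ fun n _ => Submodule.mem_iSup_of_mem n (hj.degree_mem q n x)

theorem proj_apply (hj : IsGradedDual 𝒱 j) (q : DegreeProj 𝒱) (n : ℕ) (x : M) (v : V) :
    j ((hj.proj q).π n x) v = j x (q.π n v) := hj.degree_apply q n x v

/-- The graded dual separates points. -/
theorem eq_zero (hj : IsGradedDual 𝒱 j) (q : DegreeProj 𝒱) {v : V} (hv : ∀ x, j x v = 0) : v = 0 := by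
  obtain ⟨N, hN⟩ := q.exists_sum v
  rw [← hN N le_rfl]
  refine Finset.sum_eq_zero fun n _ => ?_
  rw [← Module.forall_dual_apply_eq_zero_iff k]
  intro f
  have hf : f ∘ₗ q.π n ∈ LinearMap.range j := by
    rw [hj.range_eq]
    exact comp_mem q n f
  obtain ⟨x, hx⟩ := hf
  have := hv x
  rwa [hx] at this

theorem flip_injective (hj : IsGradedDual 𝒱 j) (q : DegreeProj 𝒱) :
    Function.Injective j.flip := by
  rw [injective_iff_map_eq_zero]
  intro v hv
  exact hj.eq_zero q fun x => LinearMap.congr_fun hv x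

theorem tensor_ext (hi : IsGradedDual 𝒰 i) (hj : IsGradedDual 𝒱 j)
    (p : DegreeProj 𝒰) (q : DegreeProj 𝒱) {t t' : U ⊗[k] V}
    (h : ∀ x y, pairing i j (x ⊗ₜ y) t = pairing i j (x ⊗ₜ y) t') : t = t' := by
  apply pairing_injective _ _ (hi.flip_injective p) (hj.flip_injective q)
  apply TensorProduct.ext'
  intro x y
  rw [pairing_flip, pairing_flip, h]

theorem mem_tensorGr (hi : IsGradedDual 𝒰 i) (hj : IsGradedDual 𝒱 j)
    (p : DegreeProj 𝒰) (q : DegreeProj 𝒱) {t : U ⊗[k] V} {n : ℕ}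
    (h : ∀ a b, a + b ≠ n → ∀ x ∈ dualGr 𝒰 i a, ∀ y ∈ dualGr 𝒱 j b,
      pairing i j (x ⊗ₜ y) t = 0) : t ∈ tensorGr 𝒰 𝒱 n := by
  refine p.mem_tensorGr q fun a b hab => hi.tensor_ext hj p q fun x y => ?_
  have h1 : pairing i j (x ⊗ₜ y) (TensorProduct.map (p.π a) (q.π b) t) =
      pairing i j ((hi.proj p).π a x ⊗ₜ (hj.proj q).π b y) t := by
    clear h
    induction t with
    | zero => simp
    | add t u ht hu => simp only [map_add, ht, hu]
    | tmul u v => simp [proj_apply]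
  rw [h1, h a b hab _ ((hi.proj p).mem a x) _ ((hj.proj q).mem b y), map_zero]

theorem dual_mem_tensorGr (hi : IsGradedDual 𝒰 i) (hj : IsGradedDual 𝒱 j)
    (p : DegreeProj 𝒰) (q : DegreeProj 𝒱) {t : L ⊗[k] M} {n : ℕ}
    (h : ∀ a b, a + b ≠ n → ∀ u ∈ 𝒰 a, ∀ v ∈ 𝒱 b, pairing i j t (u ⊗ₜ v) = 0) :
    t ∈ tensorGr (dualGr 𝒰 i) (dualGr 𝒱 j) n := by
  refine (hi.proj p).mem_tensorGr (hj.proj q) fun a b hab => ?_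
  apply pairing_injective _ _ hi.injective hj.injective
  apply TensorProduct.ext'
  intro u v
  have h1 : pairing i j (TensorProduct.map ((hi.proj p).π a) ((hj.proj q).π b) t) (u ⊗ₜ v) =
      pairing i j t (p.π a u ⊗ₜ q.π b v) := by
    clear h
    induction t with
    | zero => simp
    | add t u ht hu => simp only [map_add, LinearMap.add_apply, ht, hu]
    | tmul x y => simp [proj_apply]
  rw [h1, h a b hab _ (p.mem a u) _ (q.mem b v), map_zero, LinearMap.zero_apply]

theorem pairing_eq_zero {x : L ⊗[k] M} {t : U ⊗[k] V} {m n : ℕ} (hmn : m ≠ n)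
    (hx : x ∈ tensorGr (dualGr 𝒰 i) (dualGr 𝒱 j) m) (ht : t ∈ tensorGr 𝒰 𝒱 n) :
    pairing i j x t = 0 := by
  induction ht using Submodule.span_induction with
  | mem t ht =>
    obtain ⟨a, b, rfl, u, hu, v, hv, rfl⟩ := ht
    induction hx using Submodule.span_induction with
    | mem x hx =>
      obtain ⟨c, d, rfl, y, hy, z, hz, rfl⟩ := hx
      rw [pairing_tmul]
      by_cases hac : a = c
      · rw [hz b (by omega) v hv, mul_zero]
      · rw [hy a hac u hu, zero_mul]
    | zero => simp
    | add x y _ _ hx hy => rw [map_add, LinearMap.add_apply, hx, hy, add_zero]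
    | smul c x _ hx => rw [map_smul, LinearMap.smul_apply, hx, smul_zero]
  | zero => simp
  | add x y _ _ hx hy => rw [map_add, hx, hy, add_zero]
  | smul c x _ hx => rw [map_smul, hx, smul_zero]

section pull
variable (hi : IsGradedDual 𝒰 i) (hj : IsGradedDual 𝒱 j) (hl : IsGradedDual ℛ l)
  (g : R →ₗ[k] U ⊗[k] V) (hg : ∀ n, ∀ r ∈ ℛ n, g r ∈ tensorGr 𝒰 𝒱 n)

theorem lcomp_mem (hi : IsGradedDual 𝒰 i) (hj : IsGradedDual 𝒱 j) (g : R →ₗ[k] U ⊗[k] V)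
    (hg : ∀ n, ∀ r ∈ ℛ n, g r ∈ tensorGr 𝒰 𝒱 n) (t : L ⊗[k] M) : pairing i j t ∘ₗ g ∈ gradedDual ℛ := by
  induction t with
  | zero => rw [map_zero, LinearMap.zero_comp]; exact Submodule.zero_mem _
  | add x y hx hy => rw [map_add, LinearMap.add_comp]; exact Submodule.add_mem _ hx hy
  | tmul x y =>
    obtain ⟨a, ha⟩ := hi.mem x
    obtain ⟨b, hb⟩ := hj.mem y
    refine ⟨a + b, fun n hn r hr => ?_⟩
    have ht := hg n r hr
    rw [LinearMap.comp_apply]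
    generalize g r = t at ht
    induction ht using Submodule.span_induction with
    | mem t ht =>
      obtain ⟨c, d, rfl, u, hu, v, hv, rfl⟩ := ht
      rw [pairing_tmul]
      by_cases hac : a ≤ c
      · rw [ha c hac u hu, zero_mul]
      · rw [hb d (by omega) v hv, mul_zero]
    | zero => simp
    | add x y _ _ hx hy => rw [map_add, hx, hy, add_zero]
    | smul c x _ hx => rw [map_smul, hx, smul_zero]

/-- The dual of a linear map `R → U ⊗ V` that preserves degrees. -/
def pull : L ⊗[k] M →ₗ[k] N :=
  hl.lift ((LinearMap.lcomp k k g) ∘ₗ pairing i j) (lcomp_mem hi hj g hg)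

theorem pull_apply (t : L ⊗[k] M) (r : R) :
    l (pull hi hj hl g hg t) r = pairing i j t (g r) :=
  LinearMap.congr_fun (hl.apply_lift _ _ _) r

theorem pull_mem {n : ℕ} {t : L ⊗[k] M} (ht : t ∈ tensorGr (dualGr 𝒰 i) (dualGr 𝒱 j) n) :
    pull hi hj hl g hg t ∈ dualGr ℛ l n := by
  intro m hm r hr
  rw [pull_apply]
  exact pairing_eq_zero hm.symm ht (hg m r hr)

end pull

/-- A family of homogeneous linear forms, finitely many in each degree, is the family of coordinates
of a linear map. -/
theorem exists_coordinates (q : DegreeProj 𝒱)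
    {ι : Type} (b : Module.Basis ι k U) (e : ι → M)
    (w : ι → ℕ) (hw : ∀ n, {a | w a = n}.Finite) (he : ∀ a, e a ∈ dualGr 𝒱 j (w a)) :
    ∃ g : V →ₗ[k] U, ∀ v a, b.repr (g v) a = j (e a) v := by
  have hfin (v : V) : (Function.support fun a => j (e a) v).Finite := by
    refine q.induction (C := fun v => (Function.support fun a => j (e a) v).Finite)
      (fun n v hv => ?_) (fun v v' h h' => ?_) v
    · refine (hw n).subset fun a ha => ?_
      by_contra hne
      exact ha (he a n (Ne.symm hne) v hv)
    · refine (h.union h').subset ?_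
      simp_rw [map_add]
      exact Function.support_add _ _
  refine ⟨b.repr.symm.toLinearMap ∘ₗ
    { toFun := fun v => Finsupp.ofSupportFinite (fun a => j (e a) v) (hfin v)
      map_add' := fun v w => Finsupp.ext fun a => map_add (j (e a)) v w
      map_smul' := fun c v => Finsupp.ext fun a => map_smul (j (e a)) c v }, fun v a => ?_⟩
  rw [LinearMap.comp_apply, LinearEquiv.coe_coe, LinearEquiv.apply_symm_apply]
  rfl

end IsGradedDual

/-- A vector space that is paired with an algebra `P`, without degeneracy on its side, and has a
diagonal and a counit dual to the product and the unit of `P` is a coalgebra. -/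
@[reducible] def coalgebraOfPairing {P : Type} [Ring P] [Algebra k P] (j : V →ₗ[k] Module.Dual k P)
    (hj : Function.Injective j) (Δ : V →ₗ[k] V ⊗[k] V) (ε : V →ₗ[k] k)
    (hΔ : ∀ v x y, pairing j j (Δ v) (x ⊗ₜ y) = j v (x * y)) (hε : ∀ v, ε v = j v 1) :
    Coalgebra k V where
  comul := Δ
  counit := ε
  coassoc := by
    apply LinearMap.ext
    intro v
    apply pairing_injective _ _ hj (pairing_injective _ _ hj hj)
    apply TensorProduct.ext
    apply LinearMap.ext
    intro x
    apply TensorProduct.ext'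
    intro y z
    have h1 (t : V ⊗[k] V) : pairing j (pairing j j) (Δ.lTensor V t) (x ⊗ₜ (y ⊗ₜ z)) =
        pairing j j t (x ⊗ₜ (y * z)) := by
      induction t with
      | zero => simp
      | add t u ht hu => simp only [map_add, LinearMap.add_apply, ht, hu]
      | tmul v w => rw [LinearMap.lTensor_tmul, pairing_tmul, pairing_tmul, hΔ]
    have h2 (t : (V ⊗[k] V) ⊗[k] V) : pairing j (pairing j j) (TensorProduct.assoc k V V V t)
        (x ⊗ₜ (y ⊗ₜ z)) = pairing (pairing j j) j t ((x ⊗ₜ y) ⊗ₜ z) := by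
      induction t with
      | zero => simp
      | add t u ht hu => simp only [map_add, LinearMap.add_apply, ht, hu]
      | tmul t w =>
        induction t with
        | zero => simp
        | add t u ht hu => simp only [TensorProduct.add_tmul, map_add, LinearMap.add_apply, ht, hu]
        | tmul u v => simp [mul_assoc]
    have h3 (t : V ⊗[k] V) : pairing (pairing j j) j (Δ.rTensor V t) ((x ⊗ₜ y) ⊗ₜ z) =
        pairing j j t ((x * y) ⊗ₜ z) := by
      induction t with
      | zero => simp
      | add t u ht hu => simp only [map_add, LinearMap.add_apply, ht, hu]
      | tmul v w => rw [LinearMap.rTensor_tmul, pairing_tmul, pairing_tmul, hΔ]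
    refine (h2 _).trans ((h3 _).trans ?_)
    refine Eq.trans ?_ (h1 _).symm
    rw [hΔ, hΔ, mul_assoc]
  rTensor_counit_comp_comul := by
    apply LinearMap.ext
    intro v
    apply (TensorProduct.lid k _).injective
    apply hj
    apply LinearMap.ext
    intro x
    have h (t : V ⊗[k] V) : j (TensorProduct.lid k _ (ε.rTensor _ t)) x =
        pairing j j t (1 ⊗ₜ x) := by
      induction t with
      | zero => simp
      | add t u ht hu => simp only [map_add, LinearMap.add_apply, ht, hu]
      | tmul v w => simp [hε]
    refine (h _).trans ?_
    rw [hΔ, one_mul]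
    simp
  lTensor_counit_comp_comul := by
    apply LinearMap.ext
    intro v
    apply (TensorProduct.rid k _).injective
    apply hj
    apply LinearMap.ext
    intro x
    have h (t : V ⊗[k] V) : j (TensorProduct.rid k _ (ε.lTensor _ t)) x =
        pairing j j t (x ⊗ₜ 1) := by
      induction t with
      | zero => simp
      | add t u ht hu => simp only [map_add, LinearMap.add_apply, ht, hu]
      | tmul v w => simp [hε, mul_comm]
    refine (h _).trans ?_
    rw [hΔ, mul_one]
    simp

end
end GradedAux

/-! ### The dual of the bicomodule of relations and of the symmetry operator -/

namespace SteenrodExt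
open AdemAux GradedAux
noncomputable section

theorem isGradedDual_evalA : IsGradedDual steenrodGr evalA where
  injective := evalA_injective
  range_eq := by
    apply le_antisymm
    · rintro _ ⟨x, rfl⟩; exact x.2
    · intro f hf; exact ⟨dualMk f hf, rfl⟩

theorem isGradedDual_evalR : IsGradedDual desuspGr evalR where
  injective := Subtype.val_injective
  range_eq := Submodule.range_subtype _

theorem dualRbar_ext {ρ σ : DualRbar} (h : ∀ r, evalR ρ r = evalR σ r) : ρ = σ :=
  Subtype.ext (LinearMap.ext h)

/-- The action of `A_*` on `DualRbar`, dual to the left coaction. -/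
def dualAction : DualSteenrod ⊗[ZMod 2] DualRbar →ₗ[ZMod 2] DualRbar :=
  isGradedDual_evalA.pull isGradedDual_evalR isGradedDual_evalR leftCoaction
    fun _ _ hr => leftCoaction_mem hr

theorem evalR_dualAction (t : DualSteenrod ⊗[ZMod 2] DualRbar) (r : Rbar) :
    evalR (dualAction t) r = pairing evalA evalR t (leftCoaction r) :=
  IsGradedDual.pull_apply _ _ _ _ _ t r

theorem pairing_one_leftCoaction (ρ : DualRbar) (r : Rbar) :
    pairing evalA evalR (1 ⊗ₜ ρ) (leftCoaction r) = evalR ρ r := by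
  have h (t : Steenrod ⊗[ZMod 2] Rbar) : pairing evalA evalR (1 ⊗ₜ ρ) t =
      evalR ρ (TensorProduct.lid (ZMod 2) Rbar (aug.toLinearMap.rTensor Rbar t)) := by
    induction t with
    | zero => simp
    | add t u ht hu => simp only [map_add, ht, hu]
    | tmul a r => simp [evalA_one]
  rw [h, leftCoaction_counit]
  simp

theorem pairing_mul_leftCoaction (x y : DualSteenrod) (ρ : DualRbar) (r : Rbar) :
    pairing evalA evalR ((x * y) ⊗ₜ ρ) (leftCoaction r) =
      pairing evalA evalR (x ⊗ₜ dualAction (y ⊗ₜ ρ)) (leftCoaction r) := by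
  have h1 (t : Steenrod ⊗[ZMod 2] Rbar) : pairing evalA evalR ((x * y) ⊗ₜ ρ) t =
      pairing evalA (pairing evalA evalR) (x ⊗ₜ (y ⊗ₜ ρ))
        (TensorProduct.assoc (ZMod 2) Steenrod Steenrod Rbar (diag.toLinearMap.rTensor Rbar t)) := by
    induction t with
    | zero => simp
    | add t u ht hu => simp only [map_add, ht, hu]
    | tmul a r =>
      rw [pairing_tmul, evalA_mul, LinearMap.rTensor_tmul, AlgHom.toLinearMap_apply]
      generalize diag a = u
      induction u with
      | zero => simp
      | add t u ht hu => simp only [map_add, TensorProduct.add_tmul, add_mul, ht, hu]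
      | tmul b c => simp [mul_assoc]
  have h2 (t : Steenrod ⊗[ZMod 2] Rbar) :
      pairing evalA evalR (x ⊗ₜ dualAction (y ⊗ₜ ρ)) t =
        pairing evalA (pairing evalA evalR) (x ⊗ₜ (y ⊗ₜ ρ)) (leftCoaction.lTensor Steenrod t) := by
    induction t with
    | zero => simp
    | add t u ht hu => simp only [map_add, ht, hu]
    | tmul a r => rw [pairing_tmul, evalR_dualAction, LinearMap.lTensor_tmul, pairing_tmul]
  rw [h1, leftCoaction_coassoc, h2]

instance : Module DualSteenrod DualRbar where
  smul x ρ := dualAction (x ⊗ₜ ρ)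
  one_smul ρ := dualRbar_ext fun r => by
    change evalR (dualAction (1 ⊗ₜ ρ)) r = _
    rw [evalR_dualAction, pairing_one_leftCoaction]
  mul_smul x y ρ := dualRbar_ext fun r => by
    change evalR (dualAction ((x * y) ⊗ₜ ρ)) r = evalR (dualAction (x ⊗ₜ dualAction (y ⊗ₜ ρ))) r
    rw [evalR_dualAction, evalR_dualAction, pairing_mul_leftCoaction]
  smul_zero x := by
    change dualAction (x ⊗ₜ 0) = 0
    rw [TensorProduct.tmul_zero, map_zero]
  smul_add x ρ σ := by
    change dualAction (x ⊗ₜ (ρ + σ)) = dualAction (x ⊗ₜ ρ) + dualAction (x ⊗ₜ σ)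
    rw [TensorProduct.tmul_add, map_add]
  add_smul x y ρ := by
    change dualAction ((x + y) ⊗ₜ ρ) = dualAction (x ⊗ₜ ρ) + dualAction (y ⊗ₜ ρ)
    rw [TensorProduct.add_tmul, map_add]
  zero_smul ρ := by
    change dualAction (0 ⊗ₜ ρ) = 0
    rw [TensorProduct.zero_tmul, map_zero]

theorem dualRbar_smul_def (x : DualSteenrod) (ρ : DualRbar) : x • ρ = dualAction (x ⊗ₜ ρ) := rfl

instance : IsScalarTower (ZMod 2) DualSteenrod DualRbar where
  smul_assoc c x ρ := by
    rw [dualRbar_smul_def, dualRbar_smul_def, ← TensorProduct.smul_tmul', map_smul]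

theorem evalR_smul (x : DualSteenrod) (ρ : DualRbar) (r : Rbar) :
    evalR (x • ρ) r = pairing evalA evalR (x ⊗ₜ ρ) (leftCoaction r) := evalR_dualAction _ r

theorem pairing_rightCoaction (x : DualSteenrod) (ρ : DualRbar) (r : Rbar) :
    pairing evalR evalA (ρ ⊗ₜ x) (rightCoaction r) = evalR (x • ρ) r := by
  rw [evalR_smul, ← comm_leftCoaction]
  generalize leftCoaction r = t
  induction t with
  | zero => simp
  | add t u ht hu => simp only [map_add, ht, hu]
  | tmul a r => simp [mul_comm]

theorem smul_mem_dualRbarGr {m n : ℕ} {x : DualSteenrod} {ρ : DualRbar} (hx : x ∈ dualSteenrodGr m)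
    (hρ : ρ ∈ dualRbarGr n) : x • ρ ∈ dualRbarGr (m + n) :=
  IsGradedDual.pull_mem _ _ _ _ _ (Submodule.subset_span ⟨m, n, rfl, x, hx, ρ, hρ, rfl⟩)

/-- The bilinear map on `A_*` dual to the symmetry operator. -/
def dualSym : DualSteenrod →ₗ[ZMod 2] DualSteenrod →ₗ[ZMod 2] DualRbar :=
  TensorProduct.curry (isGradedDual_evalA.pull isGradedDual_evalA isGradedDual_evalR symOp
    isSymmetryOperator_symOp.degree)

theorem evalR_dualSym (x y : DualSteenrod) (r : Rbar) :
    evalR (dualSym x y) r = pairing evalA evalA (x ⊗ₜ y) (symOp r) :=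
  isGradedDual_evalA.pull_apply isGradedDual_evalA isGradedDual_evalR symOp
    isSymmetryOperator_symOp.degree _ r

theorem dualSym_mem {m n : ℕ} {x y : DualSteenrod} (hx : x ∈ dualSteenrodGr m)
    (hy : y ∈ dualSteenrodGr n) : dualSym x y ∈ dualRbarGr (m + n) :=
  isGradedDual_evalA.pull_mem isGradedDual_evalA isGradedDual_evalR symOp
    isSymmetryOperator_symOp.degree (Submodule.subset_span ⟨m, n, rfl, x, hx, y, hy, rfl⟩)

theorem swap_symOp (r : Rbar) : swap (symOp r) = symOp r := by
  obtain ⟨r, rfl⟩ := rbarMk_surjective r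
  rw [symOp_mk, swap_freeSym]

theorem dualSym_comm (x y : DualSteenrod) : dualSym x y = dualSym y x := dualRbar_ext fun r => by
  rw [evalR_dualSym, evalR_dualSym, ← pairing_swap, swap_symOp]

theorem dualSym_xi_self (i : ℕ) : dualSym (xi (i + 1)) (xi (i + 1)) = 0 := dualRbar_ext fun r => by
  rw [evalR_dualSym]
  exact diagonalForm_xi_symOp i r

theorem dualSym_mul_left (x y z : DualSteenrod) :
    dualSym (x * y) z = x • dualSym y z + y • dualSym x z := dualRbar_ext fun r => by
  have h1 (t : Steenrod ⊗[ZMod 2] Steenrod) : pairing evalA evalA ((x * y) ⊗ₜ z) t =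
      pairing evalA (pairing evalA evalA) (x ⊗ₜ (y ⊗ₜ z)) (diagFst t) := by
    induction t with
    | zero => simp
    | add t u ht hu => simp only [map_add, ht, hu]
    | tmul a b =>
      change _ = pairing evalA (pairing evalA evalA) (x ⊗ₜ (y ⊗ₜ z))
        (TensorProduct.assoc (ZMod 2) Steenrod Steenrod Steenrod (diag a ⊗ₜ b))
      rw [pairing_tmul, evalA_mul]
      generalize diag a = u
      induction u with
      | zero => simp
      | add t u ht hu => simp only [map_add, TensorProduct.add_tmul, add_mul, ht, hu]
      | tmul b c => simp [mul_assoc]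
  have h2 (x y : DualSteenrod) (t : Steenrod ⊗[ZMod 2] Rbar) :
      pairing evalA (pairing evalA evalA) (x ⊗ₜ (y ⊗ₜ z)) (symOp.lTensor Steenrod t) =
        pairing evalA evalR (x ⊗ₜ dualSym y z) t := by
    induction t with
    | zero => simp
    | add t u ht hu => simp only [map_add, ht, hu]
    | tmul a r => rw [LinearMap.lTensor_tmul, pairing_tmul, pairing_tmul, evalR_dualSym]
  have h3 (t : Steenrod ⊗[ZMod 2] (Steenrod ⊗[ZMod 2] Steenrod)) :
      pairing evalA (pairing evalA evalA) (x ⊗ₜ (y ⊗ₜ z)) (swapFst t) =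
      pairing evalA (pairing evalA evalA) (y ⊗ₜ (x ⊗ₜ z)) t := by
    induction t with
    | zero => simp
    | add t u ht hu => simp only [map_add, ht, hu]
    | tmul a t =>
      induction t with
      | zero => simp
      | add t u ht hu => simp only [map_add, TensorProduct.tmul_add, ht, hu]
      | tmul b c => simp [mul_left_comm]
  rw [evalR_dualSym, h1, diagFst_symOp, map_add, h3, h2, h2, map_add, LinearMap.add_apply,
    evalR_smul, evalR_smul]

/-! ### Primitives of cocycles of the dual Steenrod algebra -/

theorem dualSteenrod_hom_ext {M : Type} [AddCommGroup M] [Module (ZMod 2) M]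
    {f g : DualSteenrod →ₗ[ZMod 2] M} (h : ∀ R, f (xiPow R) = g (xiPow R)) : f = g := by
  apply LinearMap.ext
  refine (isGradedDual_evalA.proj steenrodProj).induction (fun n x hx => ?_)
    (fun x y hx hy => by rw [map_add, map_add, hx, hy])
  have hx' := dualSteenrodGr_le n hx
  clear hx
  induction hx' using Submodule.span_induction with
  | mem x hx => obtain ⟨R, -, rfl⟩ := hx; exact h R
  | zero => simp
  | add x y _ _ hx hy => rw [map_add, map_add, hx, hy]
  | smul c x _ hx => rw [map_smul, map_smul, hx]

section primitive
variable {M : Type} [AddCommGroup M] [Module (ZMod 2) M] [Module DualSteenrod M]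

theorem derivation_eq_zero (V : DualSteenrod →ₗ[ZMod 2] M)
    (hV : ∀ x y, V (x * y) = x • V y + y • V x) (h : ∀ i, V (xi (i + 1)) = 0) : V = 0 := by
  refine dualSteenrod_hom_ext fun R => ?_
  rw [LinearMap.zero_apply]
  refine xi_induction (C := fun R => V (xiPow R) = 0) ?_ (fun j => ?_) (fun R S hR hS => ?_) R
  · have := hV 1 1
    rw [mul_one, one_smul] at this
    rw [xiPow_zero]
    exact left_eq_add.1 this
  · rw [xiPow_single_one, h]
  · rw [xiPow_add, hV, hR, hS, smul_zero, smul_zero, add_zero]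

/-- A symmetric cocycle that preserves degrees bounds a cochain that preserves degrees and has
arbitrary homogeneous values on the generators `ξ_(i+1)`. -/
theorem exists_graded_primitive [IsScalarTower (ZMod 2) DualSteenrod M]
    (ℳ : ℕ → Submodule (ZMod 2) M)
    (hℳ : ∀ m n x v, x ∈ dualSteenrodGr m → v ∈ ℳ n → x • v ∈ ℳ (m + n))
    (c : TwoCocycle (ZMod 2) DualSteenrod M) (hc : ∀ x y, c.map x y = c.map y x)
    (hcℳ : ∀ m n x y, x ∈ dualSteenrodGr m → y ∈ dualSteenrodGr n → c.map x y ∈ ℳ (m + n))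
    (e : ℕ → M) (he : ∀ i, e i ∈ ℳ (2 ^ (i + 1) - 1)) :
    ∃ V : DualSteenrod →ₗ[ZMod 2] M, (∀ i, V (xi (i + 1)) = e i) ∧
      (∀ x y, V (x * y) = x • V y + y • V x + c.map x y) ∧
      ∀ n, ∀ x ∈ dualSteenrodGr n, V x ∈ ℳ n := by
  obtain ⟨V, hVX, hV⟩ := c.exists_primitive xiEquiv hc e
  have hxi (i : ℕ) : V (xi (i + 1)) = e i := by rw [← hVX, xiEquiv_X]
  have hpow (R : ℕ →₀ ℕ) : V (xiPow R) ∈ ℳ (xiWeight R) := by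
    refine xi_induction (C := fun R => V (xiPow R) ∈ ℳ (xiWeight R)) ?_ (fun j => ?_)
      (fun R S hR hS => ?_) R
    · rw [xiPow_zero, map_zero]
      -- In characteristic two the cocycle formula at `(1, 1)` reads `V 1 = c (1, 1)`.
      have h := hV 1 1
      rw [mul_one, one_smul, ZModModule.add_self, zero_add] at h
      rw [h]
      exact hcℳ 0 0 1 1 dualSteenrodGr_one_mem dualSteenrodGr_one_mem
    · rw [xiPow_single_one, xiWeight_single_one, hxi]
      exact he j
    · rw [xiPow_add, map_add, hV]
      refine Submodule.add_mem _ (Submodule.add_mem _ (hℳ _ _ _ _ (xiPow_mem R) hS) ?_)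
        (hcℳ _ _ _ _ (xiPow_mem R) (xiPow_mem S))
      rw [add_comm]
      exact hℳ _ _ _ _ (xiPow_mem S) hR
  refine ⟨V, hxi, hV, fun n x hx => ?_⟩
  have hx' := dualSteenrodGr_le n hx
  clear hx
  induction hx' using Submodule.span_induction with
  | mem x hx => obtain ⟨R, rfl, rfl⟩ := hx; exact hpow R
  | zero => rw [map_zero]; exact Submodule.zero_mem _
  | add x y _ _ hx hy => rw [map_add]; exact Submodule.add_mem _ hx hy
  | smul c x _ hx => rw [map_smul]; exact Submodule.smul_mem _ _ hx

end primitive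

end
end SteenrodExt

namespace SteenrodExt
open AdemAux GradedAux
noncomputable section

/-- A linear map `A_* → DualRbar` that preserves degrees is dual to a linear map `Rbar → A`. -/
theorem exists_predual (V : DualSteenrod →ₗ[ZMod 2] DualRbar)
    (hV : ∀ n, ∀ x ∈ dualSteenrodGr n, V x ∈ dualRbarGr n) :
    ∃ g : Rbar →ₗ[ZMod 2] Steenrod, (∀ x r, evalA x (g r) = evalR (V x) r) ∧
      ∀ n, ∀ r ∈ desuspGr n, g r ∈ steenrodGr n := by
  obtain ⟨g, hg⟩ := IsGradedDual.exists_coordinates (j := evalR) desuspProj milnorBasis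
    (fun R => V (xiPow R)) xiWeight finite_xiWeight (fun R => hV _ _ (xiPow_mem R))
  have h (x : DualSteenrod) (r : Rbar) : evalA x (g r) = evalR (V x) r := by
    have : evalA.flip (g r) = evalR.flip r ∘ₗ V := dualSteenrod_hom_ext fun R => hg r R
    exact LinearMap.congr_fun this x
  refine ⟨g, h, fun n r hr => steenrodProj.mem_of_forall fun m hm =>
    isGradedDual_evalA.eq_zero steenrodProj fun x => ?_⟩
  rw [← isGradedDual_evalA.degree_apply steenrodProj m x, h]
  exact hV m _ (isGradedDual_evalA.degree_mem steenrodProj m x) n hm.symm r hr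

/-- A bilinear map on `A_*` with values in `DualRbar` that preserves degrees is dual to a linear map
`Rbar → A ⊗ A`. -/
theorem exists_predual₂ (U : DualSteenrod →ₗ[ZMod 2] DualSteenrod →ₗ[ZMod 2] DualRbar)
    (hU : ∀ m n x y, x ∈ dualSteenrodGr m → y ∈ dualSteenrodGr n → U x y ∈ dualRbarGr (m + n)) :
    ∃ g : Rbar →ₗ[ZMod 2] Steenrod ⊗[ZMod 2] Steenrod,
      (∀ x y r, pairing evalA evalA (x ⊗ₜ y) (g r) = evalR (U x y) r) ∧
      ∀ n, ∀ r ∈ desuspGr n, g r ∈ tensorGr steenrodGr steenrodGr n := by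
  have hfin (n : ℕ) : {a : (ℕ →₀ ℕ) × (ℕ →₀ ℕ) | xiWeight a.1 + xiWeight a.2 = n}.Finite := by
    have h (n : ℕ) : {R | xiWeight R ≤ n}.Finite := by
      have : {R | xiWeight R ≤ n} = ⋃ m : Fin (n + 1), {R | xiWeight R = m} := by
        ext R
        simp only [Set.mem_ofPred_eq, Set.mem_iUnion]
        exact ⟨fun hR => ⟨⟨xiWeight R, by omega⟩, rfl⟩, fun ⟨m, hm⟩ => by omega⟩
      rw [this]
      exact Set.finite_iUnion fun m => finite_xiWeight m
    refine ((h n).prod (h n)).subset fun a ha => ?_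
    simp only [Set.mem_prod, Set.mem_ofPred_eq] at ha ⊢
    omega
  obtain ⟨g, hg⟩ := IsGradedDual.exists_coordinates (j := evalR) desuspProj
    (milnorBasis.tensorProduct milnorBasis) (fun a => U (xiPow a.1) (xiPow a.2))
    (fun a => xiWeight a.1 + xiWeight a.2) hfin
    (fun a => hU _ _ _ _ (xiPow_mem a.1) (xiPow_mem a.2))
  have hrepr (R S : ℕ →₀ ℕ) (t : Steenrod ⊗[ZMod 2] Steenrod) :
      (milnorBasis.tensorProduct milnorBasis).repr t (R, S) =
        pairing evalA evalA (xiPow R ⊗ₜ xiPow S) t := by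
    induction t with
    | zero => simp
    | add t u ht hu => simp only [map_add, Finsupp.add_apply, ht, hu]
    | tmul a b =>
      rw [Module.Basis.tensorProduct_repr_tmul_apply, pairing_tmul, milnorBasis_repr,
        milnorBasis_repr, smul_eq_mul, mul_comm]
  have h (x y : DualSteenrod) (r : Rbar) :
      pairing evalA evalA (x ⊗ₜ y) (g r) = evalR (U x y) r := by
    have h1 : ((pairing evalA evalA).flip (g r) ∘ₗ (TensorProduct.mk (ZMod 2) _ _).flip y) =
        evalR.flip r ∘ₗ U.flip y := dualSteenrod_hom_ext fun R => by
      have h2 : ((pairing evalA evalA).flip (g r) ∘ₗ (TensorProduct.mk (ZMod 2) _ _) (xiPow R)) =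
          evalR.flip r ∘ₗ U (xiPow R) := dualSteenrod_hom_ext fun S =>
        (hrepr R S (g r)).symm.trans (hg r (R, S))
      exact LinearMap.congr_fun h2 y
    exact LinearMap.congr_fun h1 x
  refine ⟨g, h, fun n r hr => isGradedDual_evalA.mem_tensorGr isGradedDual_evalA steenrodProj
    steenrodProj fun a b hab x hx y hy => ?_⟩
  rw [h]
  exact hU a b x y hx hy n (Ne.symm hab) r hr

/-! ### A biderivation whose symmetrization is dual to the symmetry operator -/

/-- The biderivation with value `S_* (ξ_i ⊗ ξ_j)` on the generators `ξ_i` and `ξ_j` for `i < j`, and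
zero for `i ≥ j`; its symmetrization is `S_*`, because `S_*` is alternating on the generators. -/
theorem exists_biderivation :
    ∃ U : DualSteenrod →ₗ[ZMod 2] DualSteenrod →ₗ[ZMod 2] DualRbar,
      (∀ x y z, U (x * y) z = x • U y z + y • U x z) ∧
      (∀ x y z, U x (y * z) = y • U x z + z • U x y) ∧
      (∀ x y, U x y + U y x = dualSym x y) ∧
      ∀ m n x y, x ∈ dualSteenrodGr m → y ∈ dualSteenrodGr n → U x y ∈ dualRbarGr (m + n) := by
  have hD (i : ℕ) : ∃ D : DualSteenrod →ₗ[ZMod 2] DualRbar,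
      (∀ j, D (xi (j + 1)) = if i < j then dualSym (xi (i + 1)) (xi (j + 1)) else 0) ∧
      (∀ x y, D (x * y) = x • D y + y • D x) ∧
      ∀ n, ∀ x ∈ dualSteenrodGr n, D x ∈ dualRbarGr (2 ^ (i + 1) - 1 + n) := by
    obtain ⟨D, h1, h2, h3⟩ := exists_graded_primitive
      (fun n => dualRbarGr (2 ^ (i + 1) - 1 + n))
      (fun m n x v hx hv => by
        rw [← add_assoc, add_comm _ m, add_assoc]; exact smul_mem_dualRbarGr hx hv)
      ⟨0, fun x y z => by simp⟩ (fun _ _ => rfl) (fun _ _ _ _ _ _ => Submodule.zero_mem _)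
      (fun j => if i < j then dualSym (xi (i + 1)) (xi (j + 1)) else 0)
      (fun j => by
        split_ifs
        · exact dualSym_mem (xi_mem (i + 1)) (xi_mem (j + 1))
        · exact Submodule.zero_mem _)
    exact ⟨D, h1, fun x y => (h2 x y).trans (add_zero _), h3⟩
  choose D hDxi hDmul hDmem using hD
  let ℳ (m : ℕ) : Submodule (ZMod 2) (DualSteenrod →ₗ[ZMod 2] DualRbar) :=
    { carrier := {f | ∀ n, ∀ x ∈ dualSteenrodGr n, f x ∈ dualRbarGr (m + n)}
      zero_mem' := fun _ _ _ => Submodule.zero_mem _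
      add_mem' := fun hf hg n x hx => Submodule.add_mem _ (hf n x hx) (hg n x hx)
      smul_mem' := fun c f hf n x hx => Submodule.smul_mem _ c (hf n x hx) }
  -- `U` is itself a derivation, with values in linear maps and with `U ξ_(i+1) = D i`.
  obtain ⟨U, hUxi, hUmul, hUmem⟩ := exists_graded_primitive ℳ
    (fun m n x f hx hf l y hy => by
      rw [LinearMap.smul_apply, add_assoc]
      exact smul_mem_dualRbarGr hx (hf l y hy))
    ⟨0, fun x y z => by simp⟩ (fun _ _ => rfl) (fun _ _ _ _ _ _ => Submodule.zero_mem _) D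
    (fun i n x hx => hDmem i n x hx)
  have hleft (x y z) : U (x * y) z = x • U y z + y • U x z :=
    (LinearMap.congr_fun (hUmul x y) z).trans (add_zero _)
  have hright (x y z) : U x (y * z) = y • U x z + z • U x y := by
    let E : DualSteenrod →ₗ[ZMod 2] DualRbar := U.flip (y * z) - (y • U.flip z + z • U.flip y)
    have hE : E = 0 := by
      refine derivation_eq_zero E (fun a b => ?_) (fun i => ?_)
      · simp only [E, LinearMap.sub_apply, LinearMap.add_apply, LinearMap.smul_apply,
          LinearMap.flip_apply, hleft, smul_add, smul_sub, smul_comm y, smul_comm z]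
        abel
      · simp only [E, LinearMap.sub_apply, LinearMap.add_apply, LinearMap.smul_apply,
          LinearMap.flip_apply, hUxi, hDmul, sub_self]
    exact sub_eq_zero.1 (LinearMap.congr_fun hE x)
  refine ⟨U, hleft, hright, fun x y => ?_, fun m n x y hx hy => hUmem m x hx n y hy⟩
  have hS (x y z) : dualSym x (y * z) = y • dualSym x z + z • dualSym x y := by
    rw [dualSym_comm, dualSym_mul_left, dualSym_comm z, dualSym_comm y]
  -- The difference of the symmetrization of `U` and `S_*` is a biderivation that vanishes on pairs
  -- of generators.
  let F : DualSteenrod →ₗ[ZMod 2] DualSteenrod →ₗ[ZMod 2] DualRbar := U + U.flip - dualSym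
  have hF : F = 0 := by
    refine derivation_eq_zero F (fun a b => LinearMap.ext fun z => ?_) (fun i => ?_)
    · simp only [F, LinearMap.add_apply, LinearMap.sub_apply, LinearMap.smul_apply,
        LinearMap.flip_apply, hleft, hright, dualSym_mul_left, smul_add, smul_sub]
      abel
    · refine derivation_eq_zero _ (fun a b => ?_) (fun j => ?_)
      · simp only [F, LinearMap.add_apply, LinearMap.sub_apply, LinearMap.flip_apply, hleft, hright,
          hS, smul_add, smul_sub]
        abel
      · simp only [F, LinearMap.add_apply, LinearMap.sub_apply, LinearMap.flip_apply, hUxi, hDxi]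
        rcases lt_trichotomy i j with h | rfl | h
        · rw [if_pos h, if_neg (by omega), add_zero, sub_self]
        · simp [dualSym_xi_self]
        · rw [if_neg (by omega), if_pos h, zero_add, dualSym_comm, sub_self]
  exact sub_eq_zero.1 (LinearMap.congr_fun (LinearMap.congr_fun hF x) y)

end
end SteenrodExt

/-! ### Singular extensions as direct sum diagrams -/

namespace GradedAux
noncomputable section

section general
variable {k : Type} [Field k]

theorem exists_algEquiv {C D : Type} [Ring C] [Algebra k C] [Ring D] [Algebra k D] (e : C ≃ₗ[k] D)
    (h : ∀ x y, e (x * y) = e x * e y) : ∃ f : C ≃ₐ[k] D, ∀ x, f x = e x := by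
  refine ⟨AlgEquiv.ofLinearEquiv e ?_ h, fun _ => rfl⟩
  obtain ⟨u, hu⟩ := e.surjective 1
  have h1 := h 1 u
  rw [one_mul, hu, mul_one] at h1
  exact h1.symm

/-- A linear isomorphism that is compatible with the diagonals is compatible with the counits, because
a counit is determined by the diagonal. -/
theorem exists_coalgEquiv {C D : Type} [AddCommGroup C] [Module k C] [Coalgebra k C]
    [AddCommGroup D] [Module k D] [Coalgebra k D] (e : C ≃ₗ[k] D)
    (h : ∀ x, TensorProduct.map e.toLinearMap e.toLinearMap (Coalgebra.comul (R := k) x) =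
      Coalgebra.comul (R := k) (e x)) : ∃ f : C ≃ₗc[k] D, ∀ x, f x = e x := by
  have hc (x : C) : Coalgebra.counit (R := k) (e x) = Coalgebra.counit (R := k) x := by
    let ε : C →ₗ[k] k := Coalgebra.counit
    let ε' : D →ₗ[k] k := Coalgebra.counit
    let m : C ⊗[k] C →ₗ[k] k := LinearMap.mul' k k ∘ₗ TensorProduct.map ε (ε' ∘ₗ e.toLinearMap)
    have h1 (t : C ⊗[k] C) : m t = ε' (e (TensorProduct.lid k C (ε.rTensor C t))) := by
      induction t with
      | zero => simp
      | add t u ht hu => simp only [map_add, ht, hu]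
      | tmul x y => simp [m]
    have h2 (t : C ⊗[k] C) : m t = ε (e.symm (TensorProduct.rid k D (ε'.lTensor D
        (TensorProduct.map e.toLinearMap e.toLinearMap t)))) := by
      induction t with
      | zero => simp
      | add t u ht hu => simp only [map_add, ht, hu]
      | tmul x y => simp [m, mul_comm]
    have h3 := (h1 (Coalgebra.comul (R := k) x)).symm.trans (h2 _)
    rw [h, Coalgebra.rTensor_counit_comul, Coalgebra.lTensor_counit_comul] at h3
    simpa using h3
  exact ⟨{ e with
    counit_comp := LinearMap.ext hc
    map_comp_comul := LinearMap.ext h }, fun _ => rfl⟩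

end general

namespace SingularHopfExtension
variable {k A R : Type} [Field k] [Ring A] [Algebra k A] [Coalgebra k A] [AddCommGroup R]
  [Module k R] {𝒜 : ℕ → Submodule k A} {ℛ : ℕ → Submodule k R}
  (E E' : SingularHopfExtension k A R 𝒜 ℛ)

theorem p_i (r : R) : E.p (E.i r) = 0 := by
  have h := E.s_p_add_i_q (E.i r)
  rw [E.q_i, add_eq_right] at h
  rw [← E.p_s (E.p (E.i r)), h, map_zero]

theorem q_s (a : A) : E.q (E.s a) = 0 := by
  have h := E.s_p_add_i_q (E.s a)
  rw [E.p_s, add_eq_left] at h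
  rw [← E.q_i (E.q (E.s a)), h, map_zero]

theorem p_comp_s : E.p.toLinearMap ∘ₗ E.s.toLinearMap = LinearMap.id := LinearMap.ext E.p_s

/-- The decomposition of `Â` as the direct sum of `A` and `R`. -/
def coords : E.carrier ≃ₗ[k] A × R :=
  LinearEquiv.ofLinearMap (E.p.toLinearMap.prod E.q) (E.s.toLinearMap.coprod E.i)
    (LinearMap.ext fun x => Prod.ext
      (by
        change E.p (E.s x.1 + E.i x.2) = x.1
        rw [map_add, E.p_s, E.p_i, add_zero])
      (by
        change E.q (E.s x.1 + E.i x.2) = x.2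
        rw [map_add, E.q_s, E.q_i, zero_add]))
    (LinearMap.ext fun x => E.s_p_add_i_q x)

variable {E} in
theorem ext {x y : E.carrier} (hp : E.p x = E.p y) (hq : E.q x = E.q y) : x = y :=
  E.coords.injective (Prod.ext hp hq)

theorem mem_gr {n : ℕ} {x : E.carrier} : x ∈ E.gr n ↔ E.p x ∈ 𝒜 n ∧ E.q x ∈ ℛ n := by
  constructor
  · intro h
    obtain ⟨_, ⟨a, ha, rfl⟩, _, ⟨r, hr, rfl⟩, rfl⟩ := Submodule.mem_sup.1 h
    change E.p (E.s a + E.i r) ∈ _ ∧ E.q (E.s a + E.i r) ∈ _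
    rw [map_add, map_add, E.p_s, E.p_i, E.q_s, E.q_i, add_zero, zero_add]
    exact ⟨ha, hr⟩
  · rintro ⟨h1, h2⟩
    rw [← E.s_p_add_i_q x]
    exact Submodule.add_mem_sup ⟨_, h1, rfl⟩ ⟨_, h2, rfl⟩

theorem s_mem {n : ℕ} {a : A} (ha : a ∈ 𝒜 n) : E.s a ∈ E.gr n :=
  Submodule.mem_sup_left ⟨a, ha, rfl⟩

theorem i_mem {n : ℕ} {r : R} (hr : r ∈ ℛ n) : E.i r ∈ E.gr n :=
  Submodule.mem_sup_right ⟨r, hr, rfl⟩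

theorem comul_s (a : A) : Coalgebra.comul (R := k) (E.s a) =
    TensorProduct.map E.s.toLinearMap E.s.toLinearMap (Coalgebra.comul (R := k) a) :=
  (LinearMap.congr_fun E.s.map_comp_comul a).symm

/-- The isomorphism of direct sum diagrams. -/
def canonical : E.carrier ≃ₗ[k] E'.carrier := E.coords.trans E'.coords.symm

theorem canonical_apply (x : E.carrier) : E.canonical E' x = E'.s (E.p x) + E'.i (E.q x) := rfl

theorem canonical_s (a : A) : E.canonical E' (E.s a) = E'.s a := by
  rw [canonical_apply, E.p_s, E.q_s, map_zero, add_zero]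

theorem canonical_i (r : R) : E.canonical E' (E.i r) = E'.i r := by
  rw [canonical_apply, E.p_i, E.q_i, map_zero, zero_add]

theorem p_canonical (x : E.carrier) : E'.p (E.canonical E' x) = E.p x := by
  rw [canonical_apply, map_add, E'.p_s, E'.p_i, add_zero]

theorem q_canonical (x : E.carrier) : E'.q (E.canonical E' x) = E.q x := by
  rw [canonical_apply, map_add, E'.q_s, E'.q_i, zero_add]

variable {E E'}

theorem sameAlgebra_of_map_mul
    (h : ∀ x y, E.canonical E' (x * y) = E.canonical E' x * E.canonical E' y) :
    E.SameAlgebra E' := by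
  obtain ⟨θ, hθ⟩ := exists_algEquiv _ h
  refine ⟨θ, fun r => ?_, fun a => ?_, fun x => ?_, fun x => ?_⟩
  · rw [hθ, canonical_i]
  · rw [hθ, canonical_s]
  · rw [hθ, p_canonical]
  · rw [hθ, q_canonical]

theorem sameCoalgebra_of_map_comul
    (h : ∀ x, TensorProduct.map (E.canonical E').toLinearMap (E.canonical E').toLinearMap
      (Coalgebra.comul (R := k) x) = Coalgebra.comul (R := k) (E.canonical E' x)) :
    E.SameCoalgebra E' := by
  obtain ⟨θ, hθ⟩ := exists_coalgEquiv _ h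
  refine ⟨θ, fun r => ?_, fun a => ?_, fun x => ?_, fun x => ?_⟩
  · rw [hθ, canonical_i]
  · rw [hθ, canonical_s]
  · rw [hθ, p_canonical]
  · rw [hθ, q_canonical]

end SingularHopfExtension

end
end GradedAux

/-! ### Products of pairs -/

namespace GradedAux
noncomputable section

/-- The values of two bilinear maps with the same symmetrization differ by a symmetric bilinear
map. -/
theorem add_comm_of_symmetrization {k B M : Type} [CommRing k] [AddCommGroup B] [Module k B]
    [AddCommGroup M] [Module k M] (h2 : ∀ m : M, m + m = 0) {c c' s : B →ₗ[k] B →ₗ[k] M}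
    (h : ∀ x y, c x y + c y x = s x y) (h' : ∀ x y, c' x y + c' y x = s x y) (x y : B) :
    (c + c') x y = (c + c') y x := by
  simp only [LinearMap.add_apply]
  have e := (h x y).trans (h' x y).symm
  have e2 : c x y = c' x y + c' y x + c y x := by
    rw [← e, add_assoc, h2, add_zero]
  rw [e2, ← add_zero (c y x + c' y x), ← h2 (c' x y)]
  abel

variable {k B M : Type} [CommRing k] [CommRing B] [Algebra k B] [AddCommGroup M] [Module k M]
  [Module B M]

/-- The product `(x, m) (y, n) = (x y, x n + y m + c (x, y))` on `B × M`, for a bilinear map `c` that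
is not required to be a cocycle. -/
def pairMul (c : B →ₗ[k] B →ₗ[k] M) (u v : B × M) : B × M :=
  (u.1 * v.1, u.1 • v.2 + v.1 • u.2 + c u.1 v.1)

/-- The map `c` is a cocycle when the product is associative. -/
theorem cocycle_of_pairMul_assoc {c : B →ₗ[k] B →ₗ[k] M}
    (h : ∀ u v w, pairMul c (pairMul c u v) w = pairMul c u (pairMul c v w)) (x y z : B) :
    x • c y z + c x (y * z) = c (x * y) z + z • c x y := by
  have h2 := congrArg Prod.snd (h (x, 0) (y, 0) (z, 0))
  simp only [pairMul, smul_zero, zero_add] at h2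
  rw [add_zero] at h2
  rw [← h2, add_comm]

/-- A cochain `V` whose coboundary is `c + c'` defines an isomorphism between the products of `c'`
and of `c`, in characteristic two. -/
theorem pairMul_shear (h2 : ∀ m : M, m + m = 0) {c c' : B →ₗ[k] B →ₗ[k] M} {V : B →ₗ[k] M}
    (hV : ∀ x y, V (x * y) = x • V y + y • V x + (c + c') x y) (u v : B × M) :
    pairMul c (u.1, u.2 + V u.1) (v.1, v.2 + V v.1) =
      ((pairMul c' u v).1, (pairMul c' u v).2 + V (pairMul c' u v).1) := by
  refine Prod.ext rfl ?_
  simp only [pairMul, hV, smul_add, LinearMap.add_apply]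
  have h := h2 (c' u.1 v.1)
  generalize c' u.1 v.1 = a at h ⊢
  rw [← add_zero (_ + _ + c u.1 v.1), ← h]
  abel

/-- The sum of two cocycles. -/
def TwoCocycle.add (c c' : TwoCocycle k B M) : TwoCocycle k B M where
  map := c.map + c'.map
  cocycle x y z := by
    have h := c.cocycle x y z
    have h' := c'.cocycle x y z
    simp only [LinearMap.add_apply, smul_add]
    rw [add_add_add_comm, h, h', add_add_add_comm]

end
end GradedAux

/-! ### The dual of the extended Steenrod algebra as a ring -/

namespace SteenrodExt
open AdemAux GradedAux
noncomputable section

/-- The pairing of `A_* × DualRbar` with `A × Rbar`. -/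
def prodEval : DualSteenrod × DualRbar →ₗ[ZMod 2] Module.Dual (ZMod 2) (Steenrod × Rbar) :=
  LinearMap.coprod (LinearMap.lcomp (ZMod 2) (ZMod 2) (LinearMap.fst (ZMod 2) Steenrod Rbar) ∘ₗ evalA)
    (LinearMap.lcomp (ZMod 2) (ZMod 2) (LinearMap.snd (ZMod 2) Steenrod Rbar) ∘ₗ evalR)

theorem prodEval_apply (u : DualSteenrod × DualRbar) (v : Steenrod × Rbar) :
    prodEval u v = evalA u.1 v.1 + evalR u.2 v.2 := rfl

theorem prodEval_injective : Function.Injective prodEval := by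
  intro u u' h
  refine Prod.ext (dual_ext fun a => ?_) (dualRbar_ext fun r => ?_)
  · have := LinearMap.congr_fun h (a, 0)
    simpa [prodEval_apply] using this
  · have := LinearMap.congr_fun h (0, r)
    simpa [prodEval_apply] using this

theorem prodEval_flip_injective : Function.Injective prodEval.flip := by
  rw [injective_iff_map_eq_zero]
  intro v hv
  refine Prod.ext (isGradedDual_evalA.eq_zero steenrodProj fun x => ?_)
    (isGradedDual_evalR.eq_zero desuspProj fun ρ => ?_)
  · have := LinearMap.congr_fun hv (x, 0)
    simpa [prodEval_apply] using this
  · have := LinearMap.congr_fun hv (0, ρ)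
    simpa [prodEval_apply] using this

theorem pairing_comp_tmul {U V U' V' : Type} [AddCommGroup U] [Module (ZMod 2) U]
    [AddCommGroup V] [Module (ZMod 2) V] [AddCommGroup U'] [Module (ZMod 2) U']
    [AddCommGroup V'] [Module (ZMod 2) V'] {M N M' N' : Type} [AddCommMonoid M] [Module (ZMod 2) M]
    [AddCommMonoid N] [Module (ZMod 2) N] [AddCommMonoid M'] [Module (ZMod 2) M']
    [AddCommMonoid N'] [Module (ZMod 2) N']
    (j : M →ₗ[ZMod 2] Module.Dual (ZMod 2) U) (l : N →ₗ[ZMod 2] Module.Dual (ZMod 2) V)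
    (j' : M' →ₗ[ZMod 2] Module.Dual (ZMod 2) U') (l' : N' →ₗ[ZMod 2] Module.Dual (ZMod 2) V')
    (f : U →ₗ[ZMod 2] U') (g : V →ₗ[ZMod 2] V') (x : M) (y : N) (x' : M') (y' : N')
    (hx : ∀ u, j' x' (f u) = j x u) (hy : ∀ v, l' y' (g v) = l y v) (t : U ⊗[ZMod 2] V) :
    pairing j' l' (x' ⊗ₜ y') (TensorProduct.map f g t) = pairing j l (x ⊗ₜ y) t := by
  induction t with
  | zero => simp
  | add t u ht hu => simp only [map_add, ht, hu]
  | tmul u v => rw [TensorProduct.map_tmul, pairing_tmul, pairing_tmul, hx, hy]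

theorem pairing_comp {U V U' V' : Type} [AddCommGroup U] [Module (ZMod 2) U]
    [AddCommGroup V] [Module (ZMod 2) V] [AddCommGroup U'] [Module (ZMod 2) U']
    [AddCommGroup V'] [Module (ZMod 2) V'] {M N M' N' : Type} [AddCommMonoid M] [Module (ZMod 2) M]
    [AddCommMonoid N] [Module (ZMod 2) N] [AddCommMonoid M'] [Module (ZMod 2) M']
    [AddCommMonoid N'] [Module (ZMod 2) N']
    (j : M →ₗ[ZMod 2] Module.Dual (ZMod 2) U) (l : N →ₗ[ZMod 2] Module.Dual (ZMod 2) V)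
    (j' : M' →ₗ[ZMod 2] Module.Dual (ZMod 2) U') (l' : N' →ₗ[ZMod 2] Module.Dual (ZMod 2) V')
    (f : M →ₗ[ZMod 2] M') (g : N →ₗ[ZMod 2] N') (u' : U') (v' : V') (u : U) (v : V)
    (hx : ∀ x, j' (f x) u' = j x u) (hy : ∀ y, l' (g y) v' = l y v) (t : M ⊗[ZMod 2] N) :
    pairing j' l' (TensorProduct.map f g t) (u' ⊗ₜ v') = pairing j l t (u ⊗ₜ v) := by
  induction t with
  | zero => simp
  | add t u ht hu => simp only [map_add, LinearMap.add_apply, ht, hu]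
  | tmul x y => rw [TensorProduct.map_tmul, pairing_tmul, pairing_tmul, hx, hy]

theorem smul_mem_desuspGr {m n : ℕ} {a : Steenrod} {r : Rbar} (ha : a ∈ steenrodGr m)
    (hr : r ∈ desuspGr n) : a • r ∈ desuspGr (m + n) := by
  obtain ⟨f, hf, rfl⟩ := ha
  obtain ⟨⟨g, hgR⟩, hg, rfl⟩ := hr
  refine ⟨⟨f * g, mul_mem_RF_left f hgR⟩, ?_, (proj_smul f ⟨g, hgR⟩).symm⟩
  change f * g ∈ freeGr (m + n + 1)
  rw [add_assoc]
  exact freeGr_mul_mem hf hg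

theorem op_smul_mem_desuspGr {m n : ℕ} {a : Steenrod} {r : Rbar} (ha : a ∈ steenrodGr m)
    (hr : r ∈ desuspGr n) : MulOpposite.op a • r ∈ desuspGr (m + n) := by
  obtain ⟨f, hf, rfl⟩ := ha
  obtain ⟨⟨g, hgR⟩, hg, rfl⟩ := hr
  refine ⟨⟨g * f, mul_mem_RF_right hgR f⟩, ?_, (op_proj_smul f ⟨g, hgR⟩).symm⟩
  change g * f ∈ freeGr (m + n + 1)
  rw [add_assoc, add_comm]
  exact freeGr_mul_mem hg hf

instance : IsScalarTower (ZMod 2) Steenrod Rbar where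
  smul_assoc c a r := by
    change leftAction (c • a) r = c • leftAction a r
    rw [map_smul, LinearMap.smul_apply]

instance : IsScalarTower (ZMod 2) Steenrodᵐᵒᵖ Rbar where
  smul_assoc c a r := by
    change (rightAction (c • a).unop).unop r = c • (rightAction a.unop).unop r
    rw [MulOpposite.unop_smul, map_smul, MulOpposite.unop_smul, LinearMap.smul_apply]

theorem rightCoaction_mem {n : ℕ} {r : Rbar} (hr : r ∈ desuspGr n) :
    rightCoaction r ∈ tensorGr desuspGr steenrodGr n := by
  rw [← comm_leftCoaction]
  have h := leftCoaction_mem hr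
  generalize leftCoaction r = t at h
  induction h using Submodule.span_induction with
  | mem t ht =>
    obtain ⟨a, b, hab, u, hu, v, hv, rfl⟩ := ht
    exact Submodule.subset_span ⟨b, a, by omega, v, hv, u, hu, rfl⟩
  | zero => rw [map_zero]; exact Submodule.zero_mem _
  | add x y _ _ hx hy => rw [map_add]; exact Submodule.add_mem _ hx hy
  | smul c x _ hx => rw [map_smul]; exact Submodule.smul_mem _ _ hx

/-! ### Existence of the extended Steenrod algebra -/

/-- The diagonal on `A × Rbar` with component `g : Rbar → A ⊗ A`. -/
def extComul (g : Rbar →ₗ[ZMod 2] Steenrod ⊗[ZMod 2] Steenrod) :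
    Steenrod × Rbar →ₗ[ZMod 2] (Steenrod × Rbar) ⊗[ZMod 2] (Steenrod × Rbar) :=
  TensorProduct.map (LinearMap.inl (ZMod 2) Steenrod Rbar) (LinearMap.inl (ZMod 2) Steenrod Rbar) ∘ₗ
    LinearMap.coprod diag.toLinearMap g +
  TensorProduct.map (LinearMap.inl (ZMod 2) Steenrod Rbar) (LinearMap.inr (ZMod 2) Steenrod Rbar) ∘ₗ
    leftCoaction ∘ₗ LinearMap.snd (ZMod 2) Steenrod Rbar +
  TensorProduct.map (LinearMap.inr (ZMod 2) Steenrod Rbar) (LinearMap.inl (ZMod 2) Steenrod Rbar) ∘ₗ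
    rightCoaction ∘ₗ LinearMap.snd (ZMod 2) Steenrod Rbar

theorem extComul_apply (g : Rbar →ₗ[ZMod 2] Steenrod ⊗[ZMod 2] Steenrod) (v : Steenrod × Rbar) :
    extComul g v =
      TensorProduct.map (LinearMap.inl (ZMod 2) Steenrod Rbar)
        (LinearMap.inl (ZMod 2) Steenrod Rbar) (diag v.1 + g v.2) +
      TensorProduct.map (LinearMap.inl (ZMod 2) Steenrod Rbar)
        (LinearMap.inr (ZMod 2) Steenrod Rbar) (leftCoaction v.2) +
      TensorProduct.map (LinearMap.inr (ZMod 2) Steenrod Rbar)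
        (LinearMap.inl (ZMod 2) Steenrod Rbar) (rightCoaction v.2) := rfl

theorem pairing_extComul {g : Rbar →ₗ[ZMod 2] Steenrod ⊗[ZMod 2] Steenrod}
    {U : DualSteenrod →ₗ[ZMod 2] DualSteenrod →ₗ[ZMod 2] DualRbar}
    (hg : ∀ x y r, pairing evalA evalA (x ⊗ₜ y) (g r) = evalR (U x y) r)
    (u u' : DualSteenrod × DualRbar) (v : Steenrod × Rbar) :
    pairing prodEval prodEval (u ⊗ₜ u') (extComul g v) = prodEval (pairMul U u u') v := by
  have hl (u : DualSteenrod × DualRbar) (a : Steenrod) :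
      prodEval u (LinearMap.inl (ZMod 2) Steenrod Rbar a) = evalA u.1 a := by
    simp [prodEval_apply]
  have hr (u : DualSteenrod × DualRbar) (r : Rbar) :
      prodEval u (LinearMap.inr (ZMod 2) Steenrod Rbar r) = evalR u.2 r := by
    simp [prodEval_apply]
  rw [extComul_apply, map_add, map_add,
    pairing_comp_tmul evalA evalA prodEval prodEval _ _ u.1 u'.1 u u' (hl u) (hl u'),
    pairing_comp_tmul evalA evalR prodEval prodEval _ _ u.1 u'.2 u u' (hl u) (hr u'),
    pairing_comp_tmul evalR evalA prodEval prodEval _ _ u.2 u'.1 u u' (hr u) (hl u'),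
    map_add, hg, ← evalA_mul, ← evalR_smul, pairing_rightCoaction, prodEval_apply]
  simp only [pairMul, map_add, LinearMap.add_apply]
  abel

theorem exists_extendedSteenrod : ∃ E : SteenrodExtension, IsExtendedSteenrod symOp E := by
  obtain ⟨U, hUl, hUr, hUS, hUmem⟩ := exists_biderivation
  obtain ⟨g, hg, hgmem⟩ := exists_predual₂ U hUmem
  let c : TwoCocycle (ZMod 2) DualSteenrod DualRbar :=
    ⟨U, fun x y z => by rw [hUl, hUr]; abel⟩
  have hc1 : U 1 1 = 0 := by
    have := hUl 1 1 1
    rw [mul_one, one_smul] at this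
    exact left_eq_add.1 this
  have hone : CocycleExt.snd c 1 = 0 := by
    rw [CocycleExt.snd_one]
    exact neg_eq_zero.2 hc1
  let j : Steenrod × Rbar →ₗ[ZMod 2] Module.Dual (ZMod 2) (CocycleExt c) := prodEval.flip
  -- The coalgebra axioms hold because `j` embeds the extension in the dual of an associative ring,
  -- with the diagonal adjoint to the product.
  let P := TrivSqZeroExt Steenrod Rbar
  let coalg : Coalgebra (ZMod 2) P := coalgebraOfPairing (V := P) j prodEval_flip_injective
    (extComul g) (aug.toLinearMap ∘ₗ LinearMap.fst (ZMod 2) Steenrod Rbar)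
    (fun v x y => (pairing_flip prodEval prodEval (x ⊗ₜ y) (extComul g v)).trans
      (pairing_extComul hg x y v))
    (fun v => by
      change aug v.1 = evalA (CocycleExt.fst c 1) v.1 + evalR (CocycleExt.snd c 1) v.2
      rw [hone, CocycleExt.fst_one, map_zero, LinearMap.zero_apply, add_zero, evalA_one])
  let incl : Steenrod →ₗ[ZMod 2] P := LinearMap.inl (ZMod 2) Steenrod Rbar
  let incr : Rbar →ₗ[ZMod 2] P := LinearMap.inr (ZMod 2) Steenrod Rbar
  let pr : P →ₗ[ZMod 2] Rbar := LinearMap.snd (ZMod 2) Steenrod Rbar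
  have hpl : pr ∘ₗ incl = 0 := rfl
  have hpr : pr ∘ₗ incr = LinearMap.id := rfl
  have hcomul (v : P) : Coalgebra.comul (R := ZMod 2) v =
      TensorProduct.map incl incl (diag (TrivSqZeroExt.fst v) + g (pr v)) +
      TensorProduct.map incl incr (leftCoaction (pr v)) +
      TensorProduct.map incr incl (rightCoaction (pr v)) := rfl
  have hgr {n : ℕ} {v : P} : v ∈ (steenrodGr n).map incl ⊔ (desuspGr n).map incr ↔
      TrivSqZeroExt.fst v ∈ steenrodGr n ∧ pr v ∈ desuspGr n := by
    constructor
    · intro h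
      obtain ⟨_, ⟨a, ha, rfl⟩, _, ⟨r, hr, rfl⟩, rfl⟩ := Submodule.mem_sup.1 h
      change a + 0 ∈ _ ∧ 0 + r ∈ _
      rw [add_zero, zero_add]
      exact ⟨ha, hr⟩
    · rintro ⟨h1, h2⟩
      exact Submodule.mem_sup.2 ⟨incl (TrivSqZeroExt.fst v), ⟨_, h1, rfl⟩, incr (pr v),
        ⟨_, h2, rfl⟩, TrivSqZeroExt.ext (add_zero _) (zero_add _)⟩
  have hinl {n : ℕ} : ∀ a ∈ steenrodGr n,
      incl a ∈ (steenrodGr n).map incl ⊔ (desuspGr n).map incr :=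
    fun a ha => Submodule.mem_sup_left ⟨a, ha, rfl⟩
  have hinr {n : ℕ} : ∀ r ∈ desuspGr n,
      incr r ∈ (steenrodGr n).map incl ⊔ (desuspGr n).map incr :=
    fun r hr => Submodule.mem_sup_right ⟨r, hr, rfl⟩
  let E : SteenrodExtension :=
    { carrier := P
      coalgebra := coalg
      i := incr
      p := TrivSqZeroExt.fstHom (ZMod 2) Steenrod Rbar
      q := pr
      s :=
        { incl with
          counit_comp := rfl
          map_comp_comul := LinearMap.ext fun a => by
            change TensorProduct.map incl incl (diag a) =
              TensorProduct.map incl incl (diag a + g 0) +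
              TensorProduct.map incl incr (leftCoaction 0) +
              TensorProduct.map incr incl (rightCoaction 0)
            simp only [map_zero, add_zero] }
      p_s := fun _ => rfl
      q_i := fun _ => rfl
      s_p_add_i_q := fun v => TrivSqZeroExt.ext (add_zero _) (zero_add _)
      i_mul_i := fun r r' => TrivSqZeroExt.inr_mul_inr Steenrod r r'
      q_comul := fun v => by
        rw [hcomul, map_add, map_add, TensorProduct.map_map, TensorProduct.map_map,
          TensorProduct.map_map, hpl]
        simp
      mul_mem := fun m n x y hx hy => by
        rw [hgr] at hx hy
        refine hgr.2 ⟨steenrodGr_mul_mem hx.1 hy.1, Submodule.add_mem _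
          (smul_mem_desuspGr hx.1 hy.2) ?_⟩
        rw [add_comm m n]
        exact op_smul_mem_desuspGr hy.1 hx.2
      comul_mem := fun n v hv => by
        rw [hgr] at hv
        rw [hcomul]
        exact Submodule.add_mem _ (Submodule.add_mem _
          (map_tensorGr (fun _ => hinl) (fun _ => hinl)
            (Submodule.add_mem _ (diag_mem hv.1) (hgmem n _ hv.2)))
          (map_tensorGr (fun _ => hinl) (fun _ => hinr) (leftCoaction_mem hv.2)))
          (map_tensorGr (fun _ => hinr) (fun _ => hinl) (rightCoaction_mem hv.2)) }
  have hlT (t : P ⊗[ZMod 2] P) : pr.lTensor P t = TensorProduct.map LinearMap.id pr t := rfl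
  have hrT (t : P ⊗[ZMod 2] P) : pr.rTensor P t = TensorProduct.map pr LinearMap.id t := rfl
  refine ⟨E, ⟨fun x y => rfl, fun x r => ?_, fun r x => ?_, fun v => ?_, fun v => ?_, fun v => ?_⟩⟩
  · refine TrivSqZeroExt.ext (mul_zero _) ?_
    change TrivSqZeroExt.fst x • r + MulOpposite.op (0 : Steenrod) • pr x = TrivSqZeroExt.fst x • r
    rw [MulOpposite.op_zero, zero_smul, add_zero]
  · refine TrivSqZeroExt.ext (zero_mul _) ?_
    change (0 : Steenrod) • pr x + MulOpposite.op (TrivSqZeroExt.fst x) • r = _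
    rw [zero_smul, zero_add]
    rfl
  · change pr.lTensor P (Coalgebra.comul (R := ZMod 2) v) =
      incl.rTensor Rbar (leftCoaction (pr v))
    rw [hcomul, hlT, map_add, map_add, TensorProduct.map_map, TensorProduct.map_map,
      TensorProduct.map_map, hpl, hpr]
    simp [LinearMap.rTensor]
  · change pr.rTensor P (Coalgebra.comul (R := ZMod 2) v) =
      incl.lTensor Rbar (rightCoaction (pr v))
    rw [hcomul, hrT, map_add, map_add, TensorProduct.map_map, TensorProduct.map_map,
      TensorProduct.map_map, hpl, hpr]
    simp [LinearMap.lTensor]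
  · change oneAddT (Coalgebra.comul (R := ZMod 2) v) = TensorProduct.map incl incl (symOp (pr v))
    have hT {U V : Type} [AddCommGroup U] [Module (ZMod 2) U] [AddCommGroup V] [Module (ZMod 2) V]
        (f : U →ₗ[ZMod 2] P) (f' : V →ₗ[ZMod 2] P) (t : U ⊗[ZMod 2] V) :
        TensorProduct.comm (ZMod 2) P P (TensorProduct.map f f' t) =
          TensorProduct.map f' f (TensorProduct.comm (ZMod 2) U V t) := by
      induction t with
      | zero => simp
      | add x y hx hy => simp only [map_add, hx, hy]
      | tmul a b => rfl
    have hcr (r : Rbar) : TensorProduct.comm (ZMod 2) Rbar Steenrod (rightCoaction r) =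
        leftCoaction r := by
      rw [← comm_leftCoaction]; simp
    -- On `A ⊗ A` the symmetrization of `g` is dual to that of `U`; the coactions are interchanged by
    -- `T`, so that they contribute nothing.
    have hsym : g (pr v) + swap (g (pr v)) = symOp (pr v) :=
      isGradedDual_evalA.tensor_ext isGradedDual_evalA steenrodProj steenrodProj fun x y => by
        rw [map_add, pairing_swap, hg, hg, ← evalR_dualSym, ← hUS, map_add, LinearMap.add_apply]
    have hadd (t : P ⊗[ZMod 2] P) : oneAddT t = t + TensorProduct.comm (ZMod 2) P P t := rfl
    have hsw (t : Steenrod ⊗[ZMod 2] Steenrod) :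
        TensorProduct.comm (ZMod 2) Steenrod Steenrod t = swap t := rfl
    rw [hadd, hcomul]
    simp only [map_add, hT]
    rw [comm_leftCoaction, hcr, hsw, hsw, swap_diag, ← hsym, map_add]
    have h2 (z : P ⊗[ZMod 2] P) : z + z = 0 := ZModModule.add_self z
    generalize TensorProduct.map incl incl (diag (TrivSqZeroExt.fst v)) = z1
    generalize TensorProduct.map incl incr (leftCoaction (pr v)) = z2
    generalize TensorProduct.map incr incl (rightCoaction (pr v)) = z3
    generalize TensorProduct.map incl incl (g (pr v)) = z4
    generalize TensorProduct.map incl incl (swap (g (pr v))) = z5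
    have : z1 + z4 + z2 + z3 + (z1 + z5 + z3 + z2) =
      (z1 + z1) + (z2 + z2) + (z3 + z3) + (z4 + z5) := by abel
    rw [this, h2 z1, h2 z2, h2 z3]
    simp

end
end SteenrodExt

/-! ### Uniqueness of the extended Steenrod algebra -/

namespace GradedAux
noncomputable section

/-- A product on a space of linear forms on a coalgebra that is dual to the diagonal is
associative. -/
theorem mul_assoc_of_pairing {k C M : Type} [Field k] [AddCommGroup C] [Module k C] [Coalgebra k C]
    [AddCommGroup M] [Module k M] (j : M →ₗ[k] Module.Dual k C) (hj : Function.Injective j)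
    (mul : M → M → M)
    (h : ∀ x y v, pairing j j (x ⊗ₜ y) (Coalgebra.comul (R := k) v) = j (mul x y) v) (x y z : M) :
    mul (mul x y) z = mul x (mul y z) := by
  have hp (x y : M) (t : C ⊗[k] C) : pairing j j (x ⊗ₜ y) t =
      LinearMap.mul' k k (TensorProduct.map (j x) (j y) t) := by
    induction t with
    | zero => simp
    | add t u ht hu => simp only [map_add, ht, hu]
    | tmul u v => simp
  have hm (x y : M) : WithConv.toConv (j (mul x y)) =
      WithConv.toConv (j x) * WithConv.toConv (j y) := by
    rw [LinearMap.convMul_def]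
    refine congrArg WithConv.toConv (LinearMap.ext fun v => ?_)
    rw [← h, hp]
    rfl
  apply hj
  apply WithConv.toConv_injective
  rw [hm, hm, hm, hm, mul_assoc]

theorem tensor_ext_of_flip_injective {k U V M N : Type} [Field k] [AddCommGroup U] [Module k U]
    [AddCommGroup V] [Module k V] [AddCommGroup M] [Module k M] [AddCommGroup N] [Module k N]
    (j : M →ₗ[k] Module.Dual k U) (j' : N →ₗ[k] Module.Dual k V) (hj : Function.Injective j.flip)
    (hj' : Function.Injective j'.flip) {t t' : U ⊗[k] V}
    (h : ∀ x y, pairing j j' (x ⊗ₜ y) t = pairing j j' (x ⊗ₜ y) t') : t = t' := by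
  apply pairing_injective _ _ hj hj'
  apply TensorProduct.ext'
  intro x y
  rw [pairing_flip, pairing_flip, h]

namespace SingularHopfExtension
variable {k A R : Type} [Field k] [Ring A] [Algebra k A] [Coalgebra k A] [AddCommGroup R]
  [Module k R] {𝒜 : ℕ → Submodule k A} {ℛ : ℕ → Submodule k R}
  (E E' : SingularHopfExtension k A R 𝒜 ℛ)

theorem exists_shear_p (g : R →ₗ[k] A) : ∃ e : E.carrier ≃ₗ[k] E'.carrier,
    (∀ v, E'.p (e v) = E.p v + g (E.q v)) ∧ ∀ v, E'.q (e v) = E.q v := by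
  let sh (g : R →ₗ[k] A) : A × R →ₗ[k] A × R :=
    LinearMap.id + LinearMap.inl k A R ∘ₗ g ∘ₗ LinearMap.snd k A R
  have hsh (g : R →ₗ[k] A) (v) : sh g v = (v.1 + g v.2, v.2) := Prod.ext rfl (add_zero _)
  let e₀ : (A × R) ≃ₗ[k] (A × R) := LinearEquiv.ofLinearMap (sh g) (sh (-g))
    (LinearMap.ext fun v => by simp [hsh]) (LinearMap.ext fun v => by simp [hsh])
  have h (v : E.carrier) : E'.coords (((E.coords.trans e₀).trans E'.coords.symm) v) =
      (E.p v + g (E.q v), E.q v) := by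
    change E'.coords (E'.coords.symm (sh g (E.coords v))) = _
    rw [LinearEquiv.apply_symm_apply, hsh]
    rfl
  exact ⟨_, fun v => congrArg Prod.fst (h v), fun v => congrArg Prod.snd (h v)⟩

theorem exists_shear_q (f : A →ₗ[k] R) : ∃ e : E.carrier ≃ₗ[k] E'.carrier,
    (∀ v, E'.p (e v) = E.p v) ∧ ∀ v, E'.q (e v) = E.q v + f (E.p v) := by
  let sh (f : A →ₗ[k] R) : A × R →ₗ[k] A × R :=
    LinearMap.id + LinearMap.inr k A R ∘ₗ f ∘ₗ LinearMap.fst k A R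
  have hsh (f : A →ₗ[k] R) (v) : sh f v = (v.1, v.2 + f v.1) := Prod.ext (add_zero _) rfl
  let e₀ : (A × R) ≃ₗ[k] (A × R) := LinearEquiv.ofLinearMap (sh f) (sh (-f))
    (LinearMap.ext fun v => by simp [hsh]) (LinearMap.ext fun v => by simp [hsh])
  have h (v : E.carrier) : E'.coords (((E.coords.trans e₀).trans E'.coords.symm) v) =
      (E.p v, E.q v + f (E.p v)) := by
    change E'.coords (E'.coords.symm (sh f (E.coords v))) = _
    rw [LinearEquiv.apply_symm_apply, hsh]
    rfl
  exact ⟨_, fun v => congrArg Prod.fst (h v), fun v => congrArg Prod.snd (h v)⟩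

theorem comul_eq (v : E.carrier) : Coalgebra.comul (R := k) v =
    TensorProduct.map E.s.toLinearMap E.s.toLinearMap (Coalgebra.comul (R := k) (E.p v)) +
      Coalgebra.comul (R := k) (E.i (E.q v)) := by
  rw [← E.comul_s, ← map_add, E.s_p_add_i_q]

end SingularHopfExtension

end
end GradedAux

namespace SteenrodExt
open AdemAux GradedAux
noncomputable section

theorem dualRbar_add_self (ρ : DualRbar) : ρ + ρ = 0 := ZModModule.add_self ρ

section
variable (E : SteenrodExtension)

/-- The elements of `A_* × DualRbar` as linear forms on an extension of `A` by `Rbar`. -/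
def extEval : DualSteenrod × DualRbar →ₗ[ZMod 2] Module.Dual (ZMod 2) E.carrier :=
  LinearMap.lcomp (ZMod 2) (ZMod 2) E.coords.toLinearMap ∘ₗ prodEval

theorem extEval_apply (u : DualSteenrod × DualRbar) (v : E.carrier) :
    extEval E u v = evalA u.1 (E.p v) + evalR u.2 (E.q v) := rfl

theorem extEval_injective : Function.Injective (extEval E) := by
  intro u u' h
  refine prodEval_injective (LinearMap.ext fun v => ?_)
  have := LinearMap.congr_fun h (E.coords.symm v)
  change prodEval u (E.coords (E.coords.symm v)) = prodEval u' (E.coords (E.coords.symm v)) at this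
  rwa [LinearEquiv.apply_symm_apply] at this

theorem extEval_flip_injective : Function.Injective (extEval E).flip := by
  intro v w h
  exact E.coords.injective (prodEval_flip_injective (LinearMap.ext fun u => LinearMap.congr_fun h u))

/-- The component `Rbar → A ⊗ A` of the diagonal of an extension. -/
def mixedComul : Rbar →ₗ[ZMod 2] Steenrod ⊗[ZMod 2] Steenrod :=
  TensorProduct.map E.p.toLinearMap E.p.toLinearMap ∘ₗ Coalgebra.comul (R := ZMod 2) ∘ₗ E.i

theorem mixedComul_apply (r : Rbar) : mixedComul E r =
    TensorProduct.map E.p.toLinearMap E.p.toLinearMap (Coalgebra.comul (R := ZMod 2) (E.i r)) := rfl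

theorem mixedComul_mem (n : ℕ) (r : Rbar) (hr : r ∈ desuspGr n) :
    mixedComul E r ∈ tensorGr steenrodGr steenrodGr n :=
  map_tensorGr (fun _ _ h => (E.mem_gr.1 h).1) (fun _ _ h => (E.mem_gr.1 h).1)
    (E.comul_mem n _ (E.i_mem hr))

/-- The bilinear map on `A_*` dual to `mixedComul`. -/
def mixedMul : DualSteenrod →ₗ[ZMod 2] DualSteenrod →ₗ[ZMod 2] DualRbar :=
  TensorProduct.curry (isGradedDual_evalA.pull isGradedDual_evalA isGradedDual_evalR (mixedComul E)
    (mixedComul_mem E))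

theorem evalR_mixedMul (x y : DualSteenrod) (r : Rbar) :
    evalR (mixedMul E x y) r = pairing evalA evalA (x ⊗ₜ y) (mixedComul E r) :=
  isGradedDual_evalA.pull_apply isGradedDual_evalA isGradedDual_evalR (mixedComul E)
    (mixedComul_mem E) _ r

theorem mixedMul_mem {m n : ℕ} {x y : DualSteenrod} (hx : x ∈ dualSteenrodGr m)
    (hy : y ∈ dualSteenrodGr n) : mixedMul E x y ∈ dualRbarGr (m + n) :=
  isGradedDual_evalA.pull_mem isGradedDual_evalA isGradedDual_evalR (mixedComul E)
    (mixedComul_mem E) (Submodule.subset_span ⟨m, n, rfl, x, hx, y, hy, rfl⟩)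

theorem pairing_extEval (u u' : DualSteenrod × DualRbar) (t : E.carrier ⊗[ZMod 2] E.carrier) :
    pairing (extEval E) (extEval E) (u ⊗ₜ u') t =
      pairing evalA evalA (u.1 ⊗ₜ u'.1) (TensorProduct.map E.p.toLinearMap E.p.toLinearMap t) +
      pairing evalA evalR (u.1 ⊗ₜ u'.2) (TensorProduct.map E.p.toLinearMap E.q t) +
      pairing evalR evalA (u.2 ⊗ₜ u'.1) (TensorProduct.map E.q E.p.toLinearMap t) +
      pairing evalR evalR (u.2 ⊗ₜ u'.2) (TensorProduct.map E.q E.q t) := by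
  induction t with
  | zero => simp
  | add t w ht hw => simp only [map_add, ht, hw]; abel
  | tmul v w =>
    simp only [TensorProduct.map_tmul, pairing_tmul, extEval_apply, AlgHom.toLinearMap_apply]
    ring

variable {E} {S : Rbar →ₗ[ZMod 2] Steenrod ⊗[ZMod 2] Steenrod}

theorem map_p_p_comul (v : E.carrier) : TensorProduct.map E.p.toLinearMap E.p.toLinearMap
    (Coalgebra.comul (R := ZMod 2) v) = diag (E.p v) + mixedComul E (E.q v) := by
  rw [E.comul_eq, map_add, TensorProduct.map_map, E.p_comp_s, TensorProduct.map_id,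
    mixedComul_apply]
  rfl

theorem IsExtendedSteenrod.map_p_q_comul (h : IsExtendedSteenrod S E) (v : E.carrier) :
    TensorProduct.map E.p.toLinearMap E.q (Coalgebra.comul (R := ZMod 2) v) =
      leftCoaction (E.q v) := by
  have h1 := congrArg (TensorProduct.map E.p.toLinearMap LinearMap.id) (h.left_coaction v)
  rw [LinearMap.lTensor, LinearMap.rTensor, TensorProduct.map_map, TensorProduct.map_map,
    E.p_comp_s, LinearMap.id_comp, LinearMap.comp_id, LinearMap.id_comp, TensorProduct.map_id] at h1
  exact h1

theorem IsExtendedSteenrod.map_q_p_comul (h : IsExtendedSteenrod S E) (v : E.carrier) :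
    TensorProduct.map E.q E.p.toLinearMap (Coalgebra.comul (R := ZMod 2) v) =
      rightCoaction (E.q v) := by
  have h1 := congrArg (TensorProduct.map LinearMap.id E.p.toLinearMap) (h.right_coaction v)
  rw [LinearMap.lTensor, LinearMap.rTensor, TensorProduct.map_map, TensorProduct.map_map,
    E.p_comp_s, LinearMap.id_comp, LinearMap.comp_id, LinearMap.id_comp, TensorProduct.map_id] at h1
  exact h1

/-- The product on `A_* × DualRbar` dual to the diagonal of the extension. -/
theorem IsExtendedSteenrod.pairing_comul (h : IsExtendedSteenrod S E)
    (u u' : DualSteenrod × DualRbar) (v : E.carrier) :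
    pairing (extEval E) (extEval E) (u ⊗ₜ u') (Coalgebra.comul (R := ZMod 2) v) =
      extEval E (pairMul (mixedMul E) u u') v := by
  rw [pairing_extEval, map_p_p_comul, h.map_p_q_comul, h.map_q_p_comul, E.q_comul, map_zero,
    map_add, ← evalR_mixedMul, ← evalA_mul, ← evalR_smul, pairing_rightCoaction, extEval_apply]
  simp only [pairMul, map_add, LinearMap.add_apply]
  abel

theorem IsExtendedSteenrod.pairMul_assoc (h : IsExtendedSteenrod S E)
    (u v w : DualSteenrod × DualRbar) : pairMul (mixedMul E) (pairMul (mixedMul E) u v) w =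
      pairMul (mixedMul E) u (pairMul (mixedMul E) v w) := by
  apply mul_assoc_of_pairing (extEval E) (extEval_injective E) (pairMul (mixedMul E))
  intro x y v
  exact h.pairing_comul x y v

/-- The cocycle that describes the diagonal of the extension. -/
def IsExtendedSteenrod.cocycle (h : IsExtendedSteenrod S E) :
    TwoCocycle (ZMod 2) DualSteenrod DualRbar where
  map := mixedMul E
  cocycle := cocycle_of_pairMul_assoc h.pairMul_assoc

theorem IsExtendedSteenrod.mixedMul_add_swap (h : IsExtendedSteenrod symOp E) (x y : DualSteenrod) :
    mixedMul E x y + mixedMul E y x = dualSym x y := dualRbar_ext fun r => by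
  have h1 := congrArg (TensorProduct.map E.p.toLinearMap E.p.toLinearMap) (h.symmetry (E.i r))
  rw [TensorProduct.map_map, E.p_comp_s, TensorProduct.map_id, E.q_i] at h1
  have hc (t : E.carrier ⊗[ZMod 2] E.carrier) :
      TensorProduct.map E.p.toLinearMap E.p.toLinearMap (oneAddT t) =
        TensorProduct.map E.p.toLinearMap E.p.toLinearMap t +
          swap (TensorProduct.map E.p.toLinearMap E.p.toLinearMap t) := by
    induction t with
    | zero => simp
    | add t w ht hw => simp only [map_add, ht, hw]; abel
    | tmul v w => rfl
  rw [hc, ← mixedComul_apply] at h1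
  rw [map_add, LinearMap.add_apply, evalR_mixedMul, evalR_mixedMul, evalR_dualSym,
    ← pairing_swap x y (mixedComul E r), ← map_add, h1]
  rfl

end

variable {E E' : SteenrodExtension}

theorem IsExtendedSteenrod.sameAlgebra {S : Rbar →ₗ[ZMod 2] Steenrod ⊗[ZMod 2] Steenrod}
    (h : IsExtendedSteenrod S E) (h' : IsExtendedSteenrod S E') : E.SameAlgebra E' := by
  refine SingularHopfExtension.sameAlgebra_of_map_mul fun x y =>
    SingularHopfExtension.ext ?_ ?_
  · rw [E.p_canonical, map_mul, map_mul, E.p_canonical, E.p_canonical]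
  · rw [h'.q_mul, E.p_canonical, E.p_canonical, E.q_canonical, E.q_canonical, E.q_canonical,
      h.q_mul]

/-- The cocycles of two extensions have the same symmetrization, so that their sum is symmetric and
hence a coboundary; a primitive of the sum is dual to an isomorphism of coalgebras. -/
theorem IsExtendedSteenrod.coalgebraEquivalent (h : IsExtendedSteenrod symOp E)
    (h' : IsExtendedSteenrod symOp E') : E.CoalgebraEquivalent E' := by
  obtain ⟨V, -, hV, hVmem⟩ := exists_graded_primitive dualRbarGr
    (fun _ _ _ _ hx hv => smul_mem_dualRbarGr hx hv) (h.cocycle.add h'.cocycle)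
    (add_comm_of_symmetrization dualRbar_add_self h.mixedMul_add_swap h'.mixedMul_add_swap)
    (fun _ _ _ _ hx hy => Submodule.add_mem _ (mixedMul_mem E hx hy) (mixedMul_mem E' hx hy))
    (fun _ => 0) (fun _ => Submodule.zero_mem _)
  obtain ⟨g, hg, hgmem⟩ := exists_predual V hVmem
  obtain ⟨e, hp, hq⟩ := E.exists_shear_p E' g
  have hev (u : DualSteenrod × DualRbar) (v : E.carrier) :
      extEval E' u (e v) = extEval E (u.1, u.2 + V u.1) v := by
    rw [extEval_apply, extEval_apply, hp, hq, map_add, hg, map_add, LinearMap.add_apply]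
    abel
  obtain ⟨ψ, hψ⟩ := exists_coalgEquiv e fun v => by
    refine tensor_ext_of_flip_injective (M := DualSteenrod × DualRbar)
      (N := DualSteenrod × DualRbar) (extEval E') (extEval E') (extEval_flip_injective E')
      (extEval_flip_injective E') fun u u' => ?_
    rw [h'.pairing_comul, hev,
      pairing_comp_tmul (extEval E) (extEval E) (extEval E') (extEval E') e.toLinearMap
        e.toLinearMap (u.1, u.2 + V u.1) (u'.1, u'.2 + V u'.1) u u' (hev u) (hev u'),
      h.pairing_comul]
    exact congrArg (fun w => extEval E w v) (pairMul_shear dualRbar_add_self hV u u')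
  refine ⟨ψ, fun a => ?_, fun v => ?_, fun n v hv => ?_⟩
  · refine SingularHopfExtension.ext ?_ ?_
    · rw [hψ, hp, E.q_s, E.p_s, E'.p_s, map_zero, add_zero]
    · rw [hψ, hq, E.q_s, E'.q_s]
  · rw [hψ, hq]
  · rw [E.mem_gr] at hv
    rw [E'.mem_gr, hψ, hp, hq]
    exact ⟨Submodule.add_mem _ hv.1 (hgmem n _ hv.2), hv.2⟩

end
end SteenrodExt

/-! ### Existence of the dual of the extended Steenrod algebra -/

namespace SteenrodExt
open AdemAux GradedAux
noncomputable section

theorem pairing_evalA_evalR_injective : Function.Injective (pairing evalA evalR) :=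
  pairing_injective _ _ isGradedDual_evalA.injective isGradedDual_evalR.injective

theorem pairing_evalR_evalA_injective : Function.Injective (pairing evalR evalA) :=
  pairing_injective _ _ isGradedDual_evalR.injective isGradedDual_evalA.injective

/-- The graded dual of a bilinear map that preserves degrees. -/
theorem exists_coaction (f : Steenrod →ₗ[ZMod 2] Rbar →ₗ[ZMod 2] Rbar)
    (hf : ∀ m n a r, a ∈ steenrodGr m → r ∈ desuspGr n → f a r ∈ desuspGr (m + n)) :
    ∃ t : DualRbar →ₗ[ZMod 2] DualSteenrod ⊗[ZMod 2] DualRbar,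
      (∀ ρ a r, pairing evalA evalR (t ρ) (a ⊗ₜ r) = evalR ρ (f a r)) ∧
      ∀ n, ∀ ρ ∈ dualRbarGr n, t ρ ∈ tensorGr dualSteenrodGr dualRbarGr n := by
  let φ : DualRbar →ₗ[ZMod 2] Module.Dual (ZMod 2) (Steenrod ⊗[ZMod 2] Rbar) :=
    LinearMap.lcomp (ZMod 2) (ZMod 2) (TensorProduct.lift f) ∘ₗ evalR
  have hφ (ρ : DualRbar) : φ ρ ∈ LinearMap.range (pairing evalA evalR) := by
    obtain ⟨N, hN⟩ := ρ.2
    obtain ⟨t, ht⟩ := exists_pairing (𝒰 := steenrodGr) (𝒱 := desuspGr) hasTruncations_steenrodGr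
      (φ ρ) N (fun m n hmn a ha r hr => hN (m + n) hmn _ (hf m n a r ha hr)) desuspProj.top
    let e : gradedDual steenrodGr →ₗ[ZMod 2] DualSteenrod :=
      { toFun := fun f => dualMk f.1 f.2
        map_add' := fun _ _ => rfl
        map_smul' := fun _ _ => rfl }
    refine ⟨TensorProduct.map e LinearMap.id t, ?_⟩
    rw [← ht]
    apply TensorProduct.ext'
    intro a r
    exact pairing_comp (gradedDual steenrodGr).subtype (gradedDual desuspGr).subtype evalA evalR
      e LinearMap.id a r a r (fun _ => rfl) (fun _ => rfl) t
  let t : DualRbar →ₗ[ZMod 2] DualSteenrod ⊗[ZMod 2] DualRbar :=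
    (LinearEquiv.ofInjective _ pairing_evalA_evalR_injective).symm.toLinearMap ∘ₗ
      LinearMap.codRestrict _ φ hφ
  have ht (ρ : DualRbar) (a : Steenrod) (r : Rbar) :
      pairing evalA evalR (t ρ) (a ⊗ₜ r) = evalR ρ (f a r) := by
    have h : pairing evalA evalR (t ρ) = φ ρ :=
      LinearEquiv.ofInjective_symm_apply (f := pairing evalA evalR)
        (h := pairing_evalA_evalR_injective) _
    rw [h]
    rfl
  refine ⟨t, ht, fun n ρ hρ => isGradedDual_evalA.dual_mem_tensorGr isGradedDual_evalR steenrodProj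
    desuspProj fun a b hab u hu v hv => ?_⟩
  rw [ht]
  exact hρ (a + b) hab _ (hf a b u v hu hv)

theorem pairing_comulAux_tmul (x : DualSteenrod) (a b : Steenrod) :
    pairing evalA evalA (DualAlg.comulAux steenrodGr x) (a ⊗ₜ b) = evalA x (a * b) := by
  rw [DualAlg.pairing_comulAux]
  rfl

theorem comulAux_mem {n : ℕ} {x : DualSteenrod} (hx : x ∈ dualSteenrodGr n) :
    DualAlg.comulAux steenrodGr x ∈ tensorGr dualSteenrodGr dualSteenrodGr n :=
  isGradedDual_evalA.dual_mem_tensorGr isGradedDual_evalA steenrodProj steenrodProj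
    fun a b hab u hu v hv => by
      rw [pairing_comulAux_tmul]
      exact hx (a + b) hab _ (steenrodGr_mul_mem hu hv)

/-- The left and the right action of `A` on `Rbar` have graded duals. -/
theorem exists_left_right_coaction :
    ∃ (t : DualRbar →ₗ[ZMod 2] DualSteenrod ⊗[ZMod 2] DualRbar)
      (t' : DualRbar →ₗ[ZMod 2] DualRbar ⊗[ZMod 2] DualSteenrod),
      (∀ ρ a r, pairing evalA evalR (t ρ) (a ⊗ₜ r) = evalR ρ (a • r)) ∧
      (∀ ρ r a, pairing evalR evalA (t' ρ) (r ⊗ₜ a) = evalR ρ (MulOpposite.op a • r)) ∧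
      (∀ n, ∀ ρ ∈ dualRbarGr n, t ρ ∈ tensorGr dualSteenrodGr dualRbarGr n) ∧
      ∀ n, ∀ ρ ∈ dualRbarGr n, t' ρ ∈ tensorGr dualRbarGr dualSteenrodGr n := by
  obtain ⟨t, ht, htm⟩ := exists_coaction
    (LinearMap.mk₂ (ZMod 2) (fun (a : Steenrod) (r : Rbar) => a • r) add_smul
      (fun c a r => smul_assoc c a r) smul_add (fun c a r => smul_comm a c r))
    (fun _ _ _ _ ha hr => smul_mem_desuspGr ha hr)
  obtain ⟨t', ht', -⟩ := exists_coaction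
    (LinearMap.mk₂ (ZMod 2) (fun (a : Steenrod) (r : Rbar) => MulOpposite.op a • r)
      (fun a b r => by rw [MulOpposite.op_add, add_smul])
      (fun c a r => by rw [MulOpposite.op_smul, smul_assoc]) (fun a r s => smul_add _ r s)
      (fun c a r => smul_comm (MulOpposite.op a) c r))
    (fun _ _ _ _ ha hr => op_smul_mem_desuspGr ha hr)
  have hcomm (u : DualSteenrod ⊗[ZMod 2] DualRbar) (r : Rbar) (a : Steenrod) :
      pairing evalR evalA (TensorProduct.comm (ZMod 2) DualSteenrod DualRbar u) (r ⊗ₜ a) =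
        pairing evalA evalR u (a ⊗ₜ r) := by
    induction u with
    | zero => simp
    | add u v hu hv => simp only [map_add, LinearMap.add_apply, hu, hv]
    | tmul x ρ => simp [mul_comm]
  have h' (ρ : DualRbar) (r : Rbar) (a : Steenrod) : pairing evalR evalA
      (((TensorProduct.comm (ZMod 2) DualSteenrod DualRbar).toLinearMap ∘ₗ t') ρ) (r ⊗ₜ a) =
        evalR ρ (MulOpposite.op a • r) := by
    rw [LinearMap.comp_apply, LinearEquiv.coe_coe, hcomm, ht']
    rfl
  refine ⟨t, _, ht, h', htm, fun n ρ hρ => isGradedDual_evalR.dual_mem_tensorGr isGradedDual_evalA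
    desuspProj steenrodProj fun b a hab v hv u hu => ?_⟩
  rw [h']
  exact hρ (a + b) (by omega) _ (op_smul_mem_desuspGr hu hv)

set_option maxHeartbeats 600000 in
theorem exists_dualExtendedSteenrod :
    ∃ E : DualSteenrodExtension, IsDualExtendedSteenrod symOp E := by
  obtain ⟨U, hUl, hUr, hUS, hUmem⟩ := exists_biderivation
  obtain ⟨t, t', ht, ht', htm, htm'⟩ := exists_left_right_coaction
  let c : TwoCocycle (ZMod 2) DualSteenrod DualRbar :=
    ⟨U, fun x y z => by rw [hUl, hUr]; abel⟩
  let j : CocycleExt c →ₗ[ZMod 2] Module.Dual (ZMod 2) (TrivSqZeroExt Steenrod Rbar) := prodEval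
  let Δ : CocycleExt c →ₗ[ZMod 2] CocycleExt c ⊗[ZMod 2] CocycleExt c :=
    TensorProduct.map (CocycleExt.inl c) (CocycleExt.inl c) ∘ₗ DualAlg.comulAux steenrodGr ∘ₗ
      CocycleExt.fst c +
    TensorProduct.map (CocycleExt.inl c) (CocycleExt.inr c) ∘ₗ t ∘ₗ CocycleExt.snd c +
    TensorProduct.map (CocycleExt.inr c) (CocycleExt.inl c) ∘ₗ t' ∘ₗ CocycleExt.snd c
  have hΔ (u : CocycleExt c) : Δ u =
      TensorProduct.map (CocycleExt.inl c) (CocycleExt.inl c)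
        (DualAlg.comulAux steenrodGr (CocycleExt.fst c u)) +
      TensorProduct.map (CocycleExt.inl c) (CocycleExt.inr c) (t (CocycleExt.snd c u)) +
      TensorProduct.map (CocycleExt.inr c) (CocycleExt.inl c) (t' (CocycleExt.snd c u)) := rfl
  have hjl (v : TrivSqZeroExt Steenrod Rbar) (x : DualSteenrod) :
      j (CocycleExt.inl c x) v = evalA x v.fst := by
    change evalA x v.fst + evalR 0 v.snd = _
    rw [map_zero, LinearMap.zero_apply, add_zero]
  have hjr (v : TrivSqZeroExt Steenrod Rbar) (ρ : DualRbar) :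
      j (CocycleExt.inr c ρ) v = evalR ρ v.snd := by
    change evalA 0 v.fst + evalR ρ v.snd = _
    rw [map_zero, LinearMap.zero_apply, zero_add]
  -- The coalgebra axioms hold because `j` embeds the extension in the dual of the semidirect product
  -- of `A` and `Rbar`, with the diagonal adjoint to its product.
  let coalg : Coalgebra (ZMod 2) (CocycleExt c) := coalgebraOfPairing j prodEval_injective Δ
    (DualAlg.counitAux steenrodGr ∘ₗ CocycleExt.fst c)
    (fun u v w => by
      rw [hΔ, map_add, map_add, LinearMap.add_apply, LinearMap.add_apply,
        pairing_comp evalA evalA j j _ _ v w v.fst w.fst (hjl v) (hjl w),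
        pairing_comp evalA evalR j j _ _ v w v.fst w.snd (hjl v) (hjr w),
        pairing_comp evalR evalA j j _ _ v w v.snd w.fst (hjr v) (hjl w),
        pairing_comulAux_tmul, ht, ht']
      change _ = evalA (CocycleExt.fst c u) (v.fst * w.fst) +
        evalR (CocycleExt.snd c u) (v.fst • w.snd + MulOpposite.op w.fst • v.snd)
      rw [map_add, add_assoc])
    (fun u => by
      change evalA (CocycleExt.fst c u) 1 =
        evalA (CocycleExt.fst c u) 1 + evalR (CocycleExt.snd c u) 0
      rw [map_zero, add_zero])
  have hql : CocycleExt.snd c ∘ₗ CocycleExt.inl c = 0 := rfl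
  have hgr {n : ℕ} {u : CocycleExt c} : u ∈ (dualSteenrodGr n).map (CocycleExt.inl c) ⊔
      (dualRbarGr n).map (CocycleExt.inr c) ↔
      CocycleExt.fst c u ∈ dualSteenrodGr n ∧ CocycleExt.snd c u ∈ dualRbarGr n := by
    constructor
    · intro h
      obtain ⟨_, ⟨a, ha, rfl⟩, _, ⟨r, hr, rfl⟩, rfl⟩ := Submodule.mem_sup.1 h
      rw [map_add, map_add, CocycleExt.fst_inl, CocycleExt.fst_inr, CocycleExt.snd_inl,
        CocycleExt.snd_inr, add_zero, zero_add]
      exact ⟨ha, hr⟩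
    · rintro ⟨h1, h2⟩
      rw [← CocycleExt.inl_fst_add_inr_snd u]
      exact Submodule.add_mem_sup ⟨_, h1, rfl⟩ ⟨_, h2, rfl⟩
  have hinl {n : ℕ} : ∀ x ∈ dualSteenrodGr n, CocycleExt.inl c x ∈
      (dualSteenrodGr n).map (CocycleExt.inl c) ⊔ (dualRbarGr n).map (CocycleExt.inr c) :=
    fun x hx => Submodule.mem_sup_left ⟨x, hx, rfl⟩
  have hinr {n : ℕ} : ∀ ρ ∈ dualRbarGr n, CocycleExt.inr c ρ ∈
      (dualSteenrodGr n).map (CocycleExt.inl c) ⊔ (dualRbarGr n).map (CocycleExt.inr c) :=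
    fun ρ hρ => Submodule.mem_sup_right ⟨ρ, hρ, rfl⟩
  have hΔmem {n : ℕ} {u : CocycleExt c} (h1 : CocycleExt.fst c u ∈ dualSteenrodGr n)
      (h2 : CocycleExt.snd c u ∈ dualRbarGr n) : Δ u ∈ tensorGr
        (fun m => (dualSteenrodGr m).map (CocycleExt.inl c) ⊔ (dualRbarGr m).map (CocycleExt.inr c))
        (fun m => (dualSteenrodGr m).map (CocycleExt.inl c) ⊔ (dualRbarGr m).map (CocycleExt.inr c))
        n := by
    rw [hΔ]
    refine Submodule.add_mem _ (Submodule.add_mem _ ?_ ?_) ?_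
    · exact map_tensorGr (fun _ => hinl) (fun _ => hinl) (comulAux_mem h1)
    · exact map_tensorGr (fun _ => hinl) (fun _ => hinr) (htm _ _ h2)
    · exact map_tensorGr (fun _ => hinr) (fun _ => hinl) (htm' _ _ h2)
  have hΔq (u : CocycleExt c) : TensorProduct.map (CocycleExt.snd c) (CocycleExt.snd c) (Δ u) = 0 := by
    rw [hΔ, map_add, map_add, TensorProduct.map_map, TensorProduct.map_map,
      TensorProduct.map_map, hql, TensorProduct.map_zero_left, TensorProduct.map_zero_left,
      TensorProduct.map_zero_right]
    simp only [LinearMap.zero_apply, add_zero]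
  have hΔr (ρ : DualRbar) : Δ (CocycleExt.inr c ρ) =
      TensorProduct.map (CocycleExt.inl c) (CocycleExt.inr c) (t ρ) +
        TensorProduct.map (CocycleExt.inr c) (CocycleExt.inl c) (t' ρ) := by
    rw [hΔ, CocycleExt.fst_inr, CocycleExt.snd_inr, map_zero, map_zero, zero_add]
  have hmr (u : CocycleExt c) (ρ : DualRbar) :
      u * CocycleExt.inr c ρ = CocycleExt.inr c (CocycleExt.fst c u • ρ) :=
    CocycleExt.ext (by simp) (by simp)
  have hrm (ρ : DualRbar) (u : CocycleExt c) :
      CocycleExt.inr c ρ * u = CocycleExt.inr c (CocycleExt.fst c u • ρ) :=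
    CocycleExt.ext (by simp) (by simp)
  have hsym (x y : DualSteenrod) : CocycleExt.inl c y * CocycleExt.inl c x =
      CocycleExt.inl c x * CocycleExt.inl c y + CocycleExt.inr c (dualSym x y) := by
    refine CocycleExt.ext ?_ ?_
    · simp [mul_comm]
    · rw [map_add, CocycleExt.snd_mul, CocycleExt.snd_mul, CocycleExt.snd_inr, ← hUS]
      simp only [CocycleExt.snd_inl, CocycleExt.fst_inl, smul_zero, zero_add]
      change U y x = U x y + (U x y + U y x)
      rw [← add_assoc, dualRbar_add_self, zero_add]
  let E : DualSteenrodExtension :=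
    { carrier := CocycleExt c
      coalgebra := coalg
      i := CocycleExt.inr c
      p := AlgHom.ofLinearMap (CocycleExt.fst c) rfl fun _ _ => rfl
      q := CocycleExt.snd c
      s :=
        { CocycleExt.inl c with
          counit_comp := rfl
          map_comp_comul := LinearMap.ext fun x => by
            change TensorProduct.map (CocycleExt.inl c) (CocycleExt.inl c)
              (DualAlg.comulAux steenrodGr x) = Δ (CocycleExt.inl c x)
            rw [hΔ, CocycleExt.fst_inl, CocycleExt.snd_inl]
            simp only [map_zero, add_zero] }
      p_s := fun _ => rfl
      q_i := fun _ => rfl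
      s_p_add_i_q := CocycleExt.inl_fst_add_inr_snd
      i_mul_i := fun ρ σ => CocycleExt.ext (by simp) (by simp)
      q_comul := hΔq
      mul_mem := fun m n u v hu hv => by
        rw [hgr] at hu hv
        refine hgr.2 ⟨dualSteenrodGr_mul_mem hu.1 hv.1, ?_⟩
        rw [CocycleExt.snd_mul]
        refine Submodule.add_mem _ (Submodule.add_mem _ (smul_mem_dualRbarGr hu.1 hv.2) ?_)
          (hUmem _ _ _ _ hu.1 hv.1)
        rw [add_comm m n]
        exact smul_mem_dualRbarGr hv.1 hu.2
      comul_mem := fun n u hu => by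
        rw [hgr] at hu
        exact hΔmem hu.1 hu.2 }
  refine ⟨E, ⟨fun ρ => ⟨t ρ, t' ρ, ht ρ, ht' ρ, hΔr ρ⟩,
    fun u ρ => ⟨CocycleExt.fst c u • ρ, fun r => evalR_smul _ _ r, hmr u ρ⟩,
    fun ρ u => ⟨CocycleExt.fst c u • ρ, fun r => (pairing_rightCoaction _ _ r).symm, hrm ρ u⟩,
    fun x y => ⟨dualSym x y, fun r => evalR_dualSym x y r, hsym x y⟩⟩⟩

/-! ### Uniqueness of the dual of the extended Steenrod algebra -/

section
variable (E : DualSteenrodExtension)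

/-- The component `A_* × A_* → DualRbar` of the product of an extension. -/
def sectionMul : DualSteenrod →ₗ[ZMod 2] DualSteenrod →ₗ[ZMod 2] DualRbar :=
  ((LinearMap.mul (ZMod 2) E.carrier).compl₁₂ E.s.toLinearMap E.s.toLinearMap).compr₂ E.q

theorem sectionMul_apply (x y : DualSteenrod) : sectionMul E x y = E.q (E.s x * E.s y) := rfl

theorem sectionMul_mem {m n : ℕ} {x y : DualSteenrod} (hx : x ∈ dualSteenrodGr m)
    (hy : y ∈ dualSteenrodGr n) : sectionMul E x y ∈ dualRbarGr (m + n) :=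
  (E.mem_gr.1 (E.mul_mem m n _ _ (E.s_mem hx) (E.s_mem hy))).2

variable {E} {E' : DualSteenrodExtension}

theorem IsDualExtendedSteenrod.mul_i_eq (h : IsDualExtendedSteenrod symOp E) (u : E.carrier)
    (ρ : DualRbar) : u * E.i ρ = E.i (E.p u • ρ) := by
  obtain ⟨ρ', h1, h2⟩ := h.mul_i u ρ
  rw [h2]
  exact congrArg E.i (dualRbar_ext fun r => (h1 r).trans (evalR_smul _ _ r).symm)

theorem IsDualExtendedSteenrod.i_mul_eq (h : IsDualExtendedSteenrod symOp E) (u : E.carrier)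
    (ρ : DualRbar) : E.i ρ * u = E.i (E.p u • ρ) := by
  obtain ⟨ρ', h1, h2⟩ := h.i_mul ρ u
  rw [h2]
  exact congrArg E.i (dualRbar_ext fun r => (h1 r).trans (pairing_rightCoaction _ _ r))

theorem IsDualExtendedSteenrod.coords_mul (h : IsDualExtendedSteenrod symOp E) (u v : E.carrier) :
    E.coords (u * v) = pairMul (sectionMul E) (E.coords u) (E.coords v) := by
  refine Prod.ext (map_mul E.p u v) ?_
  change E.q (u * v) = E.p u • E.q v + E.p v • E.q u + E.q (E.s (E.p u) * E.s (E.p v))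
  conv_lhs => rw [← E.s_p_add_i_q u, ← E.s_p_add_i_q v]
  rw [add_mul, mul_add, mul_add, h.mul_i_eq, h.i_mul_eq, E.i_mul_i, E.p_s, E.p_s, add_zero,
    map_add, map_add, E.q_i, E.q_i]
  abel

theorem IsDualExtendedSteenrod.pairMul_assoc (h : IsDualExtendedSteenrod symOp E)
    (u v w : DualSteenrod × DualRbar) : pairMul (sectionMul E) (pairMul (sectionMul E) u v) w =
      pairMul (sectionMul E) u (pairMul (sectionMul E) v w) := by
  obtain ⟨u, rfl⟩ := E.coords.surjective u
  obtain ⟨v, rfl⟩ := E.coords.surjective v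
  obtain ⟨w, rfl⟩ := E.coords.surjective w
  rw [← h.coords_mul, ← h.coords_mul, ← h.coords_mul, ← h.coords_mul, mul_assoc]

/-- The cocycle that describes the product of the extension. -/
def IsDualExtendedSteenrod.cocycle (h : IsDualExtendedSteenrod symOp E) :
    TwoCocycle (ZMod 2) DualSteenrod DualRbar where
  map := sectionMul E
  cocycle := cocycle_of_pairMul_assoc h.pairMul_assoc

theorem IsDualExtendedSteenrod.sectionMul_add_swap (h : IsDualExtendedSteenrod symOp E)
    (x y : DualSteenrod) : sectionMul E x y + sectionMul E y x = dualSym x y := by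
  obtain ⟨σ, h1, h2⟩ := h.commutation x y
  have hσ : σ = dualSym x y := dualRbar_ext fun r => (h1 r).trans (evalR_dualSym x y r).symm
  rw [sectionMul_apply, sectionMul_apply, h2, map_add, E.q_i, hσ, ← add_assoc, dualRbar_add_self,
    zero_add]

theorem IsDualExtendedSteenrod.sameCoalgebra (h : IsDualExtendedSteenrod symOp E)
    (h' : IsDualExtendedSteenrod symOp E') : E.SameCoalgebra E' := by
  refine SingularHopfExtension.sameCoalgebra_of_map_comul fun u => ?_
  have hs : (E.canonical E').toLinearMap ∘ₗ E.s.toLinearMap = E'.s.toLinearMap :=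
    LinearMap.ext (E.canonical_s E')
  have hi : (E.canonical E').toLinearMap ∘ₗ E.i = E'.i := LinearMap.ext (E.canonical_i E')
  obtain ⟨t, t', ht, ht', hE⟩ := h.comul_i (E.q u)
  obtain ⟨w, w', hw, hw', hE'⟩ := h'.comul_i (E.q u)
  have htw : t = w := pairing_evalA_evalR_injective
    (TensorProduct.ext' fun a r => (ht a r).trans (hw a r).symm)
  have htw' : t' = w' := pairing_evalR_evalA_injective
    (TensorProduct.ext' fun r a => (ht' r a).trans (hw' r a).symm)
  subst htw htw'
  rw [E.comul_eq u, hE, E'.comul_eq (E.canonical E' u), E.p_canonical, E.q_canonical, hE']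
  simp only [map_add, TensorProduct.map_map, hs, hi]

/-- The cocycles of two extensions have the same symmetrization, so that their sum is symmetric and
hence a coboundary; a primitive of the sum gives an isomorphism of algebras. -/
theorem IsDualExtendedSteenrod.algebraEquivalent (h : IsDualExtendedSteenrod symOp E)
    (h' : IsDualExtendedSteenrod symOp E') : E.AlgebraEquivalent E' := by
  obtain ⟨V, -, hV, hVmem⟩ := exists_graded_primitive dualRbarGr
    (fun _ _ _ _ hx hv => smul_mem_dualRbarGr hx hv) (h'.cocycle.add h.cocycle)
    (add_comm_of_symmetrization dualRbar_add_self h'.sectionMul_add_swap h.sectionMul_add_swap)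
    (fun _ _ _ _ hx hy => Submodule.add_mem _ (sectionMul_mem E' hx hy) (sectionMul_mem E hx hy))
    (fun _ => 0) (fun _ => Submodule.zero_mem _)
  obtain ⟨e, hp, hq⟩ := E.exists_shear_q E' V
  have hcoords (u : E.carrier) : E'.coords (e u) = ((E.coords u).1, (E.coords u).2 + V (E.coords u).1) :=
    Prod.ext (hp u) (hq u)
  obtain ⟨ψ, hψ⟩ := exists_algEquiv e fun u v => by
    apply E'.coords.injective
    rw [h'.coords_mul, hcoords, hcoords, hcoords, h.coords_mul]
    exact (pairMul_shear dualRbar_add_self hV _ _).symm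
  refine ⟨ψ, fun ρ => ?_, fun u => ?_, fun n u hu => ?_⟩
  · refine SingularHopfExtension.ext ?_ ?_
    · rw [hψ, hp, E.p_i, E'.p_i]
    · rw [hψ, hq, E.q_i, E'.q_i, E.p_i, map_zero, add_zero]
  · rw [hψ, hp]
  · rw [E.mem_gr] at hu
    rw [E'.mem_gr, hψ, hp, hq]
    exact ⟨hu.1, Submodule.add_mem _ hu.2 (hVmem n _ hu.1)⟩

end

end
end SteenrodExt

theorem theorem7p2 :
    (∃! S : Rbar →ₗ[ZMod 2] Steenrod ⊗[ZMod 2] Steenrod, IsSymmetryOperator S) ∧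
    ∀ S : Rbar →ₗ[ZMod 2] Steenrod ⊗[ZMod 2] Steenrod, IsSymmetryOperator S →
      ((∃ E : SteenrodExtension, IsExtendedSteenrod S E) ∧
        ∀ E E' : SteenrodExtension, IsExtendedSteenrod S E → IsExtendedSteenrod S E' →
          E.SameAlgebra E' ∧ E.CoalgebraEquivalent E') ∧
      ((∃ E : DualSteenrodExtension, IsDualExtendedSteenrod S E) ∧
        ∀ E E' : DualSteenrodExtension, IsDualExtendedSteenrod S E → IsDualExtendedSteenrod S E' →
          E.SameCoalgebra E' ∧ E.AlgebraEquivalent E') := by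
  refine ⟨⟨symOp, isSymmetryOperator_symOp, fun S hS => hS.eq_symOp⟩, fun S hS => ?_⟩
  rw [hS.eq_symOp]
  exact ⟨⟨exists_extendedSteenrod, fun E E' h h' => ⟨h.sameAlgebra h', h.coalgebraEquivalent h'⟩⟩,
    exists_dualExtendedSteenrod, fun E E' h h' => ⟨h.sameCoalgebra h', h.algebraEquivalent h'⟩⟩
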